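/- Let $X$ be a totally disconnected, metrisable, compact space and let $\varphi,\sigma$ be homeomorphisms of $X$ with $\sigma^2=\mathrm{id}$ and $\sigma\varphi\sigma=\varphi^{-1}$. Assume that the set of points of $X$ that are not periodic for $\varphi$ is dense in $X$, and that $\sigma$ does not preserve any $\varphi$-orbit. Assume moreover that $(X,\varphi)$ is (topologically conjugate to) a subshift, that is, a closed shift-invariant subset of $A^{\mathbb Z}$ for a finite alphabet $A$, with $\varphi$ the restriction of the shift. Let the infinite dihedral group $D_\infty=\mathbb Z\rtimes(\mathbb Z/2\mathbb Z)$ act on $X\times\mathbb R$ by $(n,j)\cdot(x,t)=(\varphi^n\sigma^j(x),(-1)^jt-n)$, let $Z=(X\times\mathbb R)/D_\infty$ be the dihedral suspension, with the quotient topology, and let $\pi_Z\colon X\times\mathbb R\to Z$ be the quotient projection. If $C\subset X$ is clopen, $I\subset\mathbb R$ is an open interval and $\pi_Z$ is injective on $C\times I$, then $Z_{C,I}=\pi_Z(C\times I)$ is called a chart. Let $I,J\subset\mathbb R$ be bounded open intervals with endpoints in $\mathbb Z[\frac12]$. For $U\subset I$ open, a map is dyadic PL on $U$ if there is a finite set $\Sigma\subset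 U\cap\mathbb Z[\frac12]$ such that on each connected component of $U\setminus\Sigma$ the map has the form $x\mapsto 2^nx+b$ with $n\in\mathbb Z$, $b\in\mathbb Z[\frac12]$. A homeomorphism $f\colon I\to J$ is of type $\mathfrak D$ if there is a finite set $B\subset I\cap\mathbb Z[\frac12]$ such that every $x\in I\setminus B$ has an open neighbourhood in $I$ on which $f$ is dyadic PL, and every $x_0\in B$ has a neighbourhood $U$ with $f(2(x-x_0)+x_0)=2(f(x)-f(x_0))+f(x_0)$ for all $x\in U$. Let $\mathscr T(\varphi,\sigma)$ be the group of all homeomorphisms $g$ of $Z$ such that for every $z\in Z$ there are charts $Z_{C,I}$ and $Z_{C,J}$ containing $z$ and $g(z)$ respectively, and a homeomorphism $f\colon I\to J$ of type $\mathfrak D$, with $g(Z_{C,I})=Z_{C,J}$ and $g(\pi_Z(x,t))=\pi_Z(x,f(t))$ for all $(x,t)\in C\times I$. Then the group $\mathscr T(\varphi,\sigma)$ is finitely generated. -/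

import Mathlib

open Set Filter Topology

namespace DihedralSuspension

/-! ### Maps of type `𝔇` on the real line -/

/-- Elements of `ℤ[1/2]`. -/
def IsDyadic (x : ℝ) : Prop := ∃ (m : ℤ) (k : ℕ), x = m / 2 ^ k

/-- Open dyadic intervals: nonempty bounded open intervals with endpoints in `ℤ[1/2]`. -/
def IsDyadicInterval (I : Set ℝ) : Prop :=
  ∃ a b : ℝ, IsDyadic a ∧ IsDyadic b ∧ a < b ∧ I = Ioo a b

/-- `f` is dyadic piecewise linear on `U`: there is a finite set `S ⊆ U` of dyadic rationals such
that on each connected component of `U \ S` the map is `x ↦ 2 ^ n * x + b` with `n : ℤ` and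
`b ∈ ℤ[1/2]`. Continuity is not repeated here: this is only used for homeomorphisms. -/
def IsDyadicPLOn (f : ℝ → ℝ) (U : Set ℝ) : Prop :=
  ∃ S : Set ℝ, S.Finite ∧ S ⊆ U ∧ (∀ s ∈ S, IsDyadic s) ∧
    ∀ x ∈ U \ S, ∃ (n : ℤ) (b : ℝ), IsDyadic b ∧
      ∀ s ∈ connectedComponentIn (U \ S) x, f s = 2 ^ n * s + b

/-- The homothety of ratio `2` centred at `x₀`. -/
def doubling (x₀ x : ℝ) : ℝ := 2 * (x - x₀) + x₀

/-- Homeomorphisms of type `𝔇` between open dyadic intervals `I = f.source` and `J = f.target`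
(an `OpenPartialHomeomorph` is precisely a homeomorphism between two open subsets). -/
structure IsTypeD (f : OpenPartialHomeomorph ℝ ℝ) : Prop where
  source_dyadic : IsDyadicInterval f.source
  target_dyadic : IsDyadicInterval f.target
  exists_BP2 : ∃ B : Set ℝ, B.Finite ∧ B ⊆ f.source ∧ (∀ x ∈ B, IsDyadic x) ∧
    (∀ x ∈ f.source \ B, ∃ U : Set ℝ, IsOpen U ∧ x ∈ U ∧ U ⊆ f.source ∧ IsDyadicPLOn f U) ∧
    (∀ x₀ ∈ B, ∃ U ∈ 𝓝 x₀, U ⊆ f.source ∧ MapsTo (doubling x₀) U f.source ∧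
      ∀ x ∈ U, f (doubling x₀ x) = doubling (f x₀) (f x))

/-! ### Auxiliary facts: type `𝔇` maps form a pseudogroup -/

theorem IsDyadic.add {x y : ℝ} (hx : IsDyadic x) (hy : IsDyadic y) : IsDyadic (x + y) := by
  obtain ⟨m, k, rfl⟩ := hx
  obtain ⟨n, l, rfl⟩ := hy
  refine ⟨m * 2 ^ l + n * 2 ^ k, k + l, ?_⟩
  push_cast
  field_simp
  ring

theorem IsDyadic.neg {x : ℝ} (hx : IsDyadic x) : IsDyadic (-x) := by
  obtain ⟨m, k, rfl⟩ := hx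
  exact ⟨-m, k, by push_cast; ring⟩

theorem IsDyadic.sub {x y : ℝ} (hx : IsDyadic x) (hy : IsDyadic y) : IsDyadic (x - y) := by
  rw [sub_eq_add_neg]
  exact hx.add hy.neg

theorem isDyadic_int (n : ℤ) : IsDyadic n := ⟨n, 0, by simp⟩

theorem IsDyadic.pow_mul {x : ℝ} (n : ℤ) (hx : IsDyadic x) : IsDyadic (2 ^ n * x) := by
  obtain ⟨m, k, rfl⟩ := hx
  obtain ⟨p, rfl | rfl⟩ := n.eq_nat_or_neg
  · refine ⟨2 ^ p * m, k, ?_⟩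
    push_cast
    rw [zpow_natCast]
    ring
  · refine ⟨m, k + p, ?_⟩
    rw [zpow_neg, zpow_natCast]
    field_simp
    ring

theorem exists_isDyadic_between {x y : ℝ} (h : x < y) : ∃ d, IsDyadic d ∧ x < d ∧ d < y := by
  obtain ⟨k, hk⟩ := exists_pow_lt_of_lt_one (sub_pos.2 h) (by norm_num : (1 / 2 : ℝ) < 1)
  have h2 : (0 : ℝ) < 2 ^ k := by positivity
  rw [one_div, inv_pow, inv_lt_iff_one_lt_mul₀ h2] at hk
  refine ⟨(⌊x * 2 ^ k⌋ + 1 : ℤ) / 2 ^ k, ⟨_, k, rfl⟩, ?_, ?_⟩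
  · rw [lt_div_iff₀ h2]
    push_cast
    exact Int.lt_floor_add_one _
  · rw [div_lt_iff₀ h2]
    push_cast
    have := Int.floor_le (x * 2 ^ k)
    nlinarith

/-- Local form of the dyadic piecewise linear condition at a point. -/
def PLAt (f : ℝ → ℝ) (t : ℝ) : Prop :=
  (∃ (n : ℤ) (b : ℝ), IsDyadic b ∧ ∀ᶠ s in 𝓝[≤] t, f s = 2 ^ n * s + b) ∧
  (∃ (n : ℤ) (b : ℝ), IsDyadic b ∧ ∀ᶠ s in 𝓝[≥] t, f s = 2 ^ n * s + b) ∧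
  (¬ IsDyadic t → ∃ (n : ℤ) (b : ℝ), IsDyadic b ∧ ∀ᶠ s in 𝓝 t, f s = 2 ^ n * s + b)

theorem eventually_of_sides {p : ℝ → Prop} {t : ℝ} (h1 : ∀ᶠ s in 𝓝[≤] t, p s)
    (h2 : ∀ᶠ s in 𝓝[≥] t, p s) : ∀ᶠ s in 𝓝 t, p s := by
  rw [← nhdsLE_sup_nhdsGE t]
  exact Filter.eventually_sup.2 ⟨h1, h2⟩

theorem plAt_of_isDyadicPLOn {f : ℝ → ℝ} {U : Set ℝ} {t : ℝ} (hU : IsOpen U) (ht : t ∈ U)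
    (hc : ContinuousAt f t) (hf : IsDyadicPLOn f U) : PLAt f t := by
  obtain ⟨S, hSf, -, hSd, hS⟩ := hf
  have hopen : IsOpen (U \ (S \ {t})) := hU.sdiff (hSf.subset sdiff_subset).isClosed
  obtain ⟨l, u, ⟨hl, hu⟩, hlu⟩ := mem_nhds_iff_exists_Ioo_subset.1
    (hopen.mem_nhds ⟨ht, fun h => h.2 rfl⟩)
  have key : ∀ V : Set ℝ, IsPreconnected V → V ⊆ Ioo l u → (t ∈ S → t ∉ V) → V.Nonempty →
      ∃ (n : ℤ) (b : ℝ), IsDyadic b ∧ ∀ s ∈ V, f s = 2 ^ n * s + b := by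
    intro V hV hVI hVt hVn
    have hsub : V ⊆ U \ S := fun s hs =>
      ⟨(hlu (hVI hs)).1, fun h => (hlu (hVI hs)).2 ⟨h, fun e => by
        have e' : s = t := e
        subst e'
        exact hVt h hs⟩⟩
    obtain ⟨x, hx⟩ := hVn
    obtain ⟨n, b, hb, h⟩ := hS x (hsub hx)
    exact ⟨n, b, hb, fun s hs => h s (hV.subset_connectedComponentIn hx hsub hs)⟩
  have side : ∀ V : Set ℝ, t ∈ closure V → (∃ (n : ℤ) (b : ℝ), IsDyadic b ∧
      ∀ s ∈ V, f s = 2 ^ n * s + b) → ∃ (n : ℤ) (b : ℝ), IsDyadic b ∧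
      ∀ s ∈ insert t V, f s = 2 ^ n * s + b := by
    rintro V hV ⟨n, b, hb, h⟩
    refine ⟨n, b, hb, ?_⟩
    have : (𝓝[V] t).NeBot := mem_closure_iff_nhdsWithin_neBot.1 hV
    have h1 : Tendsto f (𝓝[V] t) (𝓝 (f t)) := hc.mono_left nhdsWithin_le_nhds
    have h2 : Tendsto f (𝓝[V] t) (𝓝 (2 ^ n * t + b)) := by
      have : Tendsto (fun s : ℝ => (2 : ℝ) ^ n * s + b) (𝓝[V] t) (𝓝 (2 ^ n * t + b)) :=
        ((by fun_prop : Continuous fun s : ℝ => (2 : ℝ) ^ n * s + b).tendsto t).mono_left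
          nhdsWithin_le_nhds
      exact this.congr' (eventually_nhdsWithin_of_forall fun s hs => (h s hs).symm)
    rintro s (rfl | hs)
    · exact tendsto_nhds_unique h1 h2
    · exact h s hs
  refine ⟨?_, ?_, ?_⟩
  · obtain ⟨n, b, hb, h⟩ := side (Ioo l t) (by
        rw [closure_Ioo hl.ne]
        exact right_mem_Icc.2 hl.le) (key (Ioo l t) isPreconnected_Ioo
      (Ioo_subset_Ioo_right hu.le) (fun _ h => lt_irrefl _ h.2) (nonempty_Ioo.2 hl))
    refine ⟨n, b, hb, ?_⟩
    filter_upwards [Ioc_mem_nhdsLE hl] with s hs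
    rcases hs.2.eq_or_lt with rfl | h'
    · exact h _ (mem_insert _ _)
    · exact h _ (mem_insert_of_mem _ ⟨hs.1, h'⟩)
  · obtain ⟨n, b, hb, h⟩ := side (Ioo t u) (by
        rw [closure_Ioo hu.ne]
        exact left_mem_Icc.2 hu.le) (key (Ioo t u) isPreconnected_Ioo
      (Ioo_subset_Ioo_left hl.le) (fun _ h => lt_irrefl _ h.1) (nonempty_Ioo.2 hu))
    refine ⟨n, b, hb, ?_⟩
    filter_upwards [Ico_mem_nhdsGE hu] with s hs
    rcases hs.1.eq_or_lt with rfl | h'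
    · exact h _ (mem_insert _ _)
    · exact h _ (mem_insert_of_mem _ ⟨h', hs.2⟩)
  · intro hd
    obtain ⟨n, b, hb, h⟩ := key (Ioo l u) isPreconnected_Ioo subset_rfl
      (fun h => absurd (hSd _ h) hd) ⟨t, hl, hu⟩
    exact ⟨n, b, hb, by filter_upwards [Ioo_mem_nhds hl hu] with s hs using h s hs⟩

theorem PLAt.exists_isDyadicPLOn {f : ℝ → ℝ} {t : ℝ} (h : PLAt f t) {W : Set ℝ}
    (hW : W ∈ 𝓝 t) : ∃ U : Set ℝ, IsOpen U ∧ t ∈ U ∧ U ⊆ W ∧ IsDyadicPLOn f U := by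
  obtain ⟨⟨n, b, hb, h1⟩, ⟨m, c, hcd, h2⟩, h3⟩ := h
  by_cases hd : IsDyadic t
  · have h1' : ∀ᶠ s in 𝓝 t, s ≤ t → f s = 2 ^ n * s + b := eventually_nhdsWithin_iff.1 h1
    have h2' : ∀ᶠ s in 𝓝 t, t ≤ s → f s = 2 ^ m * s + c := eventually_nhdsWithin_iff.1 h2
    obtain ⟨l, u, ⟨hl, hu⟩, hlu⟩ := mem_nhds_iff_exists_Ioo_subset.1
      (inter_mem hW (h1'.and h2'))
    refine ⟨Ioo l u, isOpen_Ioo, ⟨hl, hu⟩, fun s hs => (hlu hs).1, {t}, finite_singleton t,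
      by simpa using And.intro hl hu, by simpa using hd, ?_⟩
    intro x hx
    have hxt : x ≠ t := hx.2
    have hpre := isPreconnected_connectedComponentIn (x := x) (F := Ioo l u \ {t})
    have hsub := connectedComponentIn_subset (Ioo l u \ {t}) x
    have hmem := mem_connectedComponentIn hx
    have hno : t ∉ connectedComponentIn (Ioo l u \ {t}) x := fun h => (hsub h).2 rfl
    have hord := hpre.ordConnected
    rcases hxt.lt_or_gt with h | h
    · refine ⟨n, b, hb, fun s hs => (hlu (hsub hs).1).2.1 ?_⟩
      by_contra hst
      exact hno (hord.out hmem hs ⟨h.le, (not_le.1 hst).le⟩)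
    · refine ⟨m, c, hcd, fun s hs => (hlu (hsub hs).1).2.2 ?_⟩
      by_contra hst
      exact hno (hord.out hs hmem ⟨(not_le.1 hst).le, h.le⟩)
  · obtain ⟨n, b, hb, h⟩ := h3 hd
    obtain ⟨U, hU, hUo, htU⟩ := mem_nhds_iff.1 (inter_mem hW h)
    refine ⟨U, hUo, htU, fun s hs => (hU hs).1, ∅, finite_empty, empty_subset _, by simp, ?_⟩
    intro x _
    exact ⟨n, b, hb, fun s hs => (hU (connectedComponentIn_subset _ _ hs).1).2⟩

theorem PLAt.isDyadic_iff {f : ℝ → ℝ} {t : ℝ} (h : PLAt f t) :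
    IsDyadic (f t) ↔ IsDyadic t := by
  obtain ⟨⟨n, b, hb, h1⟩, -, -⟩ := h
  rw [h1.self_of_nhdsWithin self_mem_Iic]
  refine ⟨fun h => ?_, fun h => (h.pow_mul n).add hb⟩
  have := (h.sub hb).pow_mul (-n)
  rwa [add_sub_cancel_right, ← mul_assoc, ← zpow_add₀ two_ne_zero, neg_add_cancel, zpow_zero,
    one_mul] at this

/-- An affine map with slope `2 ^ n` respects neighbourhoods in sub-half-lines. -/
theorem tendsto_side {f : ℝ → ℝ} {t b : ℝ} {n : ℤ} {R : ℝ → Set ℝ} (ht : t ∈ R t)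
    (hR : ∀ s ∈ R t, 2 ^ n * s + b ∈ R (2 ^ n * t + b))
    (h : ∀ᶠ s in 𝓝[R t] t, f s = 2 ^ n * s + b) :
    Tendsto f (𝓝[R t] t) (𝓝[R (f t)] (f t)) := by
  rw [h.self_of_nhdsWithin ht]
  have : Tendsto (fun s : ℝ => (2 : ℝ) ^ n * s + b) (𝓝[R t] t)
      (𝓝[R (2 ^ n * t + b)] (2 ^ n * t + b)) :=
    tendsto_nhdsWithin_of_tendsto_nhds_of_eventually_within _
      (((by fun_prop : Continuous fun s : ℝ => (2 : ℝ) ^ n * s + b).tendsto t).mono_left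
          nhdsWithin_le_nhds) (eventually_nhdsWithin_of_forall hR)
  exact this.congr' (h.mono fun s hs => hs.symm)

theorem affine_comp (n m : ℤ) (b c s : ℝ) :
    (2 : ℝ) ^ m * (2 ^ n * s + b) + c = 2 ^ (m + n) * s + (2 ^ m * b + c) := by
  rw [zpow_add₀ two_ne_zero]
  ring

theorem PLAt.comp {f g : ℝ → ℝ} {t : ℝ} (hg : PLAt g (f t)) (hf : PLAt f t) :
    PLAt (fun s => g (f s)) t := by
  have hd := hf.isDyadic_iff
  obtain ⟨⟨n, b, hb, h1⟩, ⟨n', b', hb', h2⟩, h3⟩ := hf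
  obtain ⟨⟨m, c, hc, k1⟩, ⟨m', c', hc', k2⟩, k3⟩ := hg
  refine ⟨⟨m + n, 2 ^ m * b + c, (hb.pow_mul m).add hc, ?_⟩,
    ⟨m' + n', 2 ^ m' * b' + c', (hb'.pow_mul m').add hc', ?_⟩, fun h => ?_⟩
  · have hp : (0 : ℝ) < 2 ^ n := by positivity
    have := (tendsto_side (R := Iic) self_mem_Iic (fun s hs => by
      simp only [mem_Iic] at hs ⊢
      nlinarith) h1).eventually k1
    filter_upwards [this, h1] with s hs hs'
    rw [hs, hs', affine_comp]
  · have hp : (0 : ℝ) < 2 ^ n' := by positivity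
    have := (tendsto_side (R := Ici) self_mem_Ici (fun s hs => by
      simp only [mem_Ici] at hs ⊢
      nlinarith) h2).eventually k2
    filter_upwards [this, h2] with s hs hs'
    rw [hs, hs', affine_comp]
  · obtain ⟨n, b, hb, h1⟩ := h3 h
    obtain ⟨m, c, hc, k1⟩ := k3 (fun h' => h (hd.1 h'))
    refine ⟨m + n, 2 ^ m * b + c, (hb.pow_mul m).add hc, ?_⟩
    have h1' : ∀ᶠ s in 𝓝[univ] t, f s = 2 ^ n * s + b := by rwa [nhdsWithin_univ]
    have := (tendsto_side (R := fun _ => univ) (mem_univ _) (fun _ _ => mem_univ _) h1')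
    rw [nhdsWithin_univ, nhdsWithin_univ] at this
    filter_upwards [this.eventually k1, h1] with s hs hs'
    rw [hs, hs', affine_comp]

/-- Local form of the condition at the singular points. -/
def SingAt (f : ℝ → ℝ) (t : ℝ) : Prop :=
  IsDyadic t ∧ (∀ᶠ s in 𝓝[≠] t, PLAt f s) ∧
    ∀ᶠ s in 𝓝 t, f (doubling t s) = doubling (f t) (f s)

theorem continuous_doubling (t : ℝ) : Continuous (doubling t) := by
  unfold doubling
  fun_prop

theorem doubling_self (t : ℝ) : doubling t t = t := by simp [doubling]

theorem tendsto_doubling (t : ℝ) : Tendsto (doubling t) (𝓝 t) (𝓝 t) := by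
  simpa only [doubling_self] using (continuous_doubling t).tendsto t

theorem PLAt.eventually_punctured {f : ℝ → ℝ} {t : ℝ} (h : PLAt f t) :
    ∀ᶠ s in 𝓝[≠] t, PLAt f s := by
  obtain ⟨⟨n, b, hb, h1⟩, ⟨m, c, hc, h2⟩, -⟩ := h
  have h1' : ∀ᶠ s in 𝓝 t, s ≤ t → f s = 2 ^ n * s + b := eventually_nhdsWithin_iff.1 h1
  have h2' : ∀ᶠ s in 𝓝 t, t ≤ s → f s = 2 ^ m * s + c := eventually_nhdsWithin_iff.1 h2
  have key : ∀ (s : ℝ) (n : ℤ) (b : ℝ), IsDyadic b → (∀ᶠ r in 𝓝 s, f r = 2 ^ n * r + b) →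
      PLAt f s := fun s n b hb h =>
    ⟨⟨n, b, hb, h.filter_mono nhdsWithin_le_nhds⟩, ⟨n, b, hb, h.filter_mono nhdsWithin_le_nhds⟩,
      fun _ => ⟨n, b, hb, h⟩⟩
  rw [eventually_nhdsWithin_iff]
  filter_upwards [(h1'.and h2').eventually_nhds] with s hs hst
  rcases lt_or_gt_of_ne (show s ≠ t from hst) with h | h
  · refine key s n b hb ?_
    filter_upwards [hs, Iio_mem_nhds h] with r hr hr'
    exact hr.1 (le_of_lt hr')
  · refine key s m c hc ?_
    filter_upwards [hs, Ioi_mem_nhds h] with r hr hr'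
    exact hr.2 (le_of_lt hr')

theorem PLAt.singAt {f : ℝ → ℝ} {t : ℝ} (h : PLAt f t) (ht : IsDyadic t) : SingAt f t := by
  refine ⟨ht, h.eventually_punctured, ?_⟩
  obtain ⟨⟨n, b, hb, h1⟩, ⟨m, c, hc, h2⟩, -⟩ := h
  have e1 := h1.self_of_nhdsWithin self_mem_Iic
  have e2 := h2.self_of_nhdsWithin self_mem_Ici
  have h1' : ∀ᶠ s in 𝓝 t, s ≤ t → f s = 2 ^ n * s + b := eventually_nhdsWithin_iff.1 h1
  have h2' : ∀ᶠ s in 𝓝 t, t ≤ s → f s = 2 ^ m * s + c := eventually_nhdsWithin_iff.1 h2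
  have h3 := h1'.and h2'
  filter_upwards [h3, (tendsto_doubling t).eventually h3] with s hs hds
  rcases le_total s t with h | h
  · rw [hs.1 h, hds.1 (by unfold doubling; linarith), e1]
    unfold doubling
    ring
  · rw [hs.2 h, hds.2 (by unfold doubling; linarith), e2]
    unfold doubling
    ring

theorem tendsto_doubling_punctured (t : ℝ) : Tendsto (doubling t) (𝓝[≠] t) (𝓝[≠] t) := by
  refine tendsto_nhdsWithin_of_tendsto_nhds_of_eventually_within _
    ((tendsto_doubling t).mono_left nhdsWithin_le_nhds)
    (eventually_nhdsWithin_of_forall fun s hs h => hs ?_)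
  have h' : doubling t s = t := h
  unfold doubling at h'
  show s = t
  linarith

theorem SingAt.isDyadic {f : ℝ → ℝ} {t : ℝ} (h : SingAt f t) : IsDyadic (f t) := by
  obtain ⟨ht, h1, h2⟩ := h
  have h3 : ∀ᶠ s in 𝓝 t, s ≠ t → PLAt f s ∧ PLAt f (doubling t s) :=
    eventually_nhdsWithin_iff.1 (h1.and ((tendsto_doubling_punctured t).eventually h1))
  obtain ⟨l, u, ⟨hl, hu⟩, hlu⟩ := mem_nhds_iff_exists_Ioo_subset.1 (h3.and h2)
  obtain ⟨d, hd, htd, hdu⟩ := exists_isDyadic_between hu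
  obtain ⟨h4, h5⟩ := hlu ⟨hl.trans htd, hdu⟩
  obtain ⟨h6, h7⟩ := h4 htd.ne'
  have e : f t = 2 ^ (1 : ℤ) * f d - f (doubling t d) := by
    rw [h5]
    unfold doubling
    rw [zpow_one]
    ring
  rw [e]
  refine ((h6.isDyadic_iff.2 hd).pow_mul 1).sub (h7.isDyadic_iff.2 ?_)
  have : doubling t d = 2 ^ (1 : ℤ) * (d - t) + t := by
    unfold doubling
    rw [zpow_one]
  rw [this]
  exact ((hd.sub ht).pow_mul 1).add ht

/-- Pointwise description of type `𝔇` maps. -/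
theorem isTypeD_iff {f : OpenPartialHomeomorph ℝ ℝ} : IsTypeD f ↔
    IsDyadicInterval f.source ∧ IsDyadicInterval f.target ∧
    (∀ x ∈ f.source, PLAt f x ∨ SingAt f x) ∧ {x ∈ f.source | ¬ PLAt f x}.Finite := by
  constructor
  · rintro ⟨h1, h2, B, hB, hBs, hBd, h3, h4⟩
    have hpl : ∀ x ∈ f.source \ B, PLAt f x := by
      intro x hx
      obtain ⟨U, hU, hxU, -, h⟩ := h3 x hx
      exact plAt_of_isDyadicPLOn hU hxU (f.continuousAt hx.1) h
    refine ⟨h1, h2, fun x hx => ?_, hB.subset fun x hx => ?_⟩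
    · by_cases hxB : x ∈ B
      · right
        obtain ⟨U, hU, -, -, h⟩ := h4 x hxB
        refine ⟨hBd x hxB, ?_, mem_of_superset hU h⟩
        have h5 : f.source \ (B \ {x}) ∈ 𝓝 x :=
          (f.open_source.sdiff (hB.subset sdiff_subset).isClosed).mem_nhds ⟨hx, fun h => h.2 rfl⟩
        rw [eventually_nhdsWithin_iff]
        filter_upwards [h5] with s hs hsx
        exact hpl s ⟨hs.1, fun h => hs.2 ⟨h, hsx⟩⟩
      · exact Or.inl (hpl x ⟨hx, hxB⟩)
    · by_contra hxB
      exact hx.2 (hpl x ⟨hx.1, hxB⟩)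
  · rintro ⟨h1, h2, h3, h4⟩
    refine ⟨h1, h2, _, h4, fun x hx => hx.1,
      fun x hx => ((h3 x hx.1).resolve_left hx.2).1, fun x hx => ?_, fun x hx => ?_⟩
    · have : PLAt f x := by
        by_contra h
        exact hx.2 ⟨hx.1, h⟩
      exact this.exists_isDyadicPLOn (f.open_source.mem_nhds hx.1)
    · have hn := f.open_source.mem_nhds hx.1
      have := ((h3 x hx.1).resolve_left hx.2).2.2
      exact ⟨_, inter_mem hn (inter_mem (tendsto_doubling x hn) this), fun s hs => hs.1,
        fun s hs => hs.2.1, fun s hs => hs.2.2⟩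

theorem IsTypeD.isDyadic_iff {f : OpenPartialHomeomorph ℝ ℝ} (hf : IsTypeD f) {t : ℝ}
    (ht : t ∈ f.source) : IsDyadic (f t) ↔ IsDyadic t := by
  rcases (isTypeD_iff.1 hf).2.2.1 t ht with h | h
  · exact h.isDyadic_iff
  · exact iff_of_true h.isDyadic h.1

theorem exists_dyadic_Icc_subset {W : Set ℝ} {t : ℝ} (hW : W ∈ 𝓝 t) :
    ∃ a b, IsDyadic a ∧ IsDyadic b ∧ a < t ∧ t < b ∧ Icc a b ⊆ W := by
  obtain ⟨l, u, ⟨hl, hu⟩, hlu⟩ := mem_nhds_iff_exists_Ioo_subset.1 hW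
  obtain ⟨a, ha, h1, h2⟩ := exists_isDyadic_between hl
  obtain ⟨b, hb, h3, h4⟩ := exists_isDyadic_between hu
  exact ⟨a, b, ha, hb, h2, h3, fun s hs => hlu ⟨h1.trans_le hs.1, hs.2.trans_lt h4⟩⟩

theorem IsTypeD.exists_restr {f : OpenPartialHomeomorph ℝ ℝ} (hf : IsTypeD f) {a b : ℝ}
    (ha : IsDyadic a) (hb : IsDyadic b) (hab' : a < b) (hab : Icc a b ⊆ f.source) :
    ∃ f' : OpenPartialHomeomorph ℝ ℝ, IsTypeD f' ∧ (⇑f' = f) ∧ (⇑f'.symm = f.symm) ∧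
      f'.source = Ioo a b ∧ f'.target ⊆ f.target := by
  have hcont : ContinuousOn f (Icc a b) := f.continuousOn.mono hab
  have hinj : InjOn f (Icc a b) := f.injOn.mono hab
  have hda : IsDyadic (f a) := (hf.isDyadic_iff (hab (left_mem_Icc.2 hab'.le))).2 ha
  have hdb : IsDyadic (f b) := (hf.isDyadic_iff (hab (right_mem_Icc.2 hab'.le))).2 hb
  have himg : IsDyadicInterval (f '' Ioo a b) := by
    rcases hcont.strictMonoOn_of_injOn_Icc' hab'.le hinj with h | h
    · exact ⟨f a, f b, hda, hdb, h (left_mem_Icc.2 hab'.le) (right_mem_Icc.2 hab'.le) hab',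
        hcont.image_Ioo_of_strictMonoOn hab'.le h⟩
    · exact ⟨f b, f a, hdb, hda, h (left_mem_Icc.2 hab'.le) (right_mem_Icc.2 hab'.le) hab',
        hcont.image_Ioo_of_strictAntiOn hab'.le h⟩
  have hsrc : (f.restrOpen (Ioo a b) isOpen_Ioo).source = Ioo a b := by
    rw [f.restrOpen_source, inter_eq_right]
    exact fun s hs => hab (Ioo_subset_Icc_self hs)
  have hcoe : ⇑(f.restrOpen (Ioo a b) isOpen_Ioo) = f := rfl
  have htgt : (f.restrOpen (Ioo a b) isOpen_Ioo).target = f '' Ioo a b := by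
    rw [← OpenPartialHomeomorph.image_source_eq_target, hsrc, hcoe]
  obtain ⟨-, -, h3, h4⟩ := isTypeD_iff.1 hf
  refine ⟨f.restrOpen (Ioo a b) isOpen_Ioo, isTypeD_iff.2 ⟨?_, ?_, ?_, ?_⟩, hcoe, rfl, hsrc, ?_⟩
  · rw [hsrc]
    exact ⟨a, b, ha, hb, hab', rfl⟩
  · rwa [htgt]
  · rw [hsrc, hcoe]
    exact fun x hx => h3 x (hab (Ioo_subset_Icc_self hx))
  · rw [hsrc, hcoe]
    exact h4.subset fun x hx => ⟨hab (Ioo_subset_Icc_self hx.1), hx.2⟩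
  · rw [htgt]
    rintro _ ⟨s, hs, rfl⟩
    exact f.map_source (hab (Ioo_subset_Icc_self hs))

theorem SingAt.comp {f : OpenPartialHomeomorph ℝ ℝ} {g : ℝ → ℝ} {t : ℝ} (ht : t ∈ f.source)
    (hg : SingAt g (f t)) (hf : SingAt f t) : SingAt (fun s => g (f s)) t := by
  refine ⟨hf.1, ?_, ?_⟩
  · have h1 : Tendsto f (𝓝[≠] t) (𝓝[≠] (f t)) := by
      refine tendsto_nhdsWithin_of_tendsto_nhds_of_eventually_within _
        ((f.continuousAt ht).mono_left nhdsWithin_le_nhds) ?_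
      rw [eventually_nhdsWithin_iff]
      filter_upwards [f.open_source.mem_nhds ht] with s hs hst h
      exact hst (f.injOn hs ht h)
    filter_upwards [h1.eventually hg.2.1, hf.2.1] with s h h' using h.comp h'
  · filter_upwards [(f.continuousAt ht).eventually hg.2.2, hf.2.2] with s h h'
    rw [h', h]

theorem IsTypeD.trans {f g : OpenPartialHomeomorph ℝ ℝ} (hf : IsTypeD f) (hg : IsTypeD g)
    (h : f.target = g.source) : IsTypeD (f.trans' g h) := by
  obtain ⟨f1, f2, f3, f4⟩ := isTypeD_iff.1 hf
  obtain ⟨g1, g2, g3, g4⟩ := isTypeD_iff.1 hg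
  have hm : ∀ x ∈ f.source, f x ∈ g.source := fun x hx => h ▸ f.map_source hx
  have hcoe : ⇑(f.trans' g h) = fun s => g (f s) := rfl
  have hsrc : (f.trans' g h).source = f.source := rfl
  refine isTypeD_iff.2 ⟨f1, g2, ?_, ?_⟩
  · rw [hcoe, hsrc]
    intro x hx
    by_cases hd : IsDyadic x
    · right
      have hd' := (hf.isDyadic_iff hx).2 hd
      exact SingAt.comp hx ((g3 _ (hm x hx)).elim (fun k => k.singAt hd') id)
        ((f3 x hx).elim (fun k => k.singAt hd) id)
    · left
      have hd' := mt (hf.isDyadic_iff hx).1 hd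
      exact ((g3 _ (hm x hx)).resolve_right fun k => hd' k.1).comp
        ((f3 x hx).resolve_right fun k => hd k.1)
  · rw [hcoe, hsrc]
    have : (f.source ∩ f ⁻¹' {y ∈ g.source | ¬ PLAt g y}).Finite := by
      refine Set.Finite.of_finite_image (g4.subset ?_) (f.injOn.mono inter_subset_left)
      rintro _ ⟨x, hx, rfl⟩
      exact hx.2
    refine (f4.union this).subset fun x hx => ?_
    by_cases hfx : PLAt f x
    · exact Or.inr ⟨hx.1, hm x hx.1, fun hgx => hx.2 (hgx.comp hfx)⟩
    · exact Or.inl ⟨hx.1, hfx⟩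

theorem affine_inv (n : ℤ) (b s : ℝ) :
    (2 : ℝ) ^ n * (2 ^ (-n) * s + -(2 ^ (-n) * b)) + b = s := by
  have : (2 : ℝ) ^ n * 2 ^ (-n) = 1 := by
    rw [← zpow_add₀ two_ne_zero, add_neg_cancel, zpow_zero]
  linear_combination (s - b) * this

theorem inv_affine (n : ℤ) (b s : ℝ) :
    (2 : ℝ) ^ (-n) * (2 ^ n * s + b) + -(2 ^ (-n) * b) = s := by
  have : (2 : ℝ) ^ n * 2 ^ (-n) = 1 := by
    rw [← zpow_add₀ two_ne_zero, add_neg_cancel, zpow_zero]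
  linear_combination s * this

theorem PLAt.symm {f : OpenPartialHomeomorph ℝ ℝ} {t : ℝ} (ht : t ∈ f.source)
    (h : PLAt f t) : PLAt f.symm (f t) := by
  have hd := h.isDyadic_iff
  have key : ∀ (R : ℝ → Set ℝ) (n : ℤ) (b : ℝ), IsDyadic b → t ∈ R t →
      (∀ s ∈ R (2 ^ n * t + b), 2 ^ (-n) * s + -(2 ^ (-n) * b) ∈ R t) →
      (∀ᶠ s in 𝓝[R t] t, f s = 2 ^ n * s + b) →
      ∃ (m : ℤ) (c : ℝ), IsDyadic c ∧ ∀ᶠ s in 𝓝[R (f t)] (f t), f.symm s = 2 ^ m * s + c := by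
    intro R n b hb hRt hR hev
    refine ⟨-n, -(2 ^ (-n) * b), (hb.pow_mul _).neg, ?_⟩
    have hev' : ∀ᶠ s in 𝓝[R t] t, s ∈ f.source ∧ f s = 2 ^ n * s + b :=
      (eventually_nhdsWithin_of_eventually_nhds (f.open_source.mem_nhds ht)).and hev
    rw [hev.self_of_nhdsWithin hRt]
    have ht' : Tendsto (fun s : ℝ => (2 : ℝ) ^ (-n) * s + -(2 ^ (-n) * b))
        (𝓝[R (2 ^ n * t + b)] (2 ^ n * t + b)) (𝓝[R t] t) := by
      refine tendsto_nhdsWithin_of_tendsto_nhds_of_eventually_within _ ?_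
        (eventually_nhdsWithin_of_forall hR)
      have := (by fun_prop : Continuous fun s : ℝ => (2 : ℝ) ^ (-n) * s +
        -(2 ^ (-n) * b)).tendsto (2 ^ n * t + b)
      rw [inv_affine] at this
      exact this.mono_left nhdsWithin_le_nhds
    filter_upwards [ht'.eventually hev'] with s hs
    have := f.left_inv hs.1
    rwa [hs.2, affine_inv] at this
  obtain ⟨⟨n, b, hb, h1⟩, ⟨n', b', hb', h2⟩, h3⟩ := h
  refine ⟨key Iic n b hb self_mem_Iic (fun s hs => ?_) h1,
    key Ici n' b' hb' self_mem_Ici (fun s hs => ?_) h2, fun h => ?_⟩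
  · have hp : (0 : ℝ) < 2 ^ (-n) := by positivity
    have := inv_affine n b t
    simp only [mem_Iic] at hs ⊢
    nlinarith
  · have hp : (0 : ℝ) < 2 ^ (-n') := by positivity
    have := inv_affine n' b' t
    simp only [mem_Ici] at hs ⊢
    nlinarith
  · obtain ⟨n, b, hb, h4⟩ := h3 (fun h' => h (hd.2 h'))
    have := key (fun _ => univ) n b hb (mem_univ _) (fun _ _ => mem_univ _)
      (by rwa [nhdsWithin_univ])
    rwa [nhdsWithin_univ] at this

theorem SingAt.symm {f : OpenPartialHomeomorph ℝ ℝ} {t : ℝ} (ht : t ∈ f.source)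
    (h : SingAt f t) : SingAt f.symm (f t) := by
  have ht' : f t ∈ f.target := f.map_source ht
  have hc : Tendsto f.symm (𝓝 (f t)) (𝓝 t) := by
    have := f.continuousAt_symm ht'
    rwa [ContinuousAt, f.left_inv ht] at this
  have htgt := f.open_target.mem_nhds ht'
  refine ⟨h.isDyadic, ?_, ?_⟩
  · have h1 : ∀ᶠ s in 𝓝 t, s ≠ t → PLAt f s := eventually_nhdsWithin_iff.1 h.2.1
    rw [eventually_nhdsWithin_iff]
    filter_upwards [htgt, hc.eventually h1] with s hs hs' hst
    have := (hs' (fun e => hst (by rw [← f.right_inv hs, e]; rfl))).symm (f.map_target hs)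
    rwa [f.right_inv hs] at this
  · have h2 := h.2.2.and ((tendsto_doubling t).eventually (f.open_source.mem_nhds ht))
    filter_upwards [htgt, hc.eventually h2] with s hs hs'
    rw [f.left_inv ht, ← f.left_inv hs'.2, hs'.1, f.right_inv hs]

theorem IsTypeD.symm {f : OpenPartialHomeomorph ℝ ℝ} (hf : IsTypeD f) : IsTypeD f.symm := by
  obtain ⟨f1, f2, f3, f4⟩ := isTypeD_iff.1 hf
  refine isTypeD_iff.2 ⟨f2, f1, fun y hy => ?_, ?_⟩
  · have hs := f.map_target hy
    rw [← f.right_inv hy]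
    exact (f3 _ hs).imp (fun h => h.symm hs) (fun h => h.symm hs)
  · refine (f4.image f).subset fun y hy => ?_
    have hs := f.map_target hy.1
    refine ⟨f.symm y, ⟨hs, fun h => hy.2 ?_⟩, f.right_inv hy.1⟩
    have := h.symm hs
    rwa [f.right_inv hy.1] at this

/-- Conjugating by `γ t = ε t - n`, `ε = ±1`. -/
theorem PLAt.conj {f : ℝ → ℝ} {t ε : ℝ} {n : ℤ} (hε : ε = 1 ∨ ε = -1) (h : PLAt f (ε * t - n)) :
    PLAt (fun s => ε * (f (ε * s - n) + n)) t := by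
  have hεε : ε * ε = 1 := by rcases hε with rfl | rfl <;> norm_num
  have hcont : Tendsto (fun s : ℝ => ε * s - n) (𝓝 t) (𝓝 (ε * t - n)) :=
    (by fun_prop : Continuous fun s : ℝ => ε * s - n).tendsto t
  have hdyad : ∀ b : ℝ, IsDyadic b → IsDyadic (ε * b) := by
    rcases hε with rfl | rfl
    · simp
    · exact fun b hb => by simpa using hb.neg
  have key : ∀ (V W : Set ℝ), (∀ s ∈ V, ε * s - n ∈ W) →
      (∃ (k : ℤ) (b : ℝ), IsDyadic b ∧ ∀ᶠ s in 𝓝[W] (ε * t - n), f s = 2 ^ k * s + b) →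
      ∃ (k : ℤ) (b : ℝ), IsDyadic b ∧
        ∀ᶠ s in 𝓝[V] t, ε * (f (ε * s - n) + n) = 2 ^ k * s + b := by
    rintro V W hVW ⟨k, b, hb, hev⟩
    refine ⟨k, ε * (b + n - 2 ^ k * n),
      hdyad _ ((hb.add (isDyadic_int n)).sub ((isDyadic_int n).pow_mul k)), ?_⟩
    have := tendsto_nhdsWithin_of_tendsto_nhds_of_eventually_within _
      (hcont.mono_left nhdsWithin_le_nhds) (eventually_nhdsWithin_of_forall hVW)
    filter_upwards [this.eventually hev] with s hs
    rw [hs]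
    linear_combination (2 : ℝ) ^ k * s * hεε
  obtain ⟨h1, h2, h3⟩ := h
  have h4 : ¬ IsDyadic t → ∃ (k : ℤ) (b : ℝ), IsDyadic b ∧
      ∀ᶠ s in 𝓝 t, ε * (f (ε * s - n) + n) = 2 ^ k * s + b := by
    intro hd
    have := key univ univ (fun _ _ => mem_univ _) (by
      rw [nhdsWithin_univ]
      refine h3 fun h' => hd ?_
      have := hdyad _ (h'.add (isDyadic_int n))
      rwa [sub_add_cancel, ← mul_assoc, hεε, one_mul] at this)
    rwa [nhdsWithin_univ] at this
  rcases hε with rfl | rfl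
  · exact ⟨key _ _ (fun s hs => by simp only [mem_Iic] at *; linarith) h1,
      key _ _ (fun s hs => by simp only [mem_Ici] at *; linarith) h2, h4⟩
  · exact ⟨key _ _ (fun s hs => by simp only [mem_Iic, mem_Ici] at *; linarith) h2,
      key _ _ (fun s hs => by simp only [mem_Iic, mem_Ici] at *; linarith) h1, h4⟩

theorem SingAt.conj {f : ℝ → ℝ} {t ε : ℝ} {n : ℤ} (hε : ε = 1 ∨ ε = -1)
    (h : SingAt f (ε * t - n)) : SingAt (fun s => ε * (f (ε * s - n) + n)) t := by
  have hεε : ε * ε = 1 := by rcases hε with rfl | rfl <;> norm_num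
  have hcont : Tendsto (fun s : ℝ => ε * s - n) (𝓝 t) (𝓝 (ε * t - n)) :=
    (by fun_prop : Continuous fun s : ℝ => ε * s - n).tendsto t
  obtain ⟨h1, h2, h3⟩ := h
  refine ⟨?_, ?_, ?_⟩
  · have := h1.add (isDyadic_int n)
    rw [sub_add_cancel] at this
    rcases hε with rfl | rfl
    · simpa using this
    · simpa using this.neg
  · rw [eventually_nhdsWithin_iff] at h2 ⊢
    filter_upwards [hcont.eventually h2] with s hs hst
    refine (hs fun e => hst ?_).conj hε
    have e' : ε * s - n = ε * t - n := e
    have : s = t := by linear_combination ε * e' - (s - t) * hεε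
    exact this
  · filter_upwards [hcont.eventually h3] with s hs
    have e : ε * doubling t s - n = doubling (ε * t - n) (ε * s - n) := by
      unfold doubling
      ring
    rw [e, hs]
    unfold doubling
    ring

theorem IsDyadicInterval.preimage {I : Set ℝ} (hI : IsDyadicInterval I) {ε : ℝ} {n : ℤ}
    (hε : ε = 1 ∨ ε = -1) : IsDyadicInterval {s | ε * s - n ∈ I} := by
  obtain ⟨a, b, ha, hb, hab, rfl⟩ := hI
  rcases hε with rfl | rfl
  · refine ⟨a + n, b + n, ha.add (isDyadic_int n), hb.add (isDyadic_int n), by linarith, ?_⟩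
    ext s
    simp only [mem_ofPred_eq, mem_Ioo]
    constructor <;> rintro ⟨h1, h2⟩ <;> constructor <;> linarith
  · refine ⟨-(b + n), -(a + n), (hb.add (isDyadic_int n)).neg, (ha.add (isDyadic_int n)).neg,
      by linarith, ?_⟩
    ext s
    simp only [mem_ofPred_eq, mem_Ioo]
    constructor <;> rintro ⟨h1, h2⟩ <;> constructor <;> linarith

theorem IsTypeD.exists_conj {f : OpenPartialHomeomorph ℝ ℝ} (hf : IsTypeD f) {ε : ℝ} {n : ℤ}
    (hε : ε = 1 ∨ ε = -1) : ∃ f' : OpenPartialHomeomorph ℝ ℝ, IsTypeD f' ∧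
      f'.source = {s | ε * s - n ∈ f.source} ∧ f'.target = {s | ε * s - n ∈ f.target} ∧
      ∀ s, f' s = ε * (f (ε * s - n) + n) := by
  have hεε : ε * ε = 1 := by rcases hε with rfl | rfl <;> norm_num
  let γ : ℝ ≃ₜ ℝ :=
    { toFun := fun s => ε * s - n
      invFun := fun s => ε * (s + n)
      left_inv := fun s => by linear_combination s * hεε
      right_inv := fun s => by linear_combination (s + n) * hεε
      continuous_toFun := by fun_prop
      continuous_invFun := by fun_prop }
  obtain ⟨f1, f2, f3, f4⟩ := isTypeD_iff.1 hf
  let f' := (γ.transOpenPartialHomeomorph f).transHomeomorph γ.symm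
  have hsrc : f'.source = {s | ε * s - n ∈ f.source} := rfl
  have htgt : f'.target = {s | ε * s - n ∈ f.target} := rfl
  have hcoe : ⇑f' = fun s => ε * (f (ε * s - n) + n) := rfl
  refine ⟨f', isTypeD_iff.2 ⟨?_, ?_, ?_, ?_⟩, hsrc, htgt, fun s => rfl⟩
  · rw [hsrc]
    exact f1.preimage hε
  · rw [htgt]
    exact f2.preimage hε
  · rw [hsrc, hcoe]
    exact fun x hx => (f3 _ hx).imp (fun h => h.conj hε) (fun h => h.conj hε)
  · rw [hsrc, hcoe]
    have : (γ ⁻¹' {y ∈ f.source | ¬ PLAt f y}).Finite := f4.preimage γ.injective.injOn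
    exact this.subset fun x hx => ⟨hx.1, fun h => hx.2 (PLAt.conj hε h)⟩

theorem isTypeD_refl {I : Set ℝ} (hI : IsDyadicInterval I) (ho : IsOpen I) :
    IsTypeD (OpenPartialHomeomorph.ofSet I ho) := by
  have h : ∀ x : ℝ, PLAt id x := fun x =>
    have h0 : ∀ s : ℝ, id s = 2 ^ (0 : ℤ) * s + 0 := fun s => by simp
    have hd : IsDyadic 0 := by simpa using isDyadic_int 0
    ⟨⟨0, 0, hd, Eventually.of_forall h0⟩, ⟨0, 0, hd, Eventually.of_forall h0⟩,
      fun _ => ⟨0, 0, hd, Eventually.of_forall h0⟩⟩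
  refine isTypeD_iff.2 ⟨hI, hI, fun x _ => Or.inl (h x), ?_⟩
  convert finite_empty (α := ℝ)
  ext x
  simp only [mem_ofPred_eq, mem_empty_iff_false, iff_false, not_and, not_not]
  exact fun _ => h x

/-! ### Reversible systems and their dihedral suspension -/

/-- Homeomorphisms `φ`, `σ` of `X` with `σ² = id` and `σ φ σ = φ⁻¹`. -/
structure ReversibleSystem (X : Type*) [TopologicalSpace X] where
  φ : X ≃ₜ X
  σ : X ≃ₜ X
  σ_σ : ∀ x, σ (σ x) = x
  σ_φ_σ : ∀ x, σ (φ (σ x)) = φ.symm x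

namespace ReversibleSystem

variable {X : Type*} [TopologicalSpace X] (S : ReversibleSystem X)

/-- The standing assumption on `(X, φ, σ)`. -/
structure StandingAssumption : Prop where
  compact : CompactSpace X
  metrizable : TopologicalSpace.MetrizableSpace X
  totallyDisconnected : TotallyDisconnectedSpace X
  /-- The non-periodic points of `φ` are dense. -/
  topologicallyFree : Dense {x : X | x ∉ Function.periodicPts S.φ}
  /-- `σ` does not preserve any `φ`-orbit. -/
  not_preserve_orbit : ∀ (x : X) (n : ℤ), S.σ x ≠ (S.φ ^ n) x

/-- `(X, φ)` is (conjugate to) a subshift: a closed shift-invariant subset of `A ^ ℤ` for a finite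
discrete alphabet `A`, with the restriction of the shift. -/
def IsSubshift : Prop :=
  ∃ (k : ℕ) (ι : X → ℤ → Fin k), IsClosedEmbedding ι ∧ ∀ x n, ι (S.φ x) n = ι x (n + 1)

theorem σ_zpow (n : ℤ) (x : X) : S.σ ((S.φ ^ n) x) = (S.φ ^ (-n)) (S.σ x) := by
  have h1 : ∀ x, S.σ (S.φ x) = S.φ.symm (S.σ x) := fun x => by
    have := S.σ_φ_σ (S.σ x)
    rwa [S.σ_σ] at this
  have h2 : S.σ * S.φ * S.σ⁻¹ = S.φ⁻¹ := by
    rw [mul_inv_eq_iff_eq_mul]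
    ext x
    exact h1 x
  have h3 : S.σ * S.φ ^ n * S.σ⁻¹ = S.φ ^ (-n) := by
    rw [← conj_zpow, h2, inv_zpow']
  rw [mul_inv_eq_iff_eq_mul] at h3
  exact DFunLike.congr_fun h3 x

theorem zpow_zpow (m n : ℤ) (x : X) : (S.φ ^ m) ((S.φ ^ n) x) = (S.φ ^ (m + n)) x := by
  rw [zpow_add]
  rfl

/-- The orbit equivalence relation on `X × ℝ` of the diagonal action of the infinite dihedral group
`ℤ ⋊ ℤ/2`, given by `(n, j) • (x, t) = (φ ^ n (σ ^ j x), (-1) ^ j * t - n)`. -/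
def dihedralSetoid : Setoid (X × ℝ) where
  r p q := ∃ n : ℤ, q = ((S.φ ^ n) p.1, p.2 - n) ∨ q = ((S.φ ^ n) (S.σ p.1), -p.2 - n)
  iseqv := by
    refine ⟨fun p => ⟨0, Or.inl (by simp)⟩, ?_, ?_⟩
    · rintro ⟨x, t⟩ q ⟨n, rfl | rfl⟩
      · refine ⟨-n, Or.inl ?_⟩
        simp
      · refine ⟨n, Or.inr ?_⟩
        simp [σ_zpow, S.σ_σ]
    · rintro ⟨x, t⟩ q r ⟨n, rfl | rfl⟩ ⟨m, rfl | rfl⟩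
      · refine ⟨m + n, Or.inl ?_⟩
        simp only [zpow_zpow, Prod.mk.injEq, true_and]
        push_cast
        ring
      · refine ⟨m - n, Or.inr ?_⟩
        simp only [zpow_zpow, σ_zpow, Prod.mk.injEq, sub_eq_add_neg, true_and]
        push_cast
        ring
      · refine ⟨m + n, Or.inr ?_⟩
        simp only [zpow_zpow, Prod.mk.injEq, true_and]
        push_cast
        ring
      · refine ⟨m - n, Or.inl ?_⟩
        simp only [zpow_zpow, σ_zpow, S.σ_σ, Prod.mk.injEq, sub_eq_add_neg, true_and]
        push_cast
        ring

/-- The dihedral suspension `Z = (X × ℝ) / D_∞`, with the quotient topology. -/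
def Z : Type _ := Quotient S.dihedralSetoid

instance : TopologicalSpace S.Z := inferInstanceAs (TopologicalSpace (Quotient S.dihedralSetoid))

/-- The quotient projection `X × ℝ → Z`. -/
def proj (p : X × ℝ) : S.Z := Quotient.mk S.dihedralSetoid p

/-- The pair `(C, I)` defines a chart: `C` is clopen, `I` is an open interval, and the projection
is injective on `C × I`. Its image is the chart `Z_{C, I}`. -/
def IsChart (C : Set X) (I : Set ℝ) : Prop :=
  IsClopen C ∧ IsOpen I ∧ I.OrdConnected ∧ InjOn S.proj (C ×ˢ I)

/-- The set `Z_{C, I}`. -/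
def chartSet (C : Set X) (I : Set ℝ) : Set S.Z := S.proj '' (C ×ˢ I)

/-- The homeomorphisms of `Z` which in suitable charts around every point are of the form
`(x, t) ↦ (x, f t)` with `f : I → J` of type `𝔇`. -/
def IsTypeDHomeo (g : S.Z ≃ₜ S.Z) : Prop :=
  ∀ z : S.Z, ∃ (C : Set X) (f : OpenPartialHomeomorph ℝ ℝ), IsTypeD f ∧
    S.IsChart C f.source ∧ S.IsChart C f.target ∧
    z ∈ S.chartSet C f.source ∧ g z ∈ S.chartSet C f.target ∧
    g '' S.chartSet C f.source = S.chartSet C f.target ∧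
    ∀ x ∈ C, ∀ t ∈ f.source, g (S.proj (x, t)) = S.proj (x, f t)

theorem proj_eq_iff {p q : X × ℝ} : S.proj p = S.proj q ↔
    ∃ n : ℤ, q = ((S.φ ^ n) p.1, p.2 - n) ∨ q = ((S.φ ^ n) (S.σ p.1), -p.2 - n) :=
  Quotient.eq (r := S.dihedralSetoid)

/-- A chart may be moved by an element of the infinite dihedral group. -/
theorem exists_isometry {p q : X × ℝ} (h : S.proj p = S.proj q) :
    ∃ (ψ : X ≃ₜ X) (ε : ℝ) (n : ℤ), (ε = 1 ∨ ε = -1) ∧ q = (ψ p.1, ε * p.2 - n) ∧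
      ∀ r : X × ℝ, S.proj (ψ r.1, ε * r.2 - n) = S.proj r := by
  obtain ⟨n, h | h⟩ := S.proj_eq_iff.1 h
  · exact ⟨S.φ ^ n, 1, n, Or.inl rfl, by simpa using h, fun r =>
      (S.proj_eq_iff.2 ⟨n, Or.inl (by simp)⟩).symm⟩
  · exact ⟨S.φ ^ n * S.σ, -1, n, Or.inr rfl, by simpa using h, fun r =>
      (S.proj_eq_iff.2 ⟨n, Or.inr (by simp)⟩).symm⟩

variable {S}

theorem IsChart.mono {C C' : Set X} {I I' : Set ℝ} (h : S.IsChart C I) (hC : IsClopen C')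
    (hI : IsDyadicInterval I') (hCC : C' ⊆ C) (hII : I' ⊆ I) : S.IsChart C' I' := by
  obtain ⟨a, b, -, -, -, rfl⟩ := hI
  exact ⟨hC, isOpen_Ioo, ordConnected_Ioo, h.2.2.2.mono (prod_mono hCC hII)⟩

theorem image_chartSet {g : S.Z → S.Z} {C : Set X} {f : OpenPartialHomeomorph ℝ ℝ}
    (h : ∀ x ∈ C, ∀ t ∈ f.source, g (S.proj (x, t)) = S.proj (x, f t)) :
    g '' S.chartSet C f.source = S.chartSet C f.target := by
  ext z
  constructor
  · rintro ⟨_, ⟨⟨x, t⟩, ⟨hx, ht⟩, rfl⟩, rfl⟩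
    exact ⟨(x, f t), ⟨hx, f.map_source ht⟩, (h x hx t ht).symm⟩
  · rintro ⟨⟨x, t⟩, ⟨hx, ht⟩, rfl⟩
    refine ⟨S.proj (x, f.symm t), ⟨(x, f.symm t), ⟨hx, f.map_target ht⟩, rfl⟩, ?_⟩
    rw [h x hx _ (f.map_target ht), f.right_inv ht]

theorem StandingAssumption.exists_chart (hS : S.StandingAssumption) (x : X) (t : ℝ) :
    ∃ (C : Set X) (I : Set ℝ), S.IsChart C I ∧ IsDyadicInterval I ∧ x ∈ C ∧ t ∈ I := by
  have := hS.compact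
  have := hS.metrizable
  have := hS.totallyDisconnected
  obtain ⟨a, b, ha, hb, hat, htb, hab⟩ := exists_dyadic_Icc_subset
    (Ioo_mem_nhds (by linarith : t - 1 / 8 < t) (by linarith : t < t + 1 / 8))
  have ha' := (hab (left_mem_Icc.2 (hat.trans htb).le)).1
  have hb' := (hab (right_mem_Icc.2 (hat.trans htb).le)).2
  set m : ℤ := round (-2 * t)
  let ψ : X ≃ₜ X := S.φ ^ m * S.σ
  have hne : ψ x ≠ x := fun h => by
    have h' : (S.φ ^ m) (S.σ x) = x := h
    refine hS.not_preserve_orbit x (-m) ?_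
    conv_rhs => rw [← h']
    rw [zpow_zpow, neg_add_cancel, zpow_zero]
    rfl
  obtain ⟨U, V, hU, hV, hxU, hxV, hUV⟩ := t2_separation hne
  obtain ⟨C, hC, hxC, hCs⟩ := compact_exists_isClopen_in_isOpen
    ((hU.preimage ψ.continuous).inter hV) ⟨hxU, hxV⟩
  refine ⟨C, Ioo a b, ⟨hC, isOpen_Ioo, ordConnected_Ioo, ?_⟩, ⟨a, b, ha, hb, hat.trans htb, rfl⟩,
    hxC, hat, htb⟩
  rintro ⟨y, s⟩ ⟨hy, hs⟩ ⟨y', s'⟩ ⟨hy', hs'⟩ h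
  simp only [mem_Ioo] at hy hs hy' hs'
  obtain ⟨n, h | h⟩ := S.proj_eq_iff.1 h
  · simp only [Prod.mk.injEq] at h
    have h1 : |(n : ℝ)| < 1 := by
      rw [abs_lt]
      constructor <;> linarith [h.2]
    have h2 : n = 0 := by
      have : |n| < 1 := by exact_mod_cast h1
      exact Int.abs_lt_one_iff.1 this
    subst h2
    simp only [zpow_zero, Int.cast_zero, sub_zero] at h
    exact Prod.ext h.1.symm h.2.symm
  · exfalso
    simp only [Prod.mk.injEq] at h
    have h1 := abs_le.1 (abs_sub_round (-2 * t))
    have h2 : |((n - m : ℤ) : ℝ)| < 1 := by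
      push_cast
      rw [abs_lt]
      constructor <;> linarith [h.2, h1.1, h1.2]
    have h3 : n = m := by
      have : |n - m| < 1 := by exact_mod_cast h2
      have := Int.abs_lt_one_iff.1 this
      omega
    subst h3
    have h4 : y' ∈ U := by
      rw [h.1]
      exact (hCs hy).1
    exact disjoint_left.1 hUV h4 (hCs hy').2

theorem StandingAssumption.isTypeDHomeo_one (hS : S.StandingAssumption) :
    S.IsTypeDHomeo 1 := by
  intro z
  obtain ⟨⟨x, t⟩, rfl⟩ := Quotient.exists_rep z
  obtain ⟨C, I, hCI, hI, hx, ht⟩ := hS.exists_chart x t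
  refine ⟨C, OpenPartialHomeomorph.ofSet I hCI.2.1, isTypeD_refl hI _, hCI, hCI,
    ⟨(x, t), ⟨hx, ht⟩, rfl⟩, ⟨(x, t), ⟨hx, ht⟩, rfl⟩, ?_, fun _ _ _ _ => rfl⟩
  exact image_id _

theorem IsTypeDHomeo.inv {g : S.Z ≃ₜ S.Z} (hg : S.IsTypeDHomeo g) : S.IsTypeDHomeo g⁻¹ := by
  intro z
  obtain ⟨C, f, hf, h1, h2, h3, h4, h5, h6⟩ := hg (g⁻¹ z)
  have hgz : g (g⁻¹ z) = z := g.apply_symm_apply z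
  rw [hgz] at h4
  have h7 : ∀ x ∈ C, ∀ t ∈ f.symm.source, g⁻¹ (S.proj (x, t)) = S.proj (x, f.symm t) := by
    intro x hx t ht
    have h8 := h6 x hx (f.symm t) (f.map_target ht)
    rw [f.right_inv ht] at h8
    rw [← h8]
    exact g.symm_apply_apply _
  exact ⟨C, f.symm, hf.symm, h2, h1, h4, h3, image_chartSet h7, h7⟩

theorem IsTypeDHomeo.mul {g h : S.Z ≃ₜ S.Z} (hg : S.IsTypeDHomeo g) (hh : S.IsTypeDHomeo h) :
    S.IsTypeDHomeo (g * h) := by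
  intro z
  obtain ⟨C, f, hf, f1, f2, ⟨⟨x, t⟩, ⟨hx, ht⟩, rfl⟩, -, -, f6⟩ := hh z
  simp only at hx ht
  obtain ⟨C', k, hk, k1, k2, ⟨⟨x', t'⟩, ⟨hx', ht'⟩, hxt'⟩, -, -, k6⟩ := hg (h (S.proj (x, t)))
  simp only at hx' ht'
  rw [f6 x hx t ht] at hxt'
  -- move the chart of `g` so that it contains `(x, f t)`
  obtain ⟨ψ, ε, n, hε, hq, hψ⟩ := S.exists_isometry hxt'.symm
  simp only [Prod.mk.injEq] at hq
  obtain ⟨rfl, rfl⟩ := hq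
  obtain ⟨l, hl, l1, l2, l3⟩ := hk.exists_conj (n := n) hε
  have hεε : ε * ε = 1 := by rcases hε with rfl | rfl <;> norm_num
  have l4 : ∀ y ∈ ψ ⁻¹' C', ∀ s ∈ l.source, g (S.proj (y, s)) = S.proj (y, l s) := by
    intro y hy s hs
    rw [l1] at hs
    rw [← hψ (y, s), k6 _ hy _ hs, ← hψ (y, l s), l3]
    congr 2
    linear_combination -(k (ε * s - n) + n) * hεε
  have hlt : f t ∈ l.source := by
    rw [l1]
    exact ht'
  -- shrink so that the maps can be composed
  obtain ⟨a, b, ha, hb, hat, htb, hab⟩ := exists_dyadic_Icc_subset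
    (inter_mem (f.open_target.mem_nhds (f.map_source ht)) (l.open_source.mem_nhds hlt))
  obtain ⟨f', hf', -, c1, c2, c3⟩ := hf.symm.exists_restr ha hb (hat.trans htb)
    fun s hs => (hab hs).1
  obtain ⟨l', hl', d1, -, d2, d3⟩ := hl.exists_restr ha hb (hat.trans htb)
    fun s hs => (hab hs).2
  have hcomp : f'.symm.target = l'.source := c2.trans d2.symm
  have hF := hf'.symm.trans hl' hcomp
  have hD : IsClopen (C ∩ ψ ⁻¹' C') := f1.1.inter (k1.1.preimage ψ.continuous)
  have e1 : ∀ s ∈ f'.target, f s ∈ l.source := by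
    intro s hs
    have := f'.map_target hs
    rw [c1, c2] at this
    exact (hab (Ioo_subset_Icc_self this)).2
  have e2 : t ∈ f'.target := by
    have h1 : f t ∈ f'.source := by
      rw [c2]
      exact ⟨hat, htb⟩
    have h2 := f'.map_source h1
    have h3 : f' (f t) = t := by
      have := f'.left_inv h1
      rw [c1] at this
      exact f.injOn (c3 h2) ht this
    rwa [h3] at h2
  have hchart : S.IsChart (C ∩ ψ ⁻¹' C') l'.target := by
    obtain ⟨u, v, -, -, -, huv⟩ := hl'.target_dyadic
    refine ⟨hD, huv ▸ isOpen_Ioo, huv ▸ ordConnected_Ioo, ?_⟩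
    rintro ⟨y, s⟩ ⟨hy, hs⟩ ⟨y', s'⟩ ⟨hy', hs'⟩ he
    rw [← hψ (y, s), ← hψ (y', s')] at he
    have h1 : ε * s - n ∈ k.target := by
      have := d3 hs
      rwa [l2] at this
    have h2 : ε * s' - n ∈ k.target := by
      have := d3 hs'
      rwa [l2] at this
    have := k2.2.2.2 (mk_mem_prod (show ψ y ∈ C' from hy.2) h1)
      (mk_mem_prod (show ψ y' ∈ C' from hy'.2) h2) he
    simp only [Prod.mk.injEq] at this
    exact Prod.ext (ψ.injective this.1) (by linear_combination ε * this.2 - (s - s') * hεε)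
  have hform : ∀ y ∈ C ∩ ψ ⁻¹' C', ∀ s ∈ (f'.symm.trans' l' hcomp).source,
      (g * h) (S.proj (y, s)) = S.proj (y, (f'.symm.trans' l' hcomp) s) := by
    intro y hy s hs
    have h1 : s ∈ f'.target := hs
    have h2 : (f'.symm.trans' l' hcomp) s = l (f s) := by
      have : (f'.symm.trans' l' hcomp) s = l' (f'.symm s) := rfl
      rw [this, d1, c1]
      rfl
    have h3 : (g * h) (S.proj (y, s)) = g (h (S.proj (y, s))) := rfl
    rw [h2, h3, f6 y hy.1 s (c3 h1), l4 y hy.2 _ (e1 s h1)]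
  have hmem : (x, t) ∈ (C ∩ ψ ⁻¹' C') ×ˢ (f'.symm.trans' l' hcomp).source := ⟨⟨hx, hx'⟩, e2⟩
  have himg := image_chartSet hform
  have hz : S.proj (x, t) ∈ S.chartSet (C ∩ ψ ⁻¹' C') (f'.symm.trans' l' hcomp).source :=
    ⟨(x, t), hmem, rfl⟩
  exact ⟨C ∩ ψ ⁻¹' C', f'.symm.trans' l' hcomp, hF,
    f1.mono hD hF.source_dyadic inter_subset_left c3, hchart, hz,
    himg ▸ mem_image_of_mem _ hz, himg, hform⟩

variable (S)

/-- The group `𝒯(φ, σ)` of type `𝔇` homeomorphisms of the dihedral suspension. -/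
def typeDGroup (hS : S.StandingAssumption) : Subgroup (S.Z ≃ₜ S.Z) where
  carrier := {g | S.IsTypeDHomeo g}
  mul_mem' := IsTypeDHomeo.mul
  one_mem' := hS.isTypeDHomeo_one
  inv_mem' := IsTypeDHomeo.inv

end ReversibleSystem

end DihedralSuspension

namespace DihedralSuspension

open scoped commutatorElement

/-! ### Type `𝔇` order automorphisms of the line -/

/-! Three facts combine. Every element decomposes into pieces living in two kinds of boxes. The
group of type `𝔇` automorphisms of an interval is finitely generated and perfect, up to shrinking
supports. In a subshift, all clopen sets arise from one finite cover by shifts, finite intersections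
and finite unions.

One dimension. Compactly supported dyadic PL automorphisms lie in the derived subgroup of a copy of
Thompson's group F generated by two elements (`mem_commutator_lineGroup`, carried to bounded
intervals by `exists_PLOn_le_commutator`). A one-sided singular germ is a PL map of (0, ∞) commuting
with t ↦ 2t, that is, a lift of a homeomorphism of the circle (0, ∞)/(t ∼ 2t). The group of these
lifts is generated by the elements that are trivial near one base point, together with their
conjugates, which are trivial near a second one; this makes it finitely generated and perfect
(`exists_rightCone_generators`, `rightCone_le_commutator`). Removing singular points one at a time
(`TDOn_le_of_germGroup`) gives `exists_TDOn_generators` and `TDOn_le_commutator`.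

Fragmentation. Density of the non-periodic points and the absence of `σ`-invariant orbits make every
element lift uniquely to X × ℝ along the leaves, equivariantly under the dihedral group; the lift is
locally constant in x over compact sets of times. Boxes of length one are centred at the reflection
centres 0 and 1/2. Pushing alternately in the two boxes brings `lift g x 0` closer to 0 by a
definite amount, uniformly in x, until it lies within 1/4 of 0. Then the germs at time 0 can be
matched by an element of the first box, and the quotient is trivial near all integer times, hence
supported in the second box (`typeDGroup_le`).

Amplification. Take a finite clopen cover refining the partition by the letter at position 0 and,
over each member, finitely many generators for a few overlapping windows of time. If one element
acts by f over E and another by k over E', their commutator acts by the commutator of f and k over E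
∩ E'; by perfectness every automorphism becomes available over E ∩ E' (`GoodOn.inter`). Conjugation
inside windows moves supports along the flow, and moving by one unit of time replaces E by a
translate under `φ` (`GoodCover.zpow`). So all cylinders, hence all clopen sets, are reached
(`GoodCover.goodOn_of_isClopen`), and overlapping windows glue to the two boxes
(`GoodCover.boxFull`). -/

theorem PLAt.congr {f g : ℝ → ℝ} {t : ℝ} (h : PLAt f t) (e : f =ᶠ[𝓝 t] g) : PLAt g t := by
  obtain ⟨⟨n, b, hb, h1⟩, ⟨m, c, hc, h2⟩, h3⟩ := h
  refine ⟨⟨n, b, hb, ?_⟩, ⟨m, c, hc, ?_⟩, fun ht => ?_⟩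
  · filter_upwards [h1, e.filter_mono nhdsWithin_le_nhds] with s hs hs'
    rw [← hs', hs]
  · filter_upwards [h2, e.filter_mono nhdsWithin_le_nhds] with s hs hs'
    rw [← hs', hs]
  · obtain ⟨k, d, hd, h4⟩ := h3 ht
    refine ⟨k, d, hd, ?_⟩
    filter_upwards [h4, e] with s hs hs'
    rw [← hs', hs]

theorem SingAt.congr {f g : ℝ → ℝ} {t : ℝ} (h : SingAt f t) (e : f =ᶠ[𝓝 t] g) : SingAt g t := by
  refine ⟨h.1, ?_, ?_⟩
  · filter_upwards [h.2.1, e.eventually_nhds.filter_mono nhdsWithin_le_nhds] with s hs hs'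
    exact hs.congr hs'
  · filter_upwards [h.2.2, e, (tendsto_doubling t).eventually e] with s hs h1 h2
    rw [← h1, ← h2, hs, e.self_of_nhds]

/-- The pointwise type `𝔇` condition. -/
def TDAt (f : ℝ → ℝ) (t : ℝ) : Prop := PLAt f t ∨ SingAt f t

theorem TDAt.congr {f g : ℝ → ℝ} {t : ℝ} (h : TDAt f t) (e : f =ᶠ[𝓝 t] g) : TDAt g t :=
  h.imp (fun h => h.congr e) fun h => h.congr e

theorem TDAt.isDyadic_iff {f : ℝ → ℝ} {t : ℝ} (h : TDAt f t) : IsDyadic (f t) ↔ IsDyadic t :=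
  h.elim (fun h => h.isDyadic_iff) fun h => iff_of_true h.isDyadic h.1

theorem TDAt.singAt {f : ℝ → ℝ} {t : ℝ} (h : TDAt f t) (ht : IsDyadic t) : SingAt f t :=
  h.elim (fun h => h.singAt ht) id

theorem TDAt.plAt {f : ℝ → ℝ} {t : ℝ} (h : TDAt f t) (ht : ¬ IsDyadic t) : PLAt f t :=
  h.elim id fun h => absurd h.1 ht

theorem TDAt.eventually_plAt {f : ℝ → ℝ} {t : ℝ} (h : TDAt f t) : ∀ᶠ s in 𝓝[≠] t, PLAt f s :=
  h.elim (fun h => h.eventually_punctured) fun h => h.2.1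

/-- Whether `t` is dyadic separates the two alternatives: at a dyadic point a PL germ also satisfies
the singular condition, and at any other point only the PL alternative is possible. Mixed
compositions therefore never occur. -/
theorem TDAt.comp {f : ℝ → ℝ} {g : ℝ ≃o ℝ} {t : ℝ} (hf : TDAt f (g t)) (hg : TDAt g t) :
    TDAt (fun s => f (g s)) t := by
  by_cases hd : IsDyadic t
  · exact Or.inr (SingAt.comp (f := g.toHomeomorph.toOpenPartialHomeomorph) (mem_univ t)
      (hf.singAt (hg.isDyadic_iff.2 hd)) (hg.singAt hd))
  · exact Or.inl ((hf.plAt (mt hg.isDyadic_iff.1 hd)).comp (hg.plAt hd))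

theorem PLAt.orderIso_symm {g : ℝ ≃o ℝ} {t : ℝ} (h : PLAt g t) : PLAt g.symm (g t) :=
  PLAt.symm (f := g.toHomeomorph.toOpenPartialHomeomorph) (mem_univ t) h

theorem TDAt.orderIso_symm {g : ℝ ≃o ℝ} {t : ℝ} (h : TDAt g t) : TDAt g.symm (g t) :=
  h.imp (fun h => h.orderIso_symm) fun h =>
    SingAt.symm (f := g.toHomeomorph.toOpenPartialHomeomorph) (mem_univ t) h

theorem isDyadic_zero : IsDyadic 0 := by simpa using isDyadic_int 0

theorem plAt_of_affine {f : ℝ → ℝ} {t b : ℝ} {n : ℤ} (hb : IsDyadic b)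
    (h : ∀ᶠ s in 𝓝 t, f s = 2 ^ n * s + b) : PLAt f t :=
  ⟨⟨n, b, hb, h.filter_mono nhdsWithin_le_nhds⟩, ⟨n, b, hb, h.filter_mono nhdsWithin_le_nhds⟩,
    fun _ => ⟨n, b, hb, h⟩⟩

theorem plAt_id (t : ℝ) : PLAt (fun s => s) t :=
  plAt_of_affine (n := 0) isDyadic_zero (Eventually.of_forall fun s => by simp)

/-- Order automorphisms of the line which are dyadic piecewise linear at every point. -/
def PL : Subgroup (ℝ ≃o ℝ) where
  carrier := {f | ∀ t, PLAt f t}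
  mul_mem' hf hg t := (hf _).comp (hg t)
  one_mem' := plAt_id
  inv_mem' := by
    intro f hf t
    have := (hf (f.symm t)).orderIso_symm
    rwa [f.apply_symm_apply] at this

/-- Order automorphisms of the line which are of type `𝔇` at every point. -/
def TD : Subgroup (ℝ ≃o ℝ) where
  carrier := {f | ∀ t, TDAt f t}
  mul_mem' hf hg t := TDAt.comp (hf _) (hg t)
  one_mem' := fun t => Or.inl (plAt_id t)
  inv_mem' := by
    intro f hf t
    have := (hf (f.symm t)).orderIso_symm
    rwa [f.apply_symm_apply] at this

theorem PL_le_TD : PL ≤ TD := fun _ hf t => Or.inl (hf t)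

/-- Order automorphisms of the line supported in `(a, b)`. -/
def suppIn (a b : ℝ) : Subgroup (ℝ ≃o ℝ) where
  carrier := {f | ∀ t ∉ Ioo a b, f t = t}
  mul_mem' := by
    intro f g hf hg t ht
    have h : f (g t) = t := by rw [hg t ht, hf t ht]
    exact h
  one_mem' := fun t _ => rfl
  inv_mem' := by
    intro f hf t ht
    have h : f.symm t = t := by rw [f.symm_apply_eq, hf t ht]
    exact h

theorem suppIn_mono {a b a' b' : ℝ} (ha : a' ≤ a) (hb : b ≤ b') : suppIn a b ≤ suppIn a' b' :=
  fun _ hf t ht => hf t fun h => ht ⟨ha.trans_lt h.1, h.2.trans_le hb⟩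

theorem suppIn_mem_Ioo {a b : ℝ} {f : ℝ ≃o ℝ} (hf : f ∈ suppIn a b) {t : ℝ} :
    f t ∈ Ioo a b ↔ t ∈ Ioo a b := by
  have ha := hf a (by simp)
  have hb := hf b (by simp)
  constructor <;> rintro ⟨h1, h2⟩
  · rw [← ha] at h1
    rw [← hb] at h2
    exact ⟨f.lt_iff_lt.1 h1, f.lt_iff_lt.1 h2⟩
  · rw [← ha, ← hb]
    exact ⟨f.lt_iff_lt.2 h1, f.lt_iff_lt.2 h2⟩

theorem suppIn_mem_Icc {a b : ℝ} {f : ℝ ≃o ℝ} (hf : f ∈ suppIn a b) {t : ℝ} :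
    f t ∈ Icc a b ↔ t ∈ Icc a b := by
  have ha := hf a (by simp)
  have hb := hf b (by simp)
  constructor <;> rintro ⟨h1, h2⟩
  · rw [← ha] at h1
    rw [← hb] at h2
    exact ⟨f.le_iff_le.1 h1, f.le_iff_le.1 h2⟩
  · rw [← ha, ← hb]
    exact ⟨f.le_iff_le.2 h1, f.le_iff_le.2 h2⟩

/-- Dyadic piecewise linear automorphisms supported in `(a, b)`. -/
def PLOn (a b : ℝ) : Subgroup (ℝ ≃o ℝ) := PL ⊓ suppIn a b

/-- Type `𝔇` automorphisms supported in `(a, b)`. -/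
def TDOn (a b : ℝ) : Subgroup (ℝ ≃o ℝ) := TD ⊓ suppIn a b

theorem PLOn_le_TDOn (a b : ℝ) : PLOn a b ≤ TDOn a b := inf_le_inf_right _ PL_le_TD

theorem mem_PLOn {a b : ℝ} {f : ℝ ≃o ℝ} : f ∈ PLOn a b ↔ f ∈ PL ∧ f ∈ suppIn a b := Iff.rfl

theorem mem_TDOn {a b : ℝ} {f : ℝ ≃o ℝ} : f ∈ TDOn a b ↔ f ∈ TD ∧ f ∈ suppIn a b := Iff.rfl

theorem PLOn_le_PL (a b : ℝ) : PLOn a b ≤ PL := inf_le_left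

theorem PLOn_le_suppIn (a b : ℝ) : PLOn a b ≤ suppIn a b := inf_le_right

theorem TDOn_le_TD (a b : ℝ) : TDOn a b ≤ TD := inf_le_left

theorem TDOn_le_suppIn (a b : ℝ) : TDOn a b ≤ suppIn a b := inf_le_right

theorem PLOn_mono {a b a' b' : ℝ} (ha : a' ≤ a) (hb : b ≤ b') : PLOn a b ≤ PLOn a' b' :=
  inf_le_inf_left _ (suppIn_mono ha hb)

theorem TDOn_mono {a b a' b' : ℝ} (ha : a' ≤ a) (hb : b ≤ b') : TDOn a b ≤ TDOn a' b' :=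
  inf_le_inf_left _ (suppIn_mono ha hb)

theorem isDyadic_apply {f : ℝ ≃o ℝ} (hf : f ∈ TD) {t : ℝ} : IsDyadic (f t) ↔ IsDyadic t :=
  (hf t).isDyadic_iff

/-- The map `t ↦ 2 ^ n * t + b`. -/
noncomputable def affineIso (n : ℤ) (b : ℝ) : ℝ ≃o ℝ where
  toFun t := 2 ^ n * t + b
  invFun t := 2 ^ (-n) * t + -(2 ^ (-n) * b)
  left_inv := inv_affine n b
  right_inv := affine_inv n b
  map_rel_iff' := by
    intro s t
    have : (0 : ℝ) < 2 ^ n := by positivity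
    simp [this]

@[simp] theorem affineIso_apply (n : ℤ) (b t : ℝ) : affineIso n b t = 2 ^ n * t + b := rfl

theorem affineIso_mem (n : ℤ) {b : ℝ} (hb : IsDyadic b) : affineIso n b ∈ PL :=
  fun _ => plAt_of_affine hb (Eventually.of_forall fun _ => rfl)

/-! ### Gluing automorphisms at dyadic points -/

/-- The map equal to `u` on `(-∞, p]` and to `v` on `(p, ∞)`. -/
noncomputable def glueFun (p : ℝ) (u v : ℝ → ℝ) (t : ℝ) : ℝ := if t ≤ p then u t else v t

theorem glueFun_of_le {p t : ℝ} {u v : ℝ → ℝ} (h : t ≤ p) : glueFun p u v t = u t := if_pos h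

theorem glueFun_of_lt {p t : ℝ} {u v : ℝ → ℝ} (h : p < t) : glueFun p u v t = v t :=
  if_neg h.not_ge

theorem glueFun_of_ge {p t : ℝ} {u v : ℝ → ℝ} (e : u p = v p) (h : p ≤ t) :
    glueFun p u v t = v t := by
  rcases h.eq_or_lt with rfl | h
  · rw [glueFun_of_le le_rfl, e]
  · exact glueFun_of_lt h

theorem glueFun_eventuallyEq_left {p t : ℝ} (u v : ℝ → ℝ) (h : t < p) :
    u =ᶠ[𝓝 t] glueFun p u v := by
  filter_upwards [Iio_mem_nhds h] with s hs
  exact (glueFun_of_le (le_of_lt hs)).symm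

theorem glueFun_eventuallyEq_right {p t : ℝ} (u v : ℝ → ℝ) (h : p < t) :
    v =ᶠ[𝓝 t] glueFun p u v := by
  filter_upwards [Ioi_mem_nhds h] with s hs
  exact (glueFun_of_lt hs).symm

theorem plAt_glueFun {p t : ℝ} {u v : ℝ → ℝ} (hp : IsDyadic p) (e : u p = v p)
    (hu : t ≤ p → PLAt u t) (hv : p ≤ t → PLAt v t) : PLAt (glueFun p u v) t := by
  rcases lt_trichotomy t p with h | rfl | h
  · exact (hu h.le).congr (glueFun_eventuallyEq_left u v h)
  · obtain ⟨n, b, hb, h1⟩ := (hu le_rfl).1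
    obtain ⟨m, c, hc, h2⟩ := (hv le_rfl).2.1
    refine ⟨⟨n, b, hb, ?_⟩, ⟨m, c, hc, ?_⟩, fun h => absurd hp h⟩
    · filter_upwards [h1, self_mem_nhdsWithin] with s hs hs'
      rw [glueFun_of_le hs', hs]
    · filter_upwards [h2, self_mem_nhdsWithin] with s hs hs'
      rw [glueFun_of_ge e hs', hs]
  · exact (hv h.le).congr (glueFun_eventuallyEq_right u v h)

/-- The homothety centred at `p` preserves each side of `p`. Two germs satisfying the doubling
relation at `p` with a common value there can thus be glued freely, and PL germs at a dyadic point
satisfy this relation too. -/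
theorem tdAt_glueFun {p t : ℝ} {u v : ℝ → ℝ} (hp : IsDyadic p) (e : u p = v p)
    (hu : t ≤ p → TDAt u t) (hv : p ≤ t → TDAt v t) : TDAt (glueFun p u v) t := by
  rcases lt_trichotomy t p with h | rfl | h
  · exact (hu h.le).congr (glueFun_eventuallyEq_left u v h)
  · obtain ⟨-, h1, h2⟩ := (hu le_rfl).singAt hp
    obtain ⟨-, h3, h4⟩ := (hv le_rfl).singAt hp
    refine Or.inr ⟨hp, ?_, ?_⟩
    · filter_upwards [h1, h3, self_mem_nhdsWithin] with s hs hs' hst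
      rcases lt_or_gt_of_ne (show s ≠ t from hst) with h | h
      · exact hs.congr (glueFun_eventuallyEq_left u v h)
      · exact hs'.congr (glueFun_eventuallyEq_right u v h)
    · filter_upwards [h2, h4] with s hs hs'
      rw [glueFun_of_le le_rfl]
      rcases le_total s t with h | h
      · rw [glueFun_of_le h, glueFun_of_le (by unfold doubling; linarith), hs]
      · rw [glueFun_of_ge e h, glueFun_of_ge e (by unfold doubling; linarith), hs', e]
  · exact (hv h.le).congr (glueFun_eventuallyEq_right u v h)

/-- Gluing of order automorphisms. -/
noncomputable def glueIso (p : ℝ) (f g : ℝ ≃o ℝ) (h : f p = g p) : ℝ ≃o ℝ :=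
  StrictMono.orderIsoOfRightInverse (glueFun p f g) (by
    intro s t hst
    rcases le_or_gt t p with h1 | h1
    · rw [glueFun_of_le h1, glueFun_of_le (hst.le.trans h1)]
      exact f.strictMono hst
    · rw [glueFun_of_lt h1]
      rcases le_or_gt s p with h2 | h2
      · rw [glueFun_of_le h2]
        exact (f.monotone h2).trans_lt (h ▸ g.strictMono h1)
      · rw [glueFun_of_lt h2]
        exact g.strictMono hst) (glueFun (f p) f.symm g.symm) (by
    intro t
    rcases le_or_gt t (f p) with h1 | h1
    · rw [glueFun_of_le h1, glueFun_of_le (f.symm_apply_le.2 h1), f.apply_symm_apply]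
    · rw [glueFun_of_lt h1, glueFun_of_lt (g.lt_symm_apply.2 (h ▸ h1)), g.apply_symm_apply])

@[simp] theorem coe_glueIso (p : ℝ) (f g : ℝ ≃o ℝ) (h : f p = g p) :
    ⇑(glueIso p f g h) = glueFun p f g := rfl

theorem glueIso_mem_PL {p : ℝ} {f g : ℝ ≃o ℝ} {h : f p = g p} (hp : IsDyadic p) (hf : f ∈ PL)
    (hg : g ∈ PL) : glueIso p f g h ∈ PL :=
  fun _ => plAt_glueFun hp h (fun _ => hf _) fun _ => hg _

theorem glueIso_mem_TD {p : ℝ} {f g : ℝ ≃o ℝ} {h : f p = g p} (hp : IsDyadic p) (hf : f ∈ TD)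
    (hg : g ∈ TD) : glueIso p f g h ∈ TD :=
  fun _ => tdAt_glueFun hp h (fun _ => hf _) fun _ => hg _

theorem one_apply (t : ℝ) : (1 : ℝ ≃o ℝ) t = t := rfl

theorem one_zero_eq : (1 : ℝ ≃o ℝ) 0 = affineIso 1 0 0 := by simp [one_apply]

theorem glueIso_one_eq : glueIso 0 1 (affineIso 1 0) one_zero_eq 1 = affineIso 0 1 1 := by
  rw [coe_glueIso, glueFun_of_lt one_pos]
  norm_num

/-- The map which is the identity on the negative half-line, `t ↦ 2 * t` on `[0, 1]`, and
`t ↦ t + 1` on `[1, ∞)`. -/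
noncomputable def stretch : ℝ ≃o ℝ :=
  glueIso 1 (glueIso 0 1 (affineIso 1 0) one_zero_eq) (affineIso 0 1) glueIso_one_eq

theorem isDyadic_one : IsDyadic 1 := by simpa using isDyadic_int 1

theorem stretch_mem : stretch ∈ PL :=
  glueIso_mem_PL isDyadic_one (glueIso_mem_PL isDyadic_zero (one_mem _)
    (affineIso_mem 1 isDyadic_zero)) (affineIso_mem 0 isDyadic_one)

theorem stretch_of_nonpos {t : ℝ} (h : t ≤ 0) : stretch t = t := by
  unfold stretch
  rw [coe_glueIso, glueFun_of_le (by linarith), coe_glueIso, glueFun_of_le h]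
  rfl

theorem stretch_of_mem {t : ℝ} (h : 0 ≤ t) (h' : t ≤ 1) : stretch t = 2 * t := by
  unfold stretch
  rw [coe_glueIso, glueFun_of_le h', coe_glueIso, glueFun_of_ge one_zero_eq h]
  simp

theorem stretch_of_ge {t : ℝ} (h : 1 ≤ t) : stretch t = t + 1 := by
  unfold stretch
  rw [coe_glueIso, glueFun_of_ge glueIso_one_eq h]
  simp

theorem stretch_pow_zero (j : ℕ) : (stretch ^ j) 0 = 0 := by
  induction j with
  | zero => rfl
  | succ j ih =>
    rw [pow_succ', RelIso.mul_apply, ih, stretch_of_nonpos le_rfl]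

theorem stretch_pow_of_ge (j : ℕ) {t : ℝ} (h : 1 ≤ t) : (stretch ^ j) t = t + j := by
  induction j with
  | zero => simp
  | succ j ih =>
    rw [pow_succ', RelIso.mul_apply, ih, stretch_of_ge (by linarith [j.cast_nonneg (α := ℝ)])]
    push_cast
    ring

theorem exists_mem_PL_nat {m n : ℕ} (hm : 1 ≤ m) (hn : 1 ≤ n) :
    ∃ f ∈ PL, f 0 = 0 ∧ f (m : ℝ) = n := by
  have hm' : (1 : ℝ) ≤ m := by exact_mod_cast hm
  have hn' : (1 : ℝ) ≤ n := by exact_mod_cast hn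
  rcases le_total m n with h | h
  · refine ⟨stretch ^ (n - m), pow_mem stretch_mem _, stretch_pow_zero _, ?_⟩
    rw [stretch_pow_of_ge _ hm', Nat.cast_sub h]
    ring
  · refine ⟨(stretch ^ (m - n)).symm, inv_mem (pow_mem stretch_mem _), ?_, ?_⟩
    · rw [OrderIso.symm_apply_eq, stretch_pow_zero]
    · rw [OrderIso.symm_apply_eq, stretch_pow_of_ge _ hn', Nat.cast_sub h]
      ring

/-- After rescaling by powers of 2 both lengths are positive integers, and `stretch` increases an
integer length by one. -/
theorem exists_mem_PL {a b c d : ℝ} (ha : IsDyadic a) (hb : IsDyadic b) (hc : IsDyadic c)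
    (hd : IsDyadic d) (hab : a < b) (hcd : c < d) : ∃ f ∈ PL, f a = c ∧ f b = d := by
  have key : ∀ x : ℝ, IsDyadic x → 0 < x → ∃ (m : ℕ) (k : ℤ), 1 ≤ m ∧ 2 ^ k * x = m := by
    rintro x ⟨m, k, rfl⟩ hx
    have hm : 0 < m := by
      have : (0 : ℝ) < m := by
        by_contra h
        exact absurd hx (not_lt.2 (div_nonpos_of_nonpos_of_nonneg (not_lt.1 h) (by positivity)))
      exact_mod_cast this
    lift m to ℕ using hm.le
    refine ⟨m, k, by exact_mod_cast hm, ?_⟩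
    rw [zpow_natCast]
    push_cast
    field_simp
  obtain ⟨m, k, hm, hmk⟩ := key (b - a) (hb.sub ha) (sub_pos.2 hab)
  obtain ⟨n, l, hn, hnl⟩ := key (d - c) (hd.sub hc) (sub_pos.2 hcd)
  obtain ⟨f, hf, f0, fm⟩ := exists_mem_PL_nat hm hn
  have e : (2 : ℝ) ^ (-l) * n = d - c := by
    rw [← hnl, ← mul_assoc, ← zpow_add₀ two_ne_zero]
    simp
  refine ⟨affineIso (-l) c * f * affineIso k (-(2 ^ k * a)), mul_mem (mul_mem
    (affineIso_mem _ hc) hf) (affineIso_mem _ (ha.pow_mul k).neg), ?_, ?_⟩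
  · simp [RelIso.mul_apply, f0]
  · have : (2 : ℝ) ^ k * b + -(2 ^ k * a) = m := by rw [← hmk]; ring
    simp only [RelIso.mul_apply, affineIso_apply, this, fm, e]
    ring

/-- Cutting off an automorphism outside an interval. -/
theorem exists_cutoff {a b s r : ℝ} {v : ℝ ≃o ℝ} (ha : IsDyadic a) (hb : IsDyadic b)
    (hs : IsDyadic s) (hr : IsDyadic r) (has : a < s) (hsr : s ≤ r) (hrb : r < b)
    (hav : a < v s) (hvb : v r < b) (hv : ∀ t ∈ Icc s r, TDAt v t) :
    ∃ u ∈ TDOn a b, (∀ t ∈ Icc s r, u t = v t) ∧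
      ∀ t, (t ∈ Icc s r → PLAt v t) → PLAt u t := by
  -- The cut-off is `k` on `[a, s]`, `v` on `[s, r]`, `l` on `[r, b]`, and the identity elsewhere.
  -- As `k` and `l` are PL, it can only be singular at a point of `[s, r]` where `v` is.
  obtain ⟨k, hk, ka, ks⟩ := exists_mem_PL ha hs ha
    ((hv s (left_mem_Icc.2 hsr)).isDyadic_iff.2 hs) has hav
  obtain ⟨l, hl, lr, lb⟩ := exists_mem_PL hr hb
    ((hv r (right_mem_Icc.2 hsr)).isDyadic_iff.2 hr) hb hrb hvb
  have e3 : l b = (1 : ℝ ≃o ℝ) b := lb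
  let g3 := glueIso b l 1 e3
  have e2 : v r = g3 r := by
    rw [coe_glueIso, glueFun_of_le hrb.le, lr]
  let g2 := glueIso r v g3 e2
  have e1 : k s = g2 s := by
    rw [coe_glueIso, glueFun_of_le hsr, ks]
  let g1 := glueIso s k g2 e1
  have e0 : (1 : ℝ ≃o ℝ) a = g1 a := by
    rw [coe_glueIso, glueFun_of_le has.le, ka]
    rfl
  refine ⟨glueIso a 1 g1 e0, ⟨fun t => ?_, fun t ht => ?_⟩, fun t ht => ?_, fun t ht => ?_⟩
  · refine tdAt_glueFun ha e0 (fun _ => Or.inl (plAt_id t)) fun _ => tdAt_glueFun hs e1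
      (fun _ => Or.inl (hk t)) fun h1 => tdAt_glueFun hr e2 (fun h2 => hv t ⟨h1, h2⟩) fun _ =>
      tdAt_glueFun hb e3 (fun _ => Or.inl (hl t)) fun _ => Or.inl (plAt_id t)
  · rw [coe_glueIso]
    rcases le_or_gt t a with h | h
    · rw [glueFun_of_le h]
      rfl
    · have h' : b ≤ t := not_lt.1 fun h' => ht ⟨h, h'⟩
      rw [glueFun_of_lt h, coe_glueIso, glueFun_of_lt (by linarith), coe_glueIso,
        glueFun_of_lt (by linarith), coe_glueIso, glueFun_of_ge e3 h']
      rfl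
  · rw [coe_glueIso, glueFun_of_lt (has.trans_le ht.1), coe_glueIso, glueFun_of_ge e1 ht.1,
      coe_glueIso, glueFun_of_le ht.2]
  · exact plAt_glueFun ha e0 (fun _ => plAt_id t) fun _ => plAt_glueFun hs e1
      (fun _ => hk t) fun h1 => plAt_glueFun hr e2 (fun h2 => ht ⟨h1, h2⟩) fun _ =>
      plAt_glueFun hb e3 (fun _ => hl t) fun _ => plAt_id t

theorem exists_cutoff_PL {a b s r : ℝ} {v : ℝ ≃o ℝ} (ha : IsDyadic a) (hb : IsDyadic b)
    (hs : IsDyadic s) (hr : IsDyadic r) (has : a < s) (hsr : s ≤ r) (hrb : r < b)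
    (hav : a < v s) (hvb : v r < b) (hv : ∀ t ∈ Icc s r, PLAt v t) :
    ∃ u ∈ PLOn a b, ∀ t ∈ Icc s r, u t = v t := by
  obtain ⟨u, hu, h1, h2⟩ := exists_cutoff ha hb hs hr has hsr hrb hav hvb
    fun t ht => Or.inl (hv t ht)
  exact ⟨u, ⟨fun t => h2 t (hv t), hu.2⟩, h1⟩

theorem exists_PLOn_apply_eq₂ {a b p q p' q' : ℝ} (ha : IsDyadic a) (hb : IsDyadic b)
    (hp : IsDyadic p) (hq : IsDyadic q) (hp' : IsDyadic p') (hq' : IsDyadic q')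
    (hap : a < p) (hpq : p < q) (hqb : q < b) (hap' : a < p') (hpq' : p' < q') (hqb' : q' < b) :
    ∃ u ∈ PLOn a b, u p = p' ∧ u q = q' := by
  obtain ⟨v, hv, vp, vq⟩ := exists_mem_PL hp hq hp' hq' hpq hpq'
  obtain ⟨u, hu, h⟩ := exists_cutoff_PL (v := v) ha hb hp hq hap hpq.le hqb (by rwa [vp])
    (by rwa [vq]) fun t _ => hv t
  exact ⟨u, hu, by rw [h p (left_mem_Icc.2 hpq.le), vp], by rw [h q (right_mem_Icc.2 hpq.le), vq]⟩

theorem exists_PLOn_apply_eq {a b p p' : ℝ} (ha : IsDyadic a) (hb : IsDyadic b)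
    (hp : IsDyadic p) (hp' : IsDyadic p') (hap : a < p) (hpb : p < b) (hap' : a < p')
    (hpb' : p' < b) : ∃ u ∈ PLOn a b, u p = p' := by
  obtain ⟨u, hu, h⟩ := exists_cutoff_PL (v := affineIso 0 (p' - p)) ha hb hp hp hap le_rfl hpb
    (by simpa) (by simpa) fun t _ => affineIso_mem 0 (hp'.sub hp) t
  exact ⟨u, hu, by rw [h p (left_mem_Icc.2 le_rfl)]; simp⟩

theorem split_at {f : ℝ ≃o ℝ} {p : ℝ} (h : f p = (1 : ℝ ≃o ℝ) p) :
    f = glueIso p f 1 h * glueIso p 1 f h.symm := by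
  ext t
  rw [RelIso.mul_apply, coe_glueIso, coe_glueIso]
  rcases le_or_gt t p with ht | ht
  · rw [glueFun_of_le (u := ⇑(1 : ℝ ≃o ℝ)) ht]
    exact (glueFun_of_le (u := f) (v := ⇑(1 : ℝ ≃o ℝ)) ht).symm
  · rw [glueFun_of_lt (v := f) ht]
    exact (glueFun_of_lt (u := f) (v := ⇑(1 : ℝ ≃o ℝ)) (lt_of_eq_of_lt h.symm (f.strictMono ht))).symm

/-- Let `p` be a dyadic point of the overlap. A PL element of one of the two subgroups carries `p`
to `f p`, the choice depending on whether `f p < c`. What remains fixes `p`, and splits there into a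
factor supported to the left of `p` and one supported to the right. -/
theorem TDOn_le_sup {a b c d : ℝ} (ha : IsDyadic a) (hb : IsDyadic b) (hc : IsDyadic c)
    (hd : IsDyadic d) (hab : a < b) (hbc : b < c) (hcd : c < d) :
    TDOn a d ≤ TDOn a c ⊔ TDOn b d := by
  intro f hf
  have h1 : TDOn a c ⊔ TDOn b d ≤ TDOn a d :=
    sup_le (TDOn_mono le_rfl hcd.le) (TDOn_mono hab.le le_rfl)
  obtain ⟨p, hp, hbp, hpc⟩ := exists_isDyadic_between hbc
  have hq : IsDyadic (f p) := (isDyadic_apply hf.1).2 hp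
  obtain ⟨hq1, hq2⟩ := (suppIn_mem_Ioo hf.2).2 ⟨hab.trans hbp, hpc.trans hcd⟩
  obtain ⟨k, hk, hkp⟩ : ∃ k ∈ TDOn a c ⊔ TDOn b d, k p = f p := by
    rcases lt_or_ge (f p) c with h | h
    · obtain ⟨k, hk, e⟩ := exists_PLOn_apply_eq ha hc hp hq (hab.trans hbp) hpc hq1 h
      exact ⟨k, le_sup_left (a := TDOn a c) (PLOn_le_TDOn _ _ hk), e⟩
    · obtain ⟨k, hk, e⟩ := exists_PLOn_apply_eq hb hd hp hq hbp (hpc.trans hcd)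
        (hbc.trans_le h) hq2
      exact ⟨k, le_sup_right (a := TDOn a c) (PLOn_le_TDOn _ _ hk), e⟩
  suffices h : k⁻¹ * f ∈ TDOn a c ⊔ TDOn b d by
    simpa using mul_mem hk h
  have hg : k⁻¹ * f ∈ TDOn a d := mul_mem (inv_mem (h1 hk)) hf
  have hgp : (k⁻¹ * f) p = (1 : ℝ ≃o ℝ) p := by
    have : k.symm (f p) = p := by rw [k.symm_apply_eq, hkp]
    exact this
  rw [split_at hgp]
  refine mul_mem (le_sup_left (a := TDOn a c) ⟨glueIso_mem_TD hp hg.1 (one_mem _), ?_⟩)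
    (le_sup_right (a := TDOn a c) ⟨glueIso_mem_TD hp (one_mem _) hg.1, ?_⟩)
  · intro t ht
    rw [coe_glueIso]
    rcases le_or_gt t p with h | h
    · rw [glueFun_of_le h]
      exact hg.2 t fun h' => ht ⟨h'.1, h.trans_lt hpc⟩
    · rw [glueFun_of_lt h]
      rfl
  · intro t ht
    rw [coe_glueIso]
    rcases le_or_gt t p with h | h
    · rw [glueFun_of_le h]
      rfl
    · rw [glueFun_of_lt h]
      exact hg.2 t fun h' => ht ⟨hbp.trans h, h'.2⟩

/-! ### Dyadic piecewise linear automorphisms with compact support -/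

/-- Such an `F` is continuous and takes a larger value arbitrarily close to the right of each point,
so its maximum on `[a, b]` is attained only at `b`. -/
theorem strictMono_of_locally {F : ℝ → ℝ} (h : ∀ t, ∃ f : ℝ ≃o ℝ, F =ᶠ[𝓝 t] f) :
    StrictMono F := by
  have hc : Continuous F := continuous_iff_continuousAt.2 fun t => by
    obtain ⟨f, hf⟩ := h t
    exact f.continuous.continuousAt.congr hf.symm
  have key : ∀ m b : ℝ, m < b → ∃ s ∈ Ioo m b, F m < F s := by
    intro m b hmb
    obtain ⟨f, hf⟩ := h m
    have h1 : ∀ᶠ s in 𝓝[>] m, F s = f s := hf.filter_mono nhdsWithin_le_nhds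
    obtain ⟨s, hs, hs'⟩ := (h1.and (Ioo_mem_nhdsGT hmb)).exists
    exact ⟨s, hs', by rw [hs, hf.self_of_nhds]; exact f.strictMono hs'.1⟩
  intro a b hab
  obtain ⟨m, hm, hmax⟩ := isCompact_Icc.exists_isMaxOn (nonempty_Icc.2 hab.le) hc.continuousOn
  have hmb : m = b := by
    by_contra hne
    obtain ⟨s, hs, hs'⟩ := key m b (lt_of_le_of_ne hm.2 hne)
    exact absurd (hmax (show s ∈ Icc a b from ⟨hm.1.trans hs.1.le, hs.2.le⟩)) (not_le.2 hs')
  subst hmb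
  obtain ⟨s, hs, hs'⟩ := key a m hab
  exact hs'.trans_le (hmax ⟨hs.1.le, hs.2.le⟩)

/-! ### Thompson's group F acting on the line -/

/-- The unit translation. -/
noncomputable def shift : ℝ ≃o ℝ := affineIso 0 1

theorem shift_apply (t : ℝ) : shift t = t + 1 := by simp [shift]

theorem shift_pow_apply (n : ℕ) (t : ℝ) : (shift ^ n) t = t + n := by
  induction n with
  | zero => simp
  | succ n ih =>
    rw [pow_succ', RelIso.mul_apply, ih, shift_apply]
    push_cast
    ring

theorem shift_zpow_apply (n : ℤ) (t : ℝ) : (shift ^ n) t = t + n := by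
  obtain ⟨k, rfl | rfl⟩ := n.eq_nat_or_neg
  · simpa using shift_pow_apply k t
  · rw [zpow_neg, zpow_natCast]
    change (shift ^ k).symm t = _
    rw [OrderIso.symm_apply_eq, shift_pow_apply]
    push_cast
    ring

theorem shift_mem : shift ∈ PL := affineIso_mem 0 isDyadic_one

/-- The copy of Thompson's group `F` generated by `shift` and `stretch`. -/
noncomputable def lineGroup : Subgroup (ℝ ≃o ℝ) := Subgroup.closure {shift, stretch}

theorem shift_mem_lineGroup : shift ∈ lineGroup := Subgroup.subset_closure (by simp)

theorem stretch_mem_lineGroup : stretch ∈ lineGroup := Subgroup.subset_closure (by simp)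

/-- One unit interval is doubled at a time: when `[0, N]` has become `[0, 2N]`, the next unit
interval starts at `2N`, where a conjugate of `stretch` by a translation acts on it. -/
theorem exists_double (N : ℕ) : ∃ f ∈ lineGroup, (∀ t ≤ 0, f t = t) ∧
    (∀ t : ℝ, 0 ≤ t → t ≤ N → f t = 2 * t) ∧ ∀ t, (N : ℝ) ≤ t → f t = t + N := by
  induction N with
  | zero =>
    refine ⟨1, one_mem _, fun t _ => rfl, fun t h h' => ?_, fun t _ => by simp⟩
    have : t = 0 := le_antisymm (by simpa using h') h
    subst this
    simp
  | succ N ih =>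
    obtain ⟨f, hf, h1, h2, h3⟩ := ih
    have hN : (0 : ℝ) ≤ N := N.cast_nonneg
    have key : ∀ t, (shift ^ (2 * N : ℤ) * stretch * shift ^ (-(2 * N) : ℤ) * f) t =
        stretch (f t - 2 * N) + 2 * N := by
      intro t
      simp only [RelIso.mul_apply, shift_zpow_apply]
      push_cast
      rw [sub_eq_add_neg]
    refine ⟨shift ^ (2 * N : ℤ) * stretch * shift ^ (-(2 * N) : ℤ) * f, mul_mem (mul_mem (mul_mem
      (zpow_mem shift_mem_lineGroup _) stretch_mem_lineGroup) (zpow_mem shift_mem_lineGroup _)) hf,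
      fun t ht => ?_, fun t ht ht' => ?_, fun t ht => ?_⟩
    · rw [key, h1 t ht, stretch_of_nonpos (by linarith)]
      ring
    · push_cast at ht'
      rw [key]
      rcases le_total t N with h | h
      · rw [h2 t ht h, stretch_of_nonpos (by linarith)]
        ring
      · rw [h3 t h, stretch_of_mem (by linarith) (by linarith)]
        ring
    · push_cast at ht ⊢
      rw [key, h3 t (by linarith), stretch_of_ge (by linarith)]
      ring

theorem exists_expand (k N : ℕ) : ∃ f ∈ lineGroup, (∀ t ≤ 0, f t = t) ∧
    (∀ t : ℝ, 0 ≤ t → t ≤ N → f t = 2 ^ k * t) ∧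
    ∀ t, (N : ℝ) ≤ t → f t = t + (2 ^ k - 1) * N := by
  induction k with
  | zero =>
    exact ⟨1, one_mem _, fun t _ => rfl, fun t h h' => by simp, fun t _ => by simp⟩
  | succ k ih =>
    obtain ⟨f, hf, h1, h2, h3⟩ := ih
    obtain ⟨g, hg, g1, g2, g3⟩ := exists_double (2 ^ k * N)
    push_cast at g1 g2 g3
    have hp : (0 : ℝ) < 2 ^ k := by positivity
    refine ⟨g * f, mul_mem hg hf, fun t ht => ?_, fun t ht ht' => ?_, fun t ht => ?_⟩
    · rw [RelIso.mul_apply, h1 t ht, g1 t ht]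
    · rw [RelIso.mul_apply, h2 t ht ht', g2 _ (by positivity) (by gcongr), pow_succ]
      ring
    · rw [RelIso.mul_apply, h3 t ht, g3 _ (by nlinarith), pow_succ]
      ring

/-- Induction on the number of unit cells, dividing off an element which expands the first cell by
the right factor. The slopes are assumed to be at least 1 so that `exists_expand` provides this
element. -/
theorem mem_lineGroup_of_integral {N : ℕ} {f : ℝ ≃o ℝ} {c : ℝ} (h1 : ∀ t ≤ 0, f t = t)
    (h2 : ∀ i < N, ∃ m : ℕ, ∀ t ∈ Icc (i : ℝ) (i + 1), f t = 2 ^ m * (t - i) + f i)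
    (h3 : ∀ t, (N : ℝ) ≤ t → f t = t + c) : f ∈ lineGroup := by
  induction N generalizing f c with
  | zero =>
    have hc : c = 0 := by
      have := h3 0 (by simp)
      rw [h1 0 le_rfl] at this
      linarith
    have : f = 1 := by
      ext t
      rcases le_total t 0 with h | h
      · exact h1 t h
      · rw [h3 t (by simpa using h), hc]
        simp
    exact this ▸ one_mem _
  | succ N ih =>
    obtain ⟨m, hm⟩ := h2 0 N.succ_pos
    obtain ⟨e, he, e1, e2, e3⟩ := exists_expand m 1
    simp only [Nat.cast_zero, zero_add, sub_zero, h1 0 le_rfl, add_zero] at hm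
    simp only [Nat.cast_one, mul_one] at e2 e3
    let K : ℤ := 2 ^ m
    have hK : (K : ℝ) = 2 ^ m := by simp [K]
    -- Both `f` and `e` send 1 to `K` and agree on `(-∞, 1]`, so `f * e⁻¹` is the identity up to
    -- `K`. The conjugation moves this point to the origin, and one cell fewer remains.
    set g := shift ^ (-K) * f * e⁻¹ * shift ^ K with hg
    have gdef : ∀ r, g (e r - K) = f r - K := by
      intro r
      simp only [hg, RelIso.mul_apply, shift_zpow_apply]
      have : e⁻¹ (e r - K + K) = r := by
        rw [sub_add_cancel]
        exact e.symm_apply_apply r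
      rw [this]
      push_cast
      ring
    have hpos : (0 : ℝ) < 2 ^ m := by positivity
    have g2 : ∀ s, 0 ≤ s → g s = f (s + 1) - K := by
      intro s hs
      rw [← gdef, e3 _ (by linarith), hK]
      congr 1
      ring
    have g1 : ∀ s ≤ 0, g s = s := by
      intro s hs
      obtain ⟨r, hr⟩ := e.surjective (s + K)
      have hs' : s = e r - K := by rw [hr]; ring
      have hr1 : r ≤ 1 := by
        by_contra h
        rw [e3 r (not_le.1 h).le] at hr
        linarith
      rw [hs', gdef]
      rcases le_total r 0 with h | h
      · rw [h1 r h, e1 r h]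
      · rw [hm r ⟨h, hr1⟩, e2 r h hr1]
    have hmem : g ∈ lineGroup := by
      refine ih (c := 1 + c - K) g1 (fun i hi => ?_) fun t ht => ?_
      · obtain ⟨n, hn⟩ := h2 (i + 1) (by omega)
        refine ⟨n, fun t ht => ?_⟩
        have hi0 : (0 : ℝ) ≤ i := i.cast_nonneg
        rw [g2 t (hi0.trans ht.1), g2 i hi0, hn (t + 1) (by
          push_cast
          exact ⟨by linarith [ht.1], by linarith [ht.2]⟩)]
        push_cast
        ring
      · rw [g2 t ((N.cast_nonneg).trans ht), h3 (t + 1) (by push_cast; linarith)]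
        ring
    have : f = shift ^ K * g * shift ^ (-K) * e := by
      rw [hg]
      group
    rw [this]
    exact mul_mem (mul_mem (mul_mem (zpow_mem shift_mem_lineGroup _) hmem)
      (zpow_mem shift_mem_lineGroup _)) he

/-- The property passes to unions, so compactness reduces it to a neighbourhood of one point. Near a
dyadic point the mesh is taken fine enough for that point to be a vertex, so that no cell straddles
a breakpoint; near any other point `f` is affine. -/
theorem exists_grid {f : ℝ → ℝ} (hf : ∀ t, PLAt f t) {K : Set ℝ} (hK : IsCompact K) :
    ∃ k₀ L : ℕ, ∀ k ≥ k₀, ∀ j : ℤ,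
      (Icc ((j : ℝ) / 2 ^ k) ((j + 1) / 2 ^ k) ∩ K).Nonempty →
      ∃ (n : ℤ) (b : ℝ), |n| ≤ L ∧ ∀ t ∈ Icc ((j : ℝ) / 2 ^ k) ((j + 1) / 2 ^ k),
        f t = 2 ^ n * t + b := by
  refine hK.induction_on (p := fun K => ∃ k₀ L : ℕ, ∀ k ≥ k₀, ∀ j : ℤ,
      (Icc ((j : ℝ) / 2 ^ k) ((j + 1) / 2 ^ k) ∩ K).Nonempty →
      ∃ (n : ℤ) (b : ℝ), |n| ≤ L ∧ ∀ t ∈ Icc ((j : ℝ) / 2 ^ k) ((j + 1) / 2 ^ k),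
        f t = 2 ^ n * t + b) ?_ ?_ ?_ ?_
  · exact ⟨0, 0, fun k _ j h => by simp at h⟩
  · rintro s t hst ⟨k₀, L, h⟩
    exact ⟨k₀, L, fun k hk j hj => h k hk j (hj.mono (inter_subset_inter_right _ hst))⟩
  · rintro s t ⟨k₀, L, h⟩ ⟨k₁, L', h'⟩
    refine ⟨max k₀ k₁, max L L', fun k hk j hj => ?_⟩
    rw [inter_union_distrib_left, union_nonempty] at hj
    rcases hj with hj | hj
    · obtain ⟨n, b, hn, hb⟩ := h k (le_trans (le_max_left _ _) hk) j hj
      exact ⟨n, b, hn.trans (by exact_mod_cast le_max_left _ _), hb⟩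
    · obtain ⟨n, b, hn, hb⟩ := h' k (le_trans (le_max_right _ _) hk) j hj
      exact ⟨n, b, hn.trans (by exact_mod_cast le_max_right _ _), hb⟩
  · intro t _
    have hcell : ∀ δ > 0, ∃ k₀ : ℕ, ∀ k ≥ k₀, ∀ j : ℤ,
        (Icc ((j : ℝ) / 2 ^ k) ((j + 1) / 2 ^ k) ∩ Ioo (t - δ / 2) (t + δ / 2)).Nonempty →
        Icc ((j : ℝ) / 2 ^ k) ((j + 1) / 2 ^ k) ⊆ Ioo (t - δ) (t + δ) := by
      intro δ hδ
      obtain ⟨k₀, hk₀⟩ := exists_pow_lt_of_lt_one (half_pos hδ) (by norm_num : (1 / 2 : ℝ) < 1)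
      refine ⟨k₀, fun k hk j => ?_⟩
      rintro ⟨r, ⟨hr1, hr2⟩, hr3, hr4⟩ s ⟨hs1, hs2⟩
      have h1 : (1 / 2 : ℝ) ^ k ≤ (1 / 2) ^ k₀ :=
        pow_le_pow_of_le_one (by norm_num) (by norm_num) hk
      have h2 : ((j : ℝ) + 1) / 2 ^ k = j / 2 ^ k + (1 / 2) ^ k := by
        rw [add_div, one_div_pow]
      rw [h2] at hr2 hs2
      constructor <;> linarith
    have hnhds : ∀ δ > 0, ∃ V ∈ 𝓝[K] t, V ⊆ Ioo (t - δ / 2) (t + δ / 2) := fun δ hδ =>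
      ⟨_, mem_nhdsWithin_of_mem_nhds (Ioo_mem_nhds (by linarith) (by linarith)), subset_rfl⟩
    obtain ⟨⟨n, b, -, h1⟩, ⟨m, c, -, h2⟩, h3⟩ := hf t
    by_cases hd : IsDyadic t
    · have h1' : ∀ᶠ s in 𝓝 t, s ≤ t → f s = 2 ^ n * s + b := eventually_nhdsWithin_iff.1 h1
      have h2' : ∀ᶠ s in 𝓝 t, t ≤ s → f s = 2 ^ m * s + c := eventually_nhdsWithin_iff.1 h2
      obtain ⟨δ, hδ, hball⟩ := Metric.eventually_nhds_iff_ball.1 (h1'.and h2')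
      rw [Real.ball_eq_Ioo] at hball
      obtain ⟨k₀, hk₀⟩ := hcell δ hδ
      obtain ⟨V, hV, hV'⟩ := hnhds δ hδ
      obtain ⟨z, l, rfl⟩ := hd
      refine ⟨V, hV, max k₀ l, max n.natAbs m.natAbs, fun k hk j hj => ?_⟩
      have hsub := hk₀ k (le_trans (le_max_left _ _) hk) j
        (hj.mono (inter_subset_inter_right _ hV'))
      have hlk : l ≤ k := le_trans (le_max_right _ _) hk
      have hz : (z : ℝ) / 2 ^ l = (z * 2 ^ (k - l) : ℤ) / 2 ^ k := by
        push_cast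
        rw [div_eq_div_iff (by positivity) (by positivity), mul_assoc, ← pow_add,
          Nat.sub_add_cancel hlk]
      rcases le_or_gt (z * 2 ^ (k - l)) j with h | h
      · refine ⟨m, c, by push_cast; rw [Int.abs_eq_natAbs]; simp, fun s hs =>
          (hball s (hsub hs)).2 (le_trans ?_ hs.1)⟩
        rw [hz]
        gcongr
      · refine ⟨n, b, by push_cast; rw [Int.abs_eq_natAbs]; simp, fun s hs =>
          (hball s (hsub hs)).1 (le_trans hs.2 ?_)⟩
        rw [hz]
        gcongr
        exact_mod_cast h
    · obtain ⟨n, b, -, h⟩ := h3 hd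
      obtain ⟨δ, hδ, hball⟩ := Metric.eventually_nhds_iff_ball.1 h
      rw [Real.ball_eq_Ioo] at hball
      obtain ⟨k₀, hk₀⟩ := hcell δ hδ
      obtain ⟨V, hV, hV'⟩ := hnhds δ hδ
      refine ⟨V, hV, k₀, n.natAbs, fun k hk j hj => ⟨n, b, ?_, fun s hs => hball s (hk₀ k hk j
        (hj.mono (inter_subset_inter_right _ hV')) hs)⟩⟩
      rw [Int.abs_eq_natAbs]

theorem mem_lineGroup_of_supp_nat {f : ℝ ≃o ℝ} (hf : f ∈ PL) {N : ℕ} (hN : f ∈ suppIn 0 N) :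
    f ∈ lineGroup := by
  obtain ⟨k, L, h⟩ := exists_grid hf (isCompact_Icc (a := (0 : ℝ)) (b := N))
  replace h := h k le_rfl
  -- `e` rescales the cells of the grid to length one, and `d` multiplies slopes by `2 ^ (k + L)`. A
  -- cell of slope `2 ^ n` then acquires slope `2 ^ (L + n)`, at least 1 because `|n| ≤ L`, so
  -- `mem_lineGroup_of_integral` applies to `d * f * e⁻¹`.
  obtain ⟨e, he, e1, e2, e3⟩ := exists_expand k N
  obtain ⟨d, hd, d1, d2, d3⟩ := exists_expand (k + L) N
  have hpos : (0 : ℝ) < 2 ^ k := by positivity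
  have hN0 : (0 : ℝ) ≤ N := N.cast_nonneg
  have hg : ∀ t, (d * f * e⁻¹) (e t) = d (f t) := fun t => by
    simp only [RelIso.mul_apply]
    congr 2
    exact e.symm_apply_apply t
  have gmid : ∀ s : ℝ, 0 ≤ s → s ≤ 2 ^ k * N → (d * f * e⁻¹) s = 2 ^ (k + L) * f (s / 2 ^ k) := by
    intro s h0 h1
    have h0' : 0 ≤ s / 2 ^ k := by positivity
    have h1' : s / 2 ^ k ≤ N := by
      rw [div_le_iff₀ hpos]
      linarith
    have hs : s = e (s / 2 ^ k) := by
      rw [e2 _ h0' h1']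
      field_simp
    conv_lhs => rw [hs]
    obtain ⟨h2, h3⟩ := (suppIn_mem_Icc hN).2 ⟨h0', h1'⟩
    rw [hg, d2 _ h2 h3]
  have hmem : d * f * e⁻¹ ∈ lineGroup := by
    refine mem_lineGroup_of_integral (N := 2 ^ k * N) (c := (2 ^ (k + L) - 2 ^ k) * N)
      (fun t ht => ?_) (fun i hi => ?_) fun s hs => ?_
    · have : t = e t := (e1 t ht).symm
      conv_lhs => rw [this]
      rw [hg, hN t (fun h' => absurd h'.1 (not_lt.2 ht)), d1 t ht]
    · have hi' : (i : ℝ) + 1 ≤ 2 ^ k * N := by exact_mod_cast hi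
      have hi0 : (0 : ℝ) ≤ i := i.cast_nonneg
      obtain ⟨n, b, hn, hb⟩ := h i ⟨i / 2 ^ k, ⟨by simp, by simp; gcongr; simp⟩, by positivity, by
        rw [div_le_iff₀ hpos]
        linarith⟩
      obtain ⟨m, hm⟩ := Int.eq_ofNat_of_zero_le
        (show 0 ≤ L + n by linarith [(abs_le.1 hn).1])
      have hcell : ∀ t ∈ Icc (i : ℝ) (i + 1), (d * f * e⁻¹) t = 2 ^ m * t + 2 ^ (k + L) * b := by
        intro t ht
        rw [gmid t (hi0.trans ht.1) (ht.2.trans hi'), hb (t / 2 ^ k) ⟨by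
          simp only [Int.cast_natCast]; gcongr; exact ht.1, by
          simp only [Int.cast_natCast]; gcongr; exact ht.2⟩]
        have : (2 : ℝ) ^ m = 2 ^ L * 2 ^ n := by
          rw [← zpow_natCast, ← hm, zpow_add₀ two_ne_zero, zpow_natCast]
        rw [this, pow_add]
        field_simp
      refine ⟨m, fun t ht => ?_⟩
      rw [hcell t ht, hcell i (left_mem_Icc.2 (by linarith))]
      ring
    · push_cast at hs
      have ht : (N : ℝ) ≤ s - (2 ^ k - 1) * N := by linarith
      have hs' : s = e (s - (2 ^ k - 1) * N) := by
        rw [e3 _ ht]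
        ring
      conv_lhs => rw [hs']
      rw [hg, hN _ (fun h' => by linarith [h'.2]), d3 _ ht]
      ring
  have : f = d⁻¹ * (d * f * e⁻¹) * e := by group
  rw [this]
  exact mul_mem (mul_mem (inv_mem hd) hmem) he

theorem mem_lineGroup {f : ℝ ≃o ℝ} (hf : f ∈ PL) {a b : ℝ} (h : f ∈ suppIn a b) :
    f ∈ lineGroup := by
  obtain ⟨N, hN⟩ := exists_nat_ge (b - ⌊a⌋)
  have hmem : shift ^ (-⌊a⌋) * f * shift ^ ⌊a⌋ ∈ lineGroup := by
    refine mem_lineGroup_of_supp_nat (N := N) (mul_mem (mul_mem (zpow_mem shift_mem _) hf)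
      (zpow_mem shift_mem _)) fun t ht => ?_
    simp only [RelIso.mul_apply, shift_zpow_apply]
    rw [h]
    · push_cast
      ring
    · rintro ⟨h1, h2⟩
      exact ht ⟨by linarith [Int.floor_le a], by linarith⟩
  have : f = shift ^ ⌊a⌋ * (shift ^ (-⌊a⌋) * f * shift ^ ⌊a⌋) * shift ^ (-⌊a⌋) := by group
  rw [this]
  exact mul_mem (mul_mem (zpow_mem shift_mem_lineGroup _) hmem) (zpow_mem shift_mem_lineGroup _)

theorem eventually_comp_translation {l : Filter ℝ} {f g : ℝ ≃o ℝ} {a b : ℝ}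
    (hl : Tendsto (fun t => t + b) l l) (hf : ∀ᶠ t in l, f t = t + a)
    (hg : ∀ᶠ t in l, g t = t + b) : ∀ᶠ t in l, (f * g) t = t + (a + b) := by
  filter_upwards [hg, hl.eventually hf] with t h1 h2
  rw [RelIso.mul_apply, h1, h2]
  ring

theorem eventually_inv_translation {l : Filter ℝ} {f : ℝ ≃o ℝ} {a : ℝ}
    (hl : Tendsto (fun t => t + -a) l l) (hf : ∀ᶠ t in l, f t = t + a) :
    ∀ᶠ t in l, f⁻¹ t = t + -a := by
  filter_upwards [hl.eventually hf] with t h2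
  have : f.symm t = t + -a := by
    rw [OrderIso.symm_apply_eq, h2]
    ring
  exact this

/-- The abelianization is detected at infinity. Elements are integer translations near −∞ and near
+∞, and the two integers determine the class: `shift` contributes (1, 1) and `stretch` contributes
(0, 1). -/
theorem lineGroup_abelianization (f : lineGroup) : ∃ i j : ℤ,
    Abelianization.of f = Abelianization.of ⟨shift, shift_mem_lineGroup⟩ ^ i *
      Abelianization.of ⟨stretch, stretch_mem_lineGroup⟩ ^ j ∧
    (∀ᶠ t in atBot, (f : ℝ ≃o ℝ) t = t + i) ∧
    ∀ᶠ t in atTop, (f : ℝ ≃o ℝ) t = t + ((i + j : ℤ) : ℝ) := by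
  have hB : ∀ c : ℝ, Tendsto (fun t => t + c) atBot atBot := fun c =>
    tendsto_atBot_add_const_right _ c tendsto_id
  have hT : ∀ c : ℝ, Tendsto (fun t => t + c) atTop atTop := fun c =>
    tendsto_atTop_add_const_right _ c tendsto_id
  obtain ⟨f, hf⟩ := f
  induction hf using Subgroup.closure_induction with
  | mem x hx =>
    rcases hx with rfl | rfl
    · exact ⟨1, 0, by simp, Eventually.of_forall fun t => by simp [shift_apply],
        Eventually.of_forall fun t => by simp [shift_apply]⟩
    · refine ⟨0, 1, by simp, ?_, ?_⟩
      · filter_upwards [eventually_le_atBot 0] with t ht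
        simp [stretch_of_nonpos ht]
      · filter_upwards [eventually_ge_atTop 1] with t ht
        simp [stretch_of_ge ht]
  | one => exact ⟨0, 0, by simp; exact map_one _, Eventually.of_forall fun t => by simp,
      Eventually.of_forall fun t => by simp⟩
  | mul x y hx hy ihx ihy =>
    obtain ⟨i, j, h1, h2, h3⟩ := ihx
    obtain ⟨i', j', h1', h2', h3'⟩ := ihy
    refine ⟨i + i', j + j', ?_, ?_, ?_⟩
    · have : (⟨x * y, mul_mem hx hy⟩ : lineGroup) = ⟨x, hx⟩ * ⟨y, hy⟩ := rfl
      rw [this, map_mul, h1, h1', zpow_add, zpow_add]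
      exact mul_mul_mul_comm _ _ _ _
    · push_cast
      exact eventually_comp_translation (hB _) h2 h2'
    · have := eventually_comp_translation (hT _) h3 h3'
      filter_upwards [this] with t ht
      rw [ht]
      push_cast
      ring
  | inv x hx ih =>
    obtain ⟨i, j, h1, h2, h3⟩ := ih
    refine ⟨-i, -j, ?_, ?_, ?_⟩
    · have : (⟨x⁻¹, inv_mem hx⟩ : lineGroup) = ⟨x, hx⟩⁻¹ := rfl
      rw [this, map_inv, h1, zpow_neg, zpow_neg, mul_inv]
    · push_cast
      exact eventually_inv_translation (hB _) h2
    · filter_upwards [eventually_inv_translation (hT _) h3] with t ht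
      rw [ht]
      push_cast
      ring

/-- With bounded support both translation lengths at infinity vanish, so the class in the
abelianization is trivial. -/
theorem mem_commutator_lineGroup {f : ℝ ≃o ℝ} (hf : f ∈ PL) {a b : ℝ} (h : f ∈ suppIn a b) :
    f ∈ ⁅lineGroup, lineGroup⁆ := by
  have hm := mem_lineGroup hf h
  obtain ⟨i, j, h1, h2, h3⟩ := lineGroup_abelianization ⟨f, hm⟩
  obtain ⟨t, ht, ht'⟩ := (h2.and (eventually_le_atBot a)).exists
  obtain ⟨s, hs, hs'⟩ := (h3.and (eventually_ge_atTop b)).exists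
  rw [h t fun h' => by linarith [h'.1]] at ht
  rw [h s fun h' => by linarith [h'.2]] at hs
  have hi : i = 0 := by
    have : (i : ℝ) = 0 := by linarith
    exact_mod_cast this
  subst hi
  have hj : j = 0 := by
    have : ((0 + j : ℤ) : ℝ) = 0 := by linarith
    simpa using this
  subst hj
  rw [zpow_zero, zpow_zero, mul_one] at h1
  have : (⟨f, hm⟩ : lineGroup) ∈ commutator lineGroup := by
    rwa [← Abelianization.ker_of, MonoidHom.mem_ker]
  rw [← Subgroup.map_subtype_commutator]
  exact ⟨_, this, rfl⟩

/-! ### Finitely generated groups of automorphisms supported in a bounded interval -/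

theorem isDyadic_half : IsDyadic (1 / 2) := ⟨1, 1, by norm_num⟩

/-! ### Transporting Thompson's group F to a bounded interval -/

theorem exists_boxShift : ∃ f ∈ PLOn (-1) 1, (∀ t, -1 ≤ t → t ≤ -1 / 2 → f t = 2 * t + 1) ∧
    (∀ t, -1 / 2 ≤ t → t ≤ 0 → f t = t + 1 / 2) ∧ ∀ t, 0 ≤ t → t ≤ 1 → f t = t / 2 + 1 / 2 := by
  have d1 : IsDyadic (-1) := isDyadic_one.neg
  have d2 : IsDyadic (-1 / 2) := by
    rw [neg_div]
    exact isDyadic_half.neg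
  have e3 : affineIso (-1) (1 / 2) 1 = (1 : ℝ ≃o ℝ) 1 := by
    rw [affineIso_apply, one_apply]
    norm_num
  let g3 := glueIso 1 (affineIso (-1) (1 / 2)) 1 e3
  have e2 : affineIso 0 (1 / 2) 0 = g3 0 := by
    rw [coe_glueIso, glueFun_of_le zero_le_one]
    norm_num
  let g2 := glueIso 0 (affineIso 0 (1 / 2)) g3 e2
  have e1 : affineIso 1 1 (-1 / 2) = g2 (-1 / 2) := by
    rw [coe_glueIso, glueFun_of_le (by norm_num)]
    norm_num
  let g1 := glueIso (-1 / 2) (affineIso 1 1) g2 e1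
  have e0 : (1 : ℝ ≃o ℝ) (-1) = g1 (-1) := by
    rw [coe_glueIso, glueFun_of_le (by norm_num), one_apply]
    norm_num
  refine ⟨glueIso (-1) 1 g1 e0, ⟨glueIso_mem_PL d1 (one_mem _) (glueIso_mem_PL d2
    (affineIso_mem _ isDyadic_one) (glueIso_mem_PL isDyadic_zero (affineIso_mem _ isDyadic_half)
    (glueIso_mem_PL isDyadic_one (affineIso_mem _ isDyadic_half) (one_mem _)))),
    fun t ht => ?_⟩, fun t h h' => ?_, fun t h h' => ?_, fun t h h' => ?_⟩
  · rw [coe_glueIso]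
    rcases le_or_gt t (-1) with h | h
    · rw [glueFun_of_le h, one_apply]
    · have h' : 1 ≤ t := not_lt.1 fun h' => ht ⟨h, h'⟩
      rw [glueFun_of_lt h, coe_glueIso, glueFun_of_lt (by linarith), coe_glueIso,
        glueFun_of_lt (by linarith), coe_glueIso, glueFun_of_ge e3 h', one_apply]
  · rw [coe_glueIso, glueFun_of_ge e0 h, coe_glueIso, glueFun_of_le h']
    norm_num
  · rw [coe_glueIso, glueFun_of_lt (by linarith), coe_glueIso, glueFun_of_ge e1 h, coe_glueIso,
      glueFun_of_le h']
    norm_num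
  · rw [coe_glueIso, glueFun_of_lt (by linarith), coe_glueIso, glueFun_of_lt (by linarith),
      coe_glueIso, glueFun_of_ge e2 h, coe_glueIso, glueFun_of_le h', affineIso_apply, zpow_neg_one]
    ring

/-- The counterpart of `stretch` on `(-1, 1)`: the interval `[0, 1]` of the line becomes `[0, 1 /
2]`, and on `[1 / 2, 1]` the map agrees with that of `exists_boxShift`, as `stretch` agrees with the
unit translation on `[1, ∞)`. -/
theorem exists_boxStretch : ∃ f ∈ PLOn (-1) 1, (∀ t, t ≤ 0 → f t = t) ∧
    (∀ t, 0 ≤ t → t ≤ 1 / 4 → f t = 2 * t) ∧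
    (∀ t, 1 / 4 ≤ t → t ≤ 1 / 2 → f t = t + 1 / 4) ∧
    ∀ t, 1 / 2 ≤ t → t ≤ 1 → f t = t / 2 + 1 / 2 := by
  have d4 : IsDyadic (1 / 4) := ⟨1, 2, by norm_num⟩
  have e3 : affineIso (-1) (1 / 2) 1 = (1 : ℝ ≃o ℝ) 1 := by
    rw [affineIso_apply, one_apply]
    norm_num
  let g3 := glueIso 1 (affineIso (-1) (1 / 2)) 1 e3
  have e2 : affineIso 0 (1 / 4) (1 / 2) = g3 (1 / 2) := by
    rw [coe_glueIso, glueFun_of_le (by norm_num)]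
    norm_num
  let g2 := glueIso (1 / 2) (affineIso 0 (1 / 4)) g3 e2
  have e1 : affineIso 1 0 (1 / 4) = g2 (1 / 4) := by
    rw [coe_glueIso, glueFun_of_le (by norm_num)]
    norm_num
  let g1 := glueIso (1 / 4) (affineIso 1 0) g2 e1
  have e0 : (1 : ℝ ≃o ℝ) 0 = g1 0 := by
    rw [coe_glueIso, glueFun_of_le (by norm_num), one_apply]
    norm_num
  refine ⟨glueIso 0 1 g1 e0, ⟨glueIso_mem_PL isDyadic_zero (one_mem _) (glueIso_mem_PL d4
    (affineIso_mem _ isDyadic_zero) (glueIso_mem_PL isDyadic_half (affineIso_mem _ d4)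
    (glueIso_mem_PL isDyadic_one (affineIso_mem _ isDyadic_half) (one_mem _)))),
    fun t ht => ?_⟩, fun t h => ?_, fun t h h' => ?_, fun t h h' => ?_, fun t h h' => ?_⟩
  · rw [coe_glueIso]
    rcases le_or_gt t 0 with h | h
    · rw [glueFun_of_le h, one_apply]
    · have h' : 1 ≤ t := not_lt.1 fun h' => ht ⟨by linarith, h'⟩
      rw [glueFun_of_lt h, coe_glueIso, glueFun_of_lt (by linarith), coe_glueIso,
        glueFun_of_lt (by linarith), coe_glueIso, glueFun_of_ge e3 h', one_apply]
  · rw [coe_glueIso, glueFun_of_le h, one_apply]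
  · rw [coe_glueIso, glueFun_of_ge e0 h, coe_glueIso, glueFun_of_le h']
    norm_num
  · rw [coe_glueIso, glueFun_of_lt (by linarith), coe_glueIso, glueFun_of_ge e1 h, coe_glueIso,
      glueFun_of_le h']
    norm_num
  · rw [coe_glueIso, glueFun_of_lt (by linarith), coe_glueIso, glueFun_of_lt (by linarith),
      coe_glueIso, glueFun_of_ge e2 h, coe_glueIso, glueFun_of_le h', affineIso_apply, zpow_neg_one]
    ring

/-- An automorphism of `(-1, 1)` which is conjugate to the unit translation of the line. -/
noncomputable def boxShift : ℝ ≃o ℝ := exists_boxShift.choose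

theorem boxShift_mem : boxShift ∈ PLOn (-1) 1 := exists_boxShift.choose_spec.1

theorem boxShift_of_mem_left {t : ℝ} (h : -1 ≤ t) (h' : t ≤ -1 / 2) : boxShift t = 2 * t + 1 :=
  exists_boxShift.choose_spec.2.1 t h h'

theorem boxShift_of_mem_mid {t : ℝ} (h : -1 / 2 ≤ t) (h' : t ≤ 0) : boxShift t = t + 1 / 2 :=
  exists_boxShift.choose_spec.2.2.1 t h h'

theorem boxShift_of_mem_right {t : ℝ} (h : 0 ≤ t) (h' : t ≤ 1) : boxShift t = t / 2 + 1 / 2 :=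
  exists_boxShift.choose_spec.2.2.2 t h h'

/-- A homeomorphism of the line onto `(-1, 1)` conjugating `shift` to `boxShift`. -/
noncomputable def lineToBox (t : ℝ) : ℝ := (boxShift ^ ⌊t⌋) (Int.fract t / 2)

/-- One formula is valid on both unit cells adjacent to `n` because `boxShift` is the translation by
1/2 on `[-1 / 2, 0]`. Hence integers cause no trouble when `lineToBox` is compared locally with
elements of `PL`. -/
theorem lineToBox_eq {n : ℤ} {t : ℝ} (h : n - 1 ≤ t) (h' : t ≤ n + 1) :
    lineToBox t = (boxShift ^ n) ((t - n) / 2) := by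
  unfold lineToBox
  rcases lt_or_ge t n with h1 | h1
  · have hf : ⌊t⌋ = n - 1 := Int.floor_eq_iff.2 ⟨by push_cast; exact h, by push_cast; linarith⟩
    have : boxShift ((t - n) / 2) = Int.fract t / 2 := by
      rw [boxShift_of_mem_mid (by linarith) (by linarith), Int.fract, hf]
      push_cast
      ring
    rw [← this, hf, ← RelIso.mul_apply, ← zpow_add_one, sub_add_cancel]
  rcases h'.lt_or_eq with h2 | h2
  · have hf : ⌊t⌋ = n := Int.floor_eq_iff.2 ⟨h1, h2⟩
    rw [Int.fract, hf]
  · have hf : ⌊t⌋ = n + 1 := by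
      rw [h2]
      exact_mod_cast Int.floor_intCast (n + 1)
    have : boxShift 0 = (t - n) / 2 := by
      rw [boxShift_of_mem_right le_rfl zero_le_one, h2]
      ring
    rw [← this, hf, ← RelIso.mul_apply, ← zpow_add_one, Int.fract, hf, h2]
    simp

theorem lineToBox_locally (t : ℝ) :
    ∃ f ∈ PL, lineToBox =ᶠ[𝓝 t] (f : ℝ ≃o ℝ) := by
  refine ⟨boxShift ^ ⌊t⌋ * affineIso (-1) (-(⌊t⌋ / 2)), mul_mem (zpow_mem (PLOn_le_PL _ _ boxShift_mem) _)
    (affineIso_mem _ (IsDyadic.neg ⟨⌊t⌋, 1, by simp⟩)), ?_⟩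
  filter_upwards [Ioo_mem_nhds (sub_one_lt _ |>.trans_le (Int.floor_le t)) (Int.lt_floor_add_one t)]
    with s hs
  rw [lineToBox_eq hs.1.le hs.2.le, RelIso.mul_apply, affineIso_apply, zpow_neg_one]
  congr 1
  ring

theorem strictMono_lineToBox : StrictMono lineToBox :=
  strictMono_of_locally fun t => (lineToBox_locally t).imp fun _ h => h.2

theorem continuous_lineToBox : Continuous lineToBox :=
  continuous_iff_continuousAt.2 fun t => by
    obtain ⟨f, -, hf⟩ := lineToBox_locally t
    exact f.continuous.continuousAt.congr hf.symm

theorem lineToBox_mem (t : ℝ) : lineToBox t ∈ Ioo (-1) 1 := by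
  have h : boxShift ^ ⌊t⌋ ∈ suppIn (-1) 1 := zpow_mem (PLOn_le_suppIn _ _ boxShift_mem) _
  refine (suppIn_mem_Ioo h).2 ⟨?_, ?_⟩
  · linarith [Int.fract_nonneg t]
  · linarith [Int.fract_lt_one t]

theorem lineToBox_nat (n : ℕ) : lineToBox n = 1 - (1 / 2) ^ n := by
  have h := lineToBox_eq (n := n) (t := n) (by simp) (by simp)
  rw [h, zpow_natCast]
  simp only [Int.cast_natCast, sub_self, zero_div]
  induction n with
  | zero => simp
  | succ n ih =>
    have hp : (0 : ℝ) < (1 / 2) ^ n := by positivity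
    have h1 : (1 / 2 : ℝ) ^ n ≤ 1 := pow_le_one₀ (by norm_num) (by norm_num)
    rw [pow_succ', RelIso.mul_apply, ih (lineToBox_eq (n := n) (t := n) (by simp) (by simp)),
      boxShift_of_mem_right (by linarith) (by linarith), pow_succ]
    ring

theorem lineToBox_neg_nat (n : ℕ) : lineToBox (-n) = -(1 - (1 / 2) ^ n) := by
  have h := lineToBox_eq (n := -n) (t := -n) (by simp) (by simp)
  rw [h, zpow_neg, zpow_natCast]
  simp only [Int.cast_neg, Int.cast_natCast, sub_self, zero_div]
  change (boxShift ^ n).symm 0 = _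
  rw [OrderIso.symm_apply_eq]
  clear h
  induction n with
  | zero => simp
  | succ n ih =>
    have hp : (0 : ℝ) < (1 / 2) ^ n := by positivity
    have h1 : (1 / 2 : ℝ) ^ n ≤ 1 := pow_le_one₀ (by norm_num) (by norm_num)
    rw [ih, pow_succ (boxShift), RelIso.mul_apply]
    congr 1
    rw [pow_succ, boxShift_of_mem_left (by linarith) (by linarith)]
    ring

theorem exists_lineToBox_eq {s : ℝ} (hs : s ∈ Ioo (-1) 1) : ∃ t, lineToBox t = s := by
  obtain ⟨n, hn⟩ := exists_pow_lt_of_lt_one (by linarith [hs.2] : 0 < 1 - s)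
    (by norm_num : (1 / 2 : ℝ) < 1)
  obtain ⟨m, hm⟩ := exists_pow_lt_of_lt_one (by linarith [hs.1] : 0 < 1 + s)
    (by norm_num : (1 / 2 : ℝ) < 1)
  refine mem_range_of_exists_le_of_exists_ge continuous_lineToBox ⟨-m, ?_⟩ ⟨n, ?_⟩
  · rw [lineToBox_neg_nat]
    linarith
  · rw [lineToBox_nat]
    linarith

/-- The automorphism `g` of `(-1, 1)` corresponds to the automorphism `f` of the line. -/
def Corresponds (f g : ℝ ≃o ℝ) : Prop := g ∈ suppIn (-1) 1 ∧ ∀ t, g (lineToBox t) = lineToBox (f t)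

/-- Automorphisms of the line corresponding to elements of `K`. -/
def correspondents (K : Subgroup (ℝ ≃o ℝ)) : Subgroup (ℝ ≃o ℝ) where
  carrier := {f | ∃ g ∈ K, Corresponds f g}
  mul_mem' := by
    rintro f f' ⟨g, hg, h, e⟩ ⟨g', hg', h', e'⟩
    exact ⟨g * g', mul_mem hg hg', mul_mem h h', fun t => by
      simp only [RelIso.mul_apply, e', e]⟩
  one_mem' := ⟨1, one_mem _, one_mem _, fun t => rfl⟩
  inv_mem' := by
    rintro f ⟨g, hg, h, e⟩
    refine ⟨g⁻¹, inv_mem hg, inv_mem h, fun t => ?_⟩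
    change g.symm _ = lineToBox (f.symm t)
    rw [OrderIso.symm_apply_eq, e, f.apply_symm_apply]

theorem corresponds_unique {f g g' : ℝ ≃o ℝ} (h : Corresponds f g) (h' : Corresponds f g') :
    g = g' := by
  ext s
  by_cases hs : s ∈ Ioo (-1) 1
  · obtain ⟨t, rfl⟩ := exists_lineToBox_eq hs
    rw [h.2, h'.2]
  · rw [h.1 s hs, h'.1 s hs]

theorem shift_corresponds : Corresponds shift boxShift := by
  refine ⟨boxShift_mem.2, fun t => ?_⟩
  have h1 := Int.floor_le t
  have h2 := Int.lt_floor_add_one t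
  rw [shift_apply, lineToBox_eq (n := ⌊t⌋) (by linarith) (by linarith),
    lineToBox_eq (n := ⌊t⌋ + 1) (t := t + 1) (by push_cast; linarith) (by push_cast; linarith),
    ← RelIso.mul_apply, ← zpow_one_add, add_comm]
  push_cast
  congr 1
  ring

theorem exists_stretch_corresponds : ∃ g ∈ PLOn (-1) 1, Corresponds stretch g := by
  obtain ⟨g, hg, g1, g2, g3, g4⟩ := exists_boxStretch
  refine ⟨g, hg, hg.2, fun t => ?_⟩
  have l0 : lineToBox 0 = 0 := by simpa using lineToBox_nat 0
  have l1 : lineToBox 1 = 1 / 2 := by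
    have := lineToBox_nat 1
    norm_num at this ⊢
    exact this
  rcases le_total t 0 with h | h
  · rw [stretch_of_nonpos h, g1]
    rw [← l0]
    exact strictMono_lineToBox.monotone h
  rcases le_total t 1 with h' | h'
  · have e : lineToBox t = t / 2 := by
      rw [lineToBox_eq (n := 0) (by simp; linarith) (by simpa using h')]
      simp
    rw [stretch_of_mem h h', e]
    rcases le_total t (1 / 2) with h'' | h''
    · rw [g2 _ (by linarith) (by linarith), lineToBox_eq (n := 0) (t := 2 * t)
        (by simp; linarith) (by simp; linarith)]
      simp
      ring
    · rw [g3 _ (by linarith) (by linarith), lineToBox_eq (n := 1) (t := 2 * t)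
        (by simp; linarith) (by simp; linarith), zpow_one, boxShift_of_mem_right
        (by simp; linarith) (by simp; linarith)]
      push_cast
      ring
  · rw [stretch_of_ge h', ← shift_apply, ← shift_corresponds.2]
    have h1 : 1 / 2 ≤ lineToBox t := by
      rw [← l1]
      exact strictMono_lineToBox.monotone h'
    have h2 := (lineToBox_mem t).2.le
    rw [g4 _ h1 h2, boxShift_of_mem_right (by linarith) h2]

/-- A support bounded away from ±1 pulls back to a bounded subset of the line, the situation of
`mem_commutator_lineGroup`. Piecewise linearity is kept because `lineToBox` coincides locally with
elements of `PL`. -/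
theorem exists_corresponds {a b : ℝ} {g : ℝ ≃o ℝ} (ha : -1 < a) (hb : b < 1)
    (hg : g ∈ PLOn a b) : ∃ f ∈ PL, (∃ A B, f ∈ suppIn A B) ∧ Corresponds f g := by
  have hg' : g ∈ suppIn (-1) 1 := suppIn_mono ha.le hb.le hg.2
  choose F hF using fun t => exists_lineToBox_eq ((suppIn_mem_Ioo hg').2 (lineToBox_mem t))
  have hmono : StrictMono F := fun s t hst => by
    rw [← strictMono_lineToBox.lt_iff_lt, hF, hF]
    exact g.strictMono (strictMono_lineToBox hst)
  have hsurj : Function.Surjective F := fun t => by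
    have hmem : g.symm (lineToBox t) ∈ Ioo (-1) 1 := by
      rw [← suppIn_mem_Ioo hg', g.apply_symm_apply]
      exact lineToBox_mem t
    obtain ⟨s, hs⟩ := exists_lineToBox_eq hmem
    refine ⟨s, strictMono_lineToBox.injective ?_⟩
    rw [hF, hs, g.apply_symm_apply]
  let f : ℝ ≃o ℝ := hmono.orderIsoOfSurjective F hsurj
  have hf : ∀ t, lineToBox (f t) = g (lineToBox t) := hF
  refine ⟨f, fun t => ?_, ?_, hg', fun t => (hf t).symm⟩
  · obtain ⟨u, hu, hu'⟩ := lineToBox_locally t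
    obtain ⟨v, hv, hv'⟩ := lineToBox_locally (f t)
    have hmem : v⁻¹ * g * u ∈ PL := mul_mem (mul_mem (inv_mem hv) (PLOn_le_PL _ _ hg)) hu
    refine (hmem t).congr ?_
    filter_upwards [hu', f.continuous.continuousAt.eventually hv'] with s h1 h2
    have : v.symm (g (u s)) = f s := by rw [OrderIso.symm_apply_eq, ← h2, ← h1, hf]
    exact this
  · rcases lt_or_ge a b with hab | hab
    · obtain ⟨A, hA⟩ := exists_lineToBox_eq (show a ∈ Ioo (-1) 1 from ⟨ha, hab.trans hb⟩)
      obtain ⟨B, hB⟩ := exists_lineToBox_eq (show b ∈ Ioo (-1) 1 from ⟨ha.trans hab, hb⟩)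
      refine ⟨A, B, fun t ht => strictMono_lineToBox.injective ?_⟩
      rw [hf, hg.2]
      rintro ⟨h1, h2⟩
      rw [← hA] at h1
      rw [← hB] at h2
      exact ht ⟨strictMono_lineToBox.lt_iff_lt.1 h1, strictMono_lineToBox.lt_iff_lt.1 h2⟩
    · refine ⟨0, 0, fun t ht => strictMono_lineToBox.injective ?_⟩
      rw [hf, hg.2]
      rw [Ioo_eq_empty hab.not_gt]
      exact notMem_empty _

/-- Compactly supported elements of the piecewise linear group of an interval are products of
commutators in a finitely generated subgroup. -/
theorem exists_PLOn_le_commutator {a b : ℝ} (ha : IsDyadic a) (hb : IsDyadic b) (hab : a < b) :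
    ∃ T : Set (ℝ ≃o ℝ), T.Finite ∧ T ⊆ PLOn a b ∧ ∀ a' b', a < a' → b' < b →
      PLOn a' b' ≤ ⁅Subgroup.closure T, Subgroup.closure T⁆ := by
  obtain ⟨x, hx, hxc⟩ := exists_stretch_corresponds
  set K := Subgroup.closure {boxShift, x} with hK
  have h1 : lineGroup ≤ correspondents K := by
    refine (Subgroup.closure_le _).2 ?_
    rintro f (rfl | rfl)
    · exact ⟨_, Subgroup.subset_closure (by simp), shift_corresponds⟩
    · exact ⟨x, Subgroup.subset_closure (by simp), hxc⟩
  have h2 : ⁅lineGroup, lineGroup⁆ ≤ correspondents ⁅K, K⁆ := by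
    refine Subgroup.commutator_le.2 fun f hf f' hf' => ?_
    obtain ⟨g, hg, hg1, e⟩ := h1 hf
    obtain ⟨g', hg', hg1', e'⟩ := h1 hf'
    have inv1 : ∀ (g f : ℝ ≃o ℝ), (∀ t, g (lineToBox t) = lineToBox (f t)) →
        ∀ t, g⁻¹ (lineToBox t) = lineToBox (f⁻¹ t) := fun g f e t => by
      change g.symm _ = lineToBox (f.symm t)
      rw [OrderIso.symm_apply_eq, e, f.apply_symm_apply]
    refine ⟨⁅g, g'⁆, Subgroup.commutator_mem_commutator hg hg',
      mul_mem (mul_mem (mul_mem hg1 hg1') (inv_mem hg1)) (inv_mem hg1'), fun t => ?_⟩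
    simp only [commutatorElement_def, RelIso.mul_apply, e, e', inv1 g f e, inv1 g' f' e']
  -- The two generators act on `(-1, 1)`; conjugation by `k` transports them to `(a, b)`.
  obtain ⟨k, hk, ka, kb⟩ := exists_mem_PL isDyadic_one.neg isDyadic_one ha hb (by norm_num) hab
  have hconj : ∀ {a' b' : ℝ} {f : ℝ ≃o ℝ}, f ∈ PLOn a' b' →
      k * f * k⁻¹ ∈ PLOn (k a') (k b') := by
    intro a' b' f hf
    refine mem_PLOn.2 ⟨mul_mem (mul_mem hk (PLOn_le_PL _ _ hf)) (inv_mem hk), fun t ht => ?_⟩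
    obtain ⟨s, rfl⟩ := k.surjective t
    have : (k * f * k⁻¹) (k s) = k (f s) := by
      simp only [RelIso.mul_apply]
      congr 2
      exact k.symm_apply_apply s
    rw [this, hf.2 s fun h => ht ⟨k.strictMono h.1, k.strictMono h.2⟩]
  refine ⟨MulAut.conj k '' {boxShift, x}, (toFinite _).image _, ?_, fun a' b' ha' hb' f hf => ?_⟩
  · rintro _ ⟨g, hg, rfl⟩
    have : g ∈ PLOn (-1) 1 := by
      rcases hg with rfl | rfl
      exacts [boxShift_mem, hx]
    rw [← ka, ← kb]
    exact hconj this
  · have hf' : k⁻¹ * f * k ∈ PLOn (k.symm a') (k.symm b') := by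
      refine mem_PLOn.2 ⟨mul_mem (mul_mem (inv_mem hk) (PLOn_le_PL _ _ hf)) hk, fun t ht => ?_⟩
      have : (k⁻¹ * f * k) t = k.symm (f (k t)) := rfl
      rw [this, OrderIso.symm_apply_eq, hf.2]
      rintro ⟨h1, h2⟩
      exact ht ⟨k.symm_apply_lt.2 h1, k.lt_symm_apply.2 h2⟩
    obtain ⟨g, hg, ⟨A, B, hAB⟩, hc⟩ := exists_corresponds
      (by rwa [k.lt_symm_apply, ka]) (by rwa [k.symm_apply_lt, kb]) hf'
    obtain ⟨g', hg', hc'⟩ := h2 (mem_commutator_lineGroup hg hAB)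
    rw [corresponds_unique hc' hc] at hg'
    have e : (MulAut.conj k '' {boxShift, x}) = ⇑(MulAut.conj k).toMonoidHom '' {boxShift, x} := rfl
    rw [e, ← MonoidHom.map_closure, ← Subgroup.map_commutator]
    refine ⟨_, hg', ?_⟩
    change k * (k⁻¹ * f * k) * k⁻¹ = f
    group

/-! ### Self-similar automorphisms -/

/-- Automorphisms which are the identity on the negative half-line and which on the positive
half-line are piecewise linear and commute with `t ↦ 2 * t`. -/
def rightCone : Subgroup (ℝ ≃o ℝ) where
  carrier := {V | (∀ t, V (2 * t) = 2 * V t) ∧ (∀ t ≠ 0, PLAt V t) ∧ ∀ t ≤ 0, V t = t}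
  mul_mem' := by
    rintro V W ⟨h1, h2, h3⟩ ⟨k1, k2, k3⟩
    refine ⟨fun t => ?_, fun t ht => (h2 (W t) fun h => ht ?_).comp (k2 t ht), fun t ht => ?_⟩
    · simp only [RelIso.mul_apply, k1, h1]
    · exact W.injective (h.trans (k3 0 le_rfl).symm)
    · simp only [RelIso.mul_apply, k3 t ht, h3 t ht]
  one_mem' := ⟨fun _ => rfl, fun t _ => plAt_id t, fun _ _ => rfl⟩
  inv_mem' := by
    rintro V ⟨h1, h2, h3⟩
    have h0 : ∀ t ≤ 0, V.symm t = t := fun t ht => by rw [V.symm_apply_eq, h3 t ht]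
    refine ⟨fun t => ?_, fun t ht => ?_, h0⟩
    · change V.symm _ = 2 * V.symm t
      rw [V.symm_apply_eq, h1, V.apply_symm_apply]
    · have := (h2 (V.symm t) fun h => ht ?_).orderIso_symm
      · rwa [V.apply_symm_apply] at this
      · rw [← V.apply_symm_apply t, h, h3 0 le_rfl]

theorem rightCone_zpow {V : ℝ ≃o ℝ} (hV : V ∈ rightCone) (k : ℤ) (t : ℝ) :
    V (2 ^ k * t) = 2 ^ k * V t := by
  have h1 : ∀ (n : ℕ) (t : ℝ), V (2 ^ n * t) = 2 ^ n * V t := by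
    intro n
    induction n with
    | zero => simp
    | succ n ih =>
      intro t
      rw [pow_succ', mul_assoc, hV.1, ih, mul_assoc]
  obtain ⟨n, rfl | rfl⟩ := k.eq_nat_or_neg
  · simpa using h1 n t
  · rw [zpow_neg, zpow_natCast]
    have h2 : (2 : ℝ) ^ n ≠ 0 := by positivity
    rw [eq_inv_mul_iff_mul_eq₀ h2, ← h1, mul_inv_cancel_left₀ h2]

theorem rightCone_pos {V : ℝ ≃o ℝ} (hV : V ∈ rightCone) {t : ℝ} (ht : 0 < t) : 0 < V t := by
  rw [← hV.2.2 0 le_rfl]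
  exact V.strictMono ht

theorem rightCone_le_TD : rightCone ≤ TD := by
  rintro V ⟨h1, h2, h3⟩ t
  by_cases ht : t = 0
  · subst ht
    refine Or.inr ⟨isDyadic_zero, eventually_nhdsWithin_of_forall fun s hs => h2 s hs,
      Eventually.of_forall fun s => ?_⟩
    rw [h3 0 le_rfl]
    unfold doubling
    simp [h1]
  · exact Or.inl (h2 t ht)

theorem exists_zpow_mul_mem {t : ℝ} (ht : 0 < t) : ∃ k : ℤ, (2 : ℝ) ^ k ≤ t ∧ t < 2 ^ (k + 1) :=
  ⟨Int.log 2 t, by exact_mod_cast Int.zpow_log_le_self one_lt_two ht,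
    by exact_mod_cast Int.lt_zpow_succ_log_self one_lt_two t⟩

theorem log_eq {t : ℝ} {k : ℤ} (h1 : (2 : ℝ) ^ k ≤ t) (h2 : t < 2 ^ (k + 1)) :
    Int.log 2 t = k := by
  have ht : 0 < t := lt_of_lt_of_le (by positivity) h1
  have h3 : k ≤ Int.log 2 t := (Int.zpow_le_iff_le_log one_lt_two ht).1 (by exact_mod_cast h1)
  have h4 : Int.log 2 t < k + 1 := (Int.lt_zpow_iff_log_lt one_lt_two ht).1 (by exact_mod_cast h2)
  omega

theorem zpow_neg_mul_mem {t : ℝ} {k : ℤ} (h1 : (2 : ℝ) ^ k ≤ t) (h2 : t ≤ 2 ^ (k + 1)) :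
    2 ^ (-k) * t ∈ Icc (1 : ℝ) 2 := by
  have hp : (0 : ℝ) < 2 ^ k := by positivity
  rw [zpow_add_one₀ two_ne_zero] at h2
  rw [zpow_neg, mem_Icc, ← div_eq_inv_mul, le_div_iff₀ hp, div_le_iff₀ hp]
  constructor <;> linarith

theorem zpow_mul_zpow_neg (k : ℤ) (t : ℝ) : (2 : ℝ) ^ k * (2 ^ (-k) * t) = t := by
  rw [← mul_assoc, ← zpow_add₀ two_ne_zero]
  simp

theorem rightCone_ext {V V' : ℝ ≃o ℝ} (hV : V ∈ rightCone) (hV' : V' ∈ rightCone)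
    (h : ∀ t ∈ Icc (1 : ℝ) 2, V t = V' t) : V = V' := by
  ext t
  rcases le_or_gt t 0 with ht | ht
  · rw [hV.2.2 t ht, hV'.2.2 t ht]
  · obtain ⟨k, h1, h2⟩ := exists_zpow_mul_mem ht
    rw [← zpow_mul_zpow_neg k t, rightCone_zpow hV, rightCone_zpow hV',
      h _ (zpow_neg_mul_mem h1 h2.le)]

/-- The self-similar extension of `v` restricted to `[1, 2]`. -/
noncomputable def coneFun (v : ℝ → ℝ) (t : ℝ) : ℝ :=
  if t ≤ 0 then t else 2 ^ Int.log 2 t * v (2 ^ (-Int.log 2 t) * t)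

/-- The relation `v 2 = 2 * v 1` makes the formulas of consecutive cells agree at their common
endpoint, so closed cells are allowed. -/
theorem coneFun_eq {v : ℝ → ℝ} (hv : v 2 = 2 * v 1) {t : ℝ} {k : ℤ} (h1 : (2 : ℝ) ^ k ≤ t)
    (h2 : t ≤ 2 ^ (k + 1)) : coneFun v t = 2 ^ k * v (2 ^ (-k) * t) := by
  have ht : 0 < t := lt_of_lt_of_le (by positivity) h1
  unfold coneFun
  rw [if_neg ht.not_ge]
  rcases h2.lt_or_eq with h2 | rfl
  · rw [log_eq h1 h2]
  · rw [log_eq le_rfl (by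
      rw [zpow_add_one₀ two_ne_zero (k + 1)]
      have : (0 : ℝ) < 2 ^ (k + 1) := by positivity
      linarith), ← zpow_add₀ two_ne_zero, ← zpow_add₀ two_ne_zero,
      show -(k + 1) + (k + 1) = 0 by ring, show -k + (k + 1) = 1 by ring, zpow_zero, zpow_one, hv,
      zpow_add_one₀ two_ne_zero]
    ring

/-- Here `v` need not preserve `[1, 2]`: as for a lift of a homeomorphism of the circle (0, ∞)/(t ∼
2t), the only compatibility required is `v 2 = 2 * v 1`. -/
theorem exists_rightCone {v : ℝ ≃o ℝ} (hv0 : 0 < v 1) (hv : v 2 = 2 * v 1)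
    (hpl : ∀ t ∈ Icc (1 : ℝ) 2, PLAt v t) :
    ∃ V ∈ rightCone, ∀ t ∈ Icc (1 : ℝ) 2, V t = v t := by
  have hpos : ∀ k : ℤ, (0 : ℝ) < 2 ^ k := fun k => by positivity
  have hneg : ∀ t ≤ 0, coneFun v t = t := fun t ht => if_pos ht
  have hlow : ∀ {t : ℝ} {k : ℤ}, (2 : ℝ) ^ k ≤ t → t < 2 ^ (k + 1) → 2 ^ k * v 1 ≤ coneFun v t := by
    intro t k h1 h2
    rw [coneFun_eq hv h1 h2.le]
    exact mul_le_mul_of_nonneg_left (v.monotone (zpow_neg_mul_mem h1 h2.le).1) (hpos k).le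
  have hup : ∀ {t : ℝ} {k : ℤ}, (2 : ℝ) ^ k ≤ t → t < 2 ^ (k + 1) →
      coneFun v t < 2 ^ (k + 1) * v 1 := by
    intro t k h1 h2
    rw [coneFun_eq hv h1 h2.le, zpow_add_one₀ two_ne_zero, mul_assoc, ← hv]
    refine mul_lt_mul_of_pos_left (v.strictMono ?_) (hpos k)
    rw [zpow_add_one₀ two_ne_zero] at h2
    rw [zpow_neg, ← div_eq_inv_mul, div_lt_iff₀ (hpos k)]
    linarith
  have hmono : StrictMono (coneFun v) := by
    intro s t hst
    rcases le_or_gt t 0 with ht | ht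
    · rwa [hneg s (hst.le.trans ht), hneg t ht]
    obtain ⟨k, k1, k2⟩ := exists_zpow_mul_mem ht
    rcases le_or_gt s 0 with hs | hs
    · rw [hneg s hs]
      exact hs.trans_lt (lt_of_lt_of_le (mul_pos (hpos k) hv0) (hlow k1 k2))
    obtain ⟨l, l1, l2⟩ := exists_zpow_mul_mem hs
    have hlk : l ≤ k := by
      by_contra h
      have : (2 : ℝ) ^ (k + 1) ≤ 2 ^ l := zpow_le_zpow_right₀ one_le_two (by omega)
      linarith
    rcases hlk.eq_or_lt with rfl | h
    · rw [coneFun_eq hv l1 l2.le, coneFun_eq hv k1 k2.le]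
      exact mul_lt_mul_of_pos_left (v.strictMono (mul_lt_mul_of_pos_left hst (hpos _))) (hpos _)
    · refine (hup l1 l2).trans_le (le_trans ?_ (hlow k1 k2))
      exact mul_le_mul_of_nonneg_right (zpow_le_zpow_right₀ one_le_two (by omega)) hv0.le
  have hsurj : Function.Surjective (coneFun v) := by
    intro y
    rcases le_or_gt y 0 with hy | hy
    · exact ⟨y, hneg y hy⟩
    obtain ⟨k, k1, k2⟩ := exists_zpow_mul_mem (div_pos hy hv0)
    rw [le_div_iff₀ hv0] at k1
    rw [div_lt_iff₀ hv0, zpow_add_one₀ two_ne_zero, mul_assoc, ← hv] at k2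
    refine ⟨2 ^ k * v.symm (2 ^ (-k) * y), ?_⟩
    have h1 : 1 ≤ v.symm (2 ^ (-k) * y) := by
      rw [v.le_symm_apply, zpow_neg, ← div_eq_inv_mul, le_div_iff₀ (hpos k)]
      linarith
    have h2 : v.symm (2 ^ (-k) * y) ≤ 2 := by
      rw [v.symm_apply_le, zpow_neg, ← div_eq_inv_mul, div_le_iff₀ (hpos k)]
      linarith
    rw [coneFun_eq (k := k) hv, ← mul_assoc (2 ^ (-k)), ← zpow_add₀ two_ne_zero, neg_add_cancel,
      zpow_zero, one_mul, v.apply_symm_apply, zpow_mul_zpow_neg]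
    · nlinarith [hpos k]
    · rw [zpow_add_one₀ two_ne_zero]
      nlinarith [hpos k]
  refine ⟨hmono.orderIsoOfSurjective _ hsurj, ⟨fun t => ?_, fun t ht => ?_, hneg⟩, fun t ht => ?_⟩
  · change coneFun v (2 * t) = 2 * coneFun v t
    rcases le_or_gt t 0 with ht | ht
    · rw [hneg t ht, hneg _ (by linarith)]
    obtain ⟨k, k1, k2⟩ := exists_zpow_mul_mem ht
    have e : (2 : ℝ) ^ (k + 1) = 2 * 2 ^ k := by rw [zpow_add_one₀ two_ne_zero, mul_comm]
    rw [coneFun_eq hv k1 k2.le, coneFun_eq (k := k + 1) hv (by linarith) (by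
      rw [zpow_add_one₀ two_ne_zero (k + 1)]
      linarith), e, mul_assoc, show (2 : ℝ) ^ (-(k + 1)) * (2 * t) = 2 ^ (-k) * t by
        rw [neg_add, zpow_add₀ two_ne_zero, zpow_neg_one]
        ring]
  · change PLAt (coneFun v) t
    have hlocal : ∀ (k : ℤ) (t : ℝ), (2 : ℝ) ^ k ≤ t → t ≤ 2 ^ (k + 1) →
        PLAt (fun s => 2 ^ k * v (2 ^ (-k) * s)) t := by
      intro k t h1 h2
      have h3 : PLAt (fun s : ℝ => 2 ^ (-k) * s) t :=
        plAt_of_affine (n := -k) isDyadic_zero (Eventually.of_forall fun s => by simp)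
      have h4 : PLAt (fun s : ℝ => 2 ^ k * s) (v (2 ^ (-k) * t)) :=
        plAt_of_affine (n := k) isDyadic_zero (Eventually.of_forall fun s => by simp)
      exact PLAt.comp (g := fun s : ℝ => 2 ^ k * s) (f := fun s : ℝ => v (2 ^ (-k) * s)) h4
        (PLAt.comp (g := v) (f := fun s : ℝ => 2 ^ (-k) * s) (hpl _ (zpow_neg_mul_mem h1 h2)) h3)
    rcases lt_or_gt_of_ne ht with h | h
    · refine (plAt_id t).congr ?_
      filter_upwards [Iio_mem_nhds h] with s hs
      exact (hneg s (le_of_lt hs)).symm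
    obtain ⟨k, k1, k2⟩ := exists_zpow_mul_mem h
    rcases k1.lt_or_eq with k1 | rfl
    · refine (hlocal k t k1.le k2.le).congr ?_
      filter_upwards [Ioo_mem_nhds k1 k2] with s hs
      exact (coneFun_eq hv hs.1.le hs.2.le).symm
    -- At `2 ^ k` two rescaled copies of `v` meet, and they are glued at this dyadic point.
    · have hk : (2 : ℝ) ^ (k - 1 + 1) = 2 ^ k := by rw [sub_add_cancel]
      have hk' : (2 : ℝ) ^ (k - 1) < 2 ^ k := zpow_lt_zpow_right₀ one_lt_two (by omega)
      refine (plAt_glueFun (p := 2 ^ k) (u := fun s => 2 ^ (k - 1) * v (2 ^ (-(k - 1)) * s))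
        (v := fun s => 2 ^ k * v (2 ^ (-k) * s)) ?_ ?_ (fun _ => hlocal _ _ hk'.le hk.ge)
        fun _ => hlocal _ _ le_rfl k2.le).congr ?_
      · simpa using isDyadic_one.pow_mul k
      · rw [← coneFun_eq hv hk'.le hk.ge, coneFun_eq hv le_rfl k2.le]
      · filter_upwards [Ioo_mem_nhds hk' k2] with s hs
        rcases le_or_gt s (2 ^ k) with h | h
        · rw [glueFun_of_le h, coneFun_eq hv hs.1.le (by rwa [hk])]
        · rw [glueFun_of_lt h, coneFun_eq hv h.le hs.2.le]
  · change coneFun v t = v t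
    rw [coneFun_eq (k := 0) hv (by simpa using ht.1) (by simpa using ht.2)]
    simp

theorem exists_rightCone_apply_one {q : ℝ} (hq : IsDyadic q) (hq0 : 0 < q) :
    ∃ V ∈ rightCone, V 1 = q := by
  have h2 : IsDyadic 2 := by simpa using isDyadic_int 2
  have hq2 : IsDyadic (2 * q) := by simpa using hq.pow_mul 1
  obtain ⟨v, hv, v1, v2⟩ := exists_mem_PL isDyadic_one h2 hq hq2 one_lt_two (by linarith)
  obtain ⟨V, hV, h⟩ := exists_rightCone (v := v) (by rwa [v1]) (by rw [v1, v2]) fun t _ => hv t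
  exact ⟨V, hV, by rw [h 1 (by norm_num), v1]⟩

theorem exists_rightCone_of_PLOn {u : ℝ ≃o ℝ} (hu : u ∈ PLOn 1 2) :
    ∃ V ∈ rightCone, ∀ t ∈ Icc (1 : ℝ) 2, V t = u t := by
  have h1 : u 1 = 1 := hu.2 1 (by simp)
  have h2 : u 2 = 2 := hu.2 2 (by simp)
  exact exists_rightCone (by rw [h1]; norm_num) (by rw [h1, h2]; norm_num) fun t _ => hu.1 t

theorem exists_rightCone_doubling : ∃ Z ∈ rightCone, ∀ t, 0 < t → Z t = 2 * t := by
  obtain ⟨V, hV, h⟩ := exists_rightCone (v := affineIso 1 0) (by simp) (by simp)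
    fun t _ => affineIso_mem 1 isDyadic_zero t
  refine ⟨V, hV, fun t ht => ?_⟩
  obtain ⟨k, k1, k2⟩ := exists_zpow_mul_mem ht
  conv_lhs => rw [← zpow_mul_zpow_neg k t]
  rw [rightCone_zpow hV, h _ (zpow_neg_mul_mem k1 k2.le), affineIso_apply]
  conv_rhs => rw [← zpow_mul_zpow_neg k t]
  rw [zpow_one]
  ring

theorem isDyadic_two : IsDyadic 2 := by simpa using isDyadic_int 2

/-! ### Generating the self-similar automorphisms -/

section Generation

variable {R : Subgroup (ℝ ≃o ℝ)} {W : ℝ ≃o ℝ}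

/-- By self-similarity `V` is also the identity near 1, so its restriction to `[1, 2]` is a PL
automorphism whose support stays away from both ends, to which `h1` applies. -/
theorem mem_of_eq_id_near_two
    (h1 : ∀ a b, 1 < a → b < 2 → ∀ u ∈ PLOn a b, ∀ V ∈ rightCone,
      (∀ t ∈ Icc (1 : ℝ) 2, V t = u t) → V ∈ R)
    {V : ℝ ≃o ℝ} (hV : V ∈ rightCone) {c d : ℝ} (hc : c < 2) (hd : 2 < d)
    (h : ∀ t ∈ Icc c d, V t = t) : V ∈ R := by
  obtain ⟨a, ha, a1, a2⟩ := exists_isDyadic_between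
    (show (1 : ℝ) < min (d / 2) (5 / 4) from lt_min (by linarith) (by norm_num))
  obtain ⟨b, hb, b1, b2⟩ := exists_isDyadic_between
    (show max c (7 / 4) < 2 from max_lt hc (by norm_num))
  have a3 := a2.trans_le (min_le_left _ _)
  have a4 := a2.trans_le (min_le_right _ _)
  have b3 := (le_max_left c (7 / 4)).trans_lt b1
  have b4 := (le_max_right c (7 / 4)).trans_lt b1
  have hVa : ∀ t ∈ Icc 1 a, V t = t := by
    intro t ht
    have := h (2 * t) ⟨by linarith [ht.1], by linarith [ht.2]⟩
    rw [hV.1] at this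
    linarith
  have hVb : ∀ t ∈ Icc b 2, V t = t := fun t ht => h t ⟨by linarith [ht.1], by linarith [ht.2]⟩
  have e2 : V b = (1 : ℝ ≃o ℝ) b := hVb b ⟨le_rfl, b2.le⟩
  let g := glueIso b V 1 e2
  have e1 : (1 : ℝ ≃o ℝ) a = g a := by
    rw [coe_glueIso, glueFun_of_le (by linarith), hVa a ⟨a1.le, le_rfl⟩, one_apply]
  refine h1 a b a1 b2 (glueIso a 1 g e1) (mem_PLOn.2 ⟨fun t => ?_, fun t ht => ?_⟩) V hV
    fun t ht => ?_
  · exact plAt_glueFun ha e1 (fun _ => plAt_id t) fun h => plAt_glueFun hb e2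
      (fun _ => hV.2.1 t (by linarith)) fun _ => plAt_id t
  · rw [coe_glueIso]
    rcases le_or_gt t a with h' | h'
    · rw [glueFun_of_le h', one_apply]
    · rw [glueFun_of_lt h', coe_glueIso, glueFun_of_ge e2 (not_lt.1 fun h'' => ht ⟨h', h''⟩),
        one_apply]
  · rw [coe_glueIso]
    rcases le_or_gt t a with h' | h'
    · rw [glueFun_of_le h', one_apply, hVa t ⟨ht.1, h'⟩]
    · rw [glueFun_of_lt h', coe_glueIso]
      rcases le_or_gt t b with h'' | h''
      · rw [glueFun_of_le h'']
      · rw [glueFun_of_lt h'', one_apply, hVb t ⟨h''.le, ht.2⟩]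

/-- An element of the family in `h2` is made to agree with `V` near the point 2; dividing it off
leaves an element which is the identity there and is covered by `mem_of_eq_id_near_two`. -/
theorem mem_of_apply_one_mem
    (h1 : ∀ a b, 1 < a → b < 2 → ∀ u ∈ PLOn a b, ∀ V ∈ rightCone,
      (∀ t ∈ Icc (1 : ℝ) 2, V t = u t) → V ∈ R)
    (hW : W ∈ rightCone) (hW1 : W 1 = 3 / 2)
    (h2 : ∀ a b, 1 < a → b < 2 → ∀ u ∈ PLOn a b, ∀ V ∈ rightCone,
      (∀ t ∈ Icc (1 : ℝ) 2, V t = u t) → W * V * W⁻¹ ∈ R)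
    {V : ℝ ≃o ℝ} (hV : V ∈ rightCone) (hV1 : 3 / 4 < V 1) (hV2 : V 1 < 3 / 2) : V ∈ R := by
  set V' := W⁻¹ * V * W with hV'
  have hV'm : V' ∈ rightCone := mul_mem (mul_mem (inv_mem hW) hV) hW
  have hW2 : W 2 = 3 := by
    have := hW.1 1
    rw [hW1, mul_one] at this
    linarith
  -- `W` maps `(1, 2)` onto `(3 / 2, 3)`. The bounds on `V 1` say that this interval contains `V 2 =
  -- 2 * V 1` besides 2, so that `V'` moves `q` to a point of `(1, 2)`.
  set q := W.symm 2 with hq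
  have q1 : 1 < q := by
    rw [hq, W.lt_symm_apply, hW1]
    norm_num
  have q2 : q < 2 := by
    rw [hq, W.symm_apply_lt, hW2]
    norm_num
  have hVq : V' q = W.symm (2 * V 1) := by
    have : V' q = W.symm (V (W (W.symm 2))) := rfl
    rw [this, W.apply_symm_apply, ← hV.1, mul_one]
  have v1 : 1 < V' q := by
    rw [hVq, W.lt_symm_apply, hW1]
    linarith
  have v2 : V' q < 2 := by
    rw [hVq, W.symm_apply_lt, hW2]
    linarith
  obtain ⟨a, ha, a1, a2⟩ := exists_isDyadic_between (lt_min q1 v1)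
  obtain ⟨b, hb, b1, b2⟩ := exists_isDyadic_between (max_lt q2 v2)
  have a3 := a2.trans_le (min_le_left _ _)
  have a4 := a2.trans_le (min_le_right _ _)
  have b3 := (le_max_left _ _).trans_lt b1
  have b4 := (le_max_right _ _).trans_lt b1
  obtain ⟨s, r, hs, hr, hsq, hqr, hsub⟩ := exists_dyadic_Icc_subset
    (inter_mem (Ioo_mem_nhds a3 b3) (V'.continuous.continuousAt (Ioo_mem_nhds a4 b4)))
  have hss := hsub (left_mem_Icc.2 (hsq.trans hqr).le)
  have hrr := hsub (right_mem_Icc.2 (hsq.trans hqr).le)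
  obtain ⟨u, hu, huv⟩ := exists_cutoff_PL (v := V') ha hb hs hr hss.1.1 (hsq.trans hqr).le
    hrr.1.2 hss.2.1 hrr.2.2 fun t ht => hV'm.2.1 t (by linarith [ht.1, hss.1.1])
  obtain ⟨U, hU, hUu⟩ := exists_rightCone_of_PLOn (PLOn_mono a1.le b2.le hu)
  have hR := h2 a b a1 b2 u hu U hU hUu
  have hid : ∀ t ∈ Icc s r, (U⁻¹ * V') t = t := by
    intro t ht
    have : U.symm (V' t) = t := by
      rw [U.symm_apply_eq, ← huv t ht, hUu t]
      exact ⟨by linarith [ht.1, hss.1.1], by linarith [ht.2, hrr.1.2]⟩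
    exact this
  have hmem : W * (U⁻¹ * V') * W⁻¹ ∈ R := by
    refine mem_of_eq_id_near_two h1 (mul_mem (mul_mem hW (mul_mem (inv_mem hU) hV'm))
      (inv_mem hW)) (c := W s) (d := W r) ?_ ?_ fun t ht => ?_
    · rwa [← W.lt_symm_apply]
    · rwa [← W.symm_apply_lt]
    · have h3 := hid (W.symm t) ⟨W.le_symm_apply.2 ht.1, W.symm_apply_le.2 ht.2⟩
      have : (W * (U⁻¹ * V') * W⁻¹) t = W ((U⁻¹ * V') (W.symm t)) := rfl
      rw [this, h3, W.apply_symm_apply]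
  have : V = (W * U * W⁻¹) * (W * (U⁻¹ * V') * W⁻¹) := by
    rw [hV']
    group
  rw [this]
  exact mul_mem hR hmem

/-- Multiplying by a power of the doubling map brings the image of 1 into `[1, 2)`, and a further
motion inside `(1, 2)` brings it into the range of `mem_of_apply_one_mem`. The main point is that
the doubling map `Z` itself lies in `R`. -/
theorem rightCone_le_of
    (h1 : ∀ a b, 1 < a → b < 2 → ∀ u ∈ PLOn a b, ∀ V ∈ rightCone,
      (∀ t ∈ Icc (1 : ℝ) 2, V t = u t) → V ∈ R)
    (hW : W ∈ rightCone) (hW1 : W 1 = 3 / 2)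
    (h2 : ∀ a b, 1 < a → b < 2 → ∀ u ∈ PLOn a b, ∀ V ∈ rightCone,
      (∀ t ∈ Icc (1 : ℝ) 2, V t = u t) → W * V * W⁻¹ ∈ R) : rightCone ≤ R := by
  have near := @mem_of_apply_one_mem R W h1 hW hW1 h2
  have move : ∀ p q : ℝ, IsDyadic p → IsDyadic q → 1 < p → p < 2 → 1 < q → q < 2 →
      ∃ V ∈ rightCone, V ∈ R ∧ V p = q := by
    intro p q hp hq p1 p2 q1 q2
    obtain ⟨a, ha, a1, a2⟩ := exists_isDyadic_between (lt_min p1 q1)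
    obtain ⟨b, hb, b1, b2⟩ := exists_isDyadic_between (max_lt p2 q2)
    obtain ⟨u, hu, e⟩ := exists_PLOn_apply_eq ha hb hp hq (a2.trans_le (min_le_left _ _))
      ((le_max_left _ _).trans_lt b1) (a2.trans_le (min_le_right _ _))
      ((le_max_right _ _).trans_lt b1)
    obtain ⟨V, hV, hVu⟩ := exists_rightCone_of_PLOn (PLOn_mono a1.le b2.le hu)
    exact ⟨V, hV, h1 a b a1 b2 u hu V hV hVu, by rw [hVu p ⟨p1.le, p2.le⟩, e]⟩
  obtain ⟨Z, hZ, hZ2⟩ := exists_rightCone_doubling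
  have hZR : Z ∈ R := by
    -- `Z` is compared with a chain 1 ↦ 9/8 ↦ 15/8 ↦ 2 effected by `A`, `B` and `C⁻¹`, the last
    -- because `C 2 = 2 * C 1 = 15 / 8`. Each factor moves points little enough to lie in `R`, and
    -- `Z⁻¹` times the chain fixes 1.
    obtain ⟨A, hA, A1⟩ := exists_rightCone_apply_one (q := 9 / 8) ⟨9, 3, by norm_num⟩ (by norm_num)
    obtain ⟨B, hB, hBR, B1⟩ := move (9 / 8) (15 / 8) ⟨9, 3, by norm_num⟩ ⟨15, 3, by norm_num⟩
      (by norm_num) (by norm_num) (by norm_num) (by norm_num)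
    obtain ⟨C, hC, C1⟩ := exists_rightCone_apply_one (q := 15 / 16) ⟨15, 4, by norm_num⟩
      (by norm_num)
    have hAR := near hA (by rw [A1]; norm_num) (by rw [A1]; norm_num)
    have hCR := near hC (by rw [C1]; norm_num) (by rw [C1]; norm_num)
    have e : (Z⁻¹ * (C⁻¹ * B * A)) 1 = 1 := by
      have : Z.symm (C.symm (B (A 1))) = 1 := by
        rw [A1, B1, Z.symm_apply_eq, C.symm_apply_eq, hZ2 1 one_pos, hC.1, C1]
        norm_num
      exact this
    have hmem := near (mul_mem (inv_mem hZ) (mul_mem (mul_mem (inv_mem hC) hB) hA))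
      (by rw [e]; norm_num) (by rw [e]; norm_num)
    have : Z = (C⁻¹ * B * A) * (Z⁻¹ * (C⁻¹ * B * A))⁻¹ := by group
    rw [this]
    exact mul_mem (mul_mem (mul_mem (inv_mem hCR) hBR) hAR) (inv_mem hmem)
  have hZpow : ∀ (n : ℤ) (t : ℝ), 0 < t → (Z ^ n) t = 2 ^ n * t := by
    have hn : ∀ (n : ℕ) (t : ℝ), 0 < t → (Z ^ n) t = 2 ^ n * t := by
      intro n
      induction n with
      | zero => simp
      | succ n ih =>
        intro t ht
        rw [pow_succ', RelIso.mul_apply, ih t ht, hZ2 _ (by positivity)]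
        ring
    intro n t ht
    obtain ⟨k, rfl | rfl⟩ := n.eq_nat_or_neg
    · simpa using hn k t ht
    · rw [zpow_neg, zpow_natCast, zpow_neg, zpow_natCast]
      change (Z ^ k).symm t = _
      rw [OrderIso.symm_apply_eq, hn k _ (by positivity), mul_inv_cancel_left₀ (by positivity)]
  intro V hV
  have hpos : 0 < V 1 := rightCone_pos hV one_pos
  obtain ⟨k, k1, k2⟩ := exists_zpow_mul_mem hpos
  have hp : (0 : ℝ) < 2 ^ k := by positivity
  set V' := Z ^ (-k) * V with hV'
  have hV'm : V' ∈ rightCone := mul_mem (zpow_mem hZ _) hV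
  have hV'1 : V' 1 = 2 ^ (-k) * V 1 := by rw [hV', RelIso.mul_apply, hZpow _ _ hpos]
  have hV'R : V' ∈ R := by
    have hl : 1 ≤ V' 1 := by
      rw [hV'1, zpow_neg, ← div_eq_inv_mul, le_div_iff₀ hp]
      linarith
    have hu : V' 1 < 2 := by
      rw [zpow_add_one₀ two_ne_zero] at k2
      rw [hV'1, zpow_neg, ← div_eq_inv_mul, div_lt_iff₀ hp]
      linarith
    rcases lt_or_ge (V' 1) (3 / 2) with h | h
    · exact near hV'm (by linarith) h
    · have hd : IsDyadic (V' 1) := (isDyadic_apply (rightCone_le_TD hV'm)).2 isDyadic_one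
      obtain ⟨B, hB, hBR, B1⟩ := move (V' 1) (5 / 4) hd ⟨5, 2, by norm_num⟩ (by linarith) hu
        (by norm_num) (by norm_num)
      have e : (B * V') 1 = 5 / 4 := B1
      have := near (mul_mem hB hV'm) (by rw [e]; norm_num) (by rw [e]; norm_num)
      have h' : V' = B⁻¹ * (B * V') := by group
      rw [h']
      exact mul_mem (inv_mem hBR) this
  have : V = Z ^ k * V' := by
    rw [hV']
    group
  rw [this]
  exact mul_mem (zpow_mem hZR _) hV'R

end Generation

/-- Piecewise linear automorphisms supported in `(1, 2)` whose self-similar extension is in `R`. -/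
def coneRestrictions (R : Subgroup (ℝ ≃o ℝ)) : Subgroup (ℝ ≃o ℝ) where
  carrier := {u | u ∈ PLOn 1 2 ∧ ∃ V ∈ R, V ∈ rightCone ∧ ∀ t ∈ Icc (1 : ℝ) 2, V t = u t}
  mul_mem' := by
    rintro u u' ⟨hu, V, hV, hVc, h⟩ ⟨hu', V', hV', hVc', h'⟩
    refine ⟨mul_mem hu hu', V * V', mul_mem hV hV', mul_mem hVc hVc', fun t ht => ?_⟩
    rw [RelIso.mul_apply, RelIso.mul_apply, h' t ht, h _ ((suppIn_mem_Icc hu'.2).2 ht)]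
  one_mem' := ⟨one_mem _, 1, one_mem _, one_mem _, fun _ _ => rfl⟩
  inv_mem' := by
    rintro u ⟨hu, V, hV, hVc, h⟩
    refine ⟨inv_mem hu, V⁻¹, inv_mem hV, inv_mem hVc, fun t ht => ?_⟩
    have h1 : u.symm t ∈ Icc (1 : ℝ) 2 := by
      rw [← suppIn_mem_Icc hu.2, u.apply_symm_apply]
      exact ht
    have : V.symm t = u.symm t := by rw [V.symm_apply_eq, h _ h1, u.apply_symm_apply]
    exact this

theorem rightCone_le_of_coneRestrictions {R : Subgroup (ℝ ≃o ℝ)} {W : ℝ ≃o ℝ}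
    (hW : W ∈ rightCone) (hW1 : W 1 = 3 / 2)
    (h1 : ∀ a b, 1 < a → b < 2 → PLOn a b ≤ coneRestrictions R)
    (h2 : ∀ V ∈ R, V ∈ rightCone → W * V * W⁻¹ ∈ R) : rightCone ≤ R := by
  have key : ∀ a b, 1 < a → b < 2 → ∀ u ∈ PLOn a b, ∀ V ∈ rightCone,
      (∀ t ∈ Icc (1 : ℝ) 2, V t = u t) → V ∈ R := by
    intro a b ha hb u hu V hV h
    obtain ⟨-, V', hV', hVc', h'⟩ := h1 a b ha hb hu
    rwa [rightCone_ext hV hVc' fun t ht => by rw [h t ht, h' t ht]]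
  exact rightCone_le_of key hW hW1 fun a b ha hb u hu V hV h =>
    h2 V (key a b ha hb u hu V hV h) hV

/-- The extensions of finitely many PL automorphisms of `(1, 2)` generate all extensions with
support away from 1 and 2, and the single extra generator `W` supplies their conjugates. -/
theorem exists_rightCone_generators : ∃ T : Set (ℝ ≃o ℝ), T.Finite ∧ T ⊆ rightCone ∧
    rightCone ≤ Subgroup.closure T := by
  obtain ⟨W, hW, hW1⟩ := exists_rightCone_apply_one (q := 3 / 2) ⟨3, 1, by norm_num⟩ (by norm_num)
  obtain ⟨T, hT, hTs, h⟩ := exists_PLOn_le_commutator isDyadic_one isDyadic_two one_lt_two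
  choose! E hE hEu using fun u (hu : u ∈ PLOn 1 2) => exists_rightCone_of_PLOn hu
  refine ⟨insert W (E '' T), (hT.image E).insert W, ?_, ?_⟩
  · rintro _ (rfl | ⟨u, hu, rfl⟩)
    exacts [hW, hE u (hTs hu)]
  have hWc : W ∈ Subgroup.closure (insert W (E '' T)) := Subgroup.subset_closure (mem_insert _ _)
  refine rightCone_le_of_coneRestrictions hW hW1 (fun a b ha hb => (h a b ha hb).trans
    (Subgroup.commutator_le_self _ |>.trans ((Subgroup.closure_le _).2 fun u hu => ?_)))
    fun V hV _ => mul_mem (mul_mem hWc hV) (inv_mem hWc)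
  exact ⟨hTs hu, E u, Subgroup.subset_closure (mem_insert_of_mem _ (mem_image_of_mem _ hu)),
    hE u (hTs hu), hEu u (hTs hu)⟩

/-- Extensions of PL automorphisms supported away from the ends of `(1, 2)` are products of
commutators because their restrictions are. The identity `W * V * W⁻¹ = ⁅W, V⁆ * V` puts their
conjugates into the derived subgroup as well. -/
theorem rightCone_le_commutator : rightCone ≤ ⁅rightCone, rightCone⁆ := by
  obtain ⟨W, hW, hW1⟩ := exists_rightCone_apply_one (q := 3 / 2) ⟨3, 1, by norm_num⟩ (by norm_num)
  obtain ⟨T, -, hTs, h⟩ := exists_PLOn_le_commutator isDyadic_one isDyadic_two one_lt_two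
  have hT : Subgroup.closure T ≤ PLOn 1 2 := (Subgroup.closure_le _).2 hTs
  refine rightCone_le_of_coneRestrictions hW hW1 (fun a b ha hb => (h a b ha hb).trans
    (Subgroup.commutator_le.2 fun u hu u' hu' => ?_)) fun V hV hVc => ?_
  · obtain ⟨V, hV, e⟩ := exists_rightCone_of_PLOn (hT hu)
    obtain ⟨V', hV', e'⟩ := exists_rightCone_of_PLOn (hT hu')
    have inv1 : ∀ {u V : ℝ ≃o ℝ}, u ∈ PLOn 1 2 → (∀ t ∈ Icc (1 : ℝ) 2, V t = u t) →
        ∀ t ∈ Icc (1 : ℝ) 2, u⁻¹ t ∈ Icc (1 : ℝ) 2 ∧ V⁻¹ t = u⁻¹ t := by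
      intro u V hu e t ht
      have h1 : u.symm t ∈ Icc (1 : ℝ) 2 := by
        rw [← suppIn_mem_Icc hu.2, u.apply_symm_apply]
        exact ht
      have : V.symm t = u.symm t := by rw [V.symm_apply_eq, e _ h1, u.apply_symm_apply]
      exact ⟨h1, this⟩
    refine ⟨mul_mem (mul_mem (mul_mem (hT hu) (hT hu')) (inv_mem (hT hu))) (inv_mem (hT hu')),
      ⁅V, V'⁆, Subgroup.commutator_mem_commutator hV hV',
      mul_mem (mul_mem (mul_mem hV hV') (inv_mem hV)) (inv_mem hV'), fun t ht => ?_⟩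
    simp only [commutatorElement_def, RelIso.mul_apply]
    obtain ⟨m1, e1⟩ := inv1 (hT hu') e' t ht
    obtain ⟨m2, e2⟩ := inv1 (hT hu) e _ m1
    rw [e1, e2, e' _ m2, e _ ((suppIn_mem_Icc (PLOn_le_suppIn _ _ (hT hu'))).2 m2)]
  · have : W * V * W⁻¹ = ⁅W, V⁆ * V := by
      rw [commutatorElement_def]
      group
    rw [this]
    exact mul_mem (Subgroup.commutator_mem_commutator hW hVc) hV

/-! ### Generation and perfectness of groups of type `𝔇` automorphisms -/

/-- Conjugation by `t ↦ -t`. -/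
def negConj : (ℝ ≃o ℝ) →* (ℝ ≃o ℝ) where
  toFun f :=
    { toFun := fun t => -f (-t)
      invFun := fun t => -f.symm (-t)
      left_inv := fun t => by simp
      right_inv := fun t => by simp
      map_rel_iff' := by simp }
  map_one' := by
    ext t
    exact neg_neg t
  map_mul' f g := by
    ext t
    change -f (g (-t)) = -f (- -g (-t))
    rw [neg_neg]

@[simp] theorem negConj_apply (f : ℝ ≃o ℝ) (t : ℝ) : negConj f t = -f (-t) := rfl

theorem plAt_negConj {f : ℝ ≃o ℝ} {t : ℝ} (h : PLAt f (-t)) : PLAt (negConj f) t := by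
  have := PLAt.conj (f := f) (t := t) (ε := -1) (n := 0) (Or.inr rfl) (by simpa using h)
  exact this.congr (Eventually.of_forall fun s => by simp)

theorem singAt_negConj {f : ℝ ≃o ℝ} {t : ℝ} (h : SingAt f (-t)) : SingAt (negConj f) t := by
  have := SingAt.conj (f := f) (t := t) (ε := -1) (n := 0) (Or.inr rfl) (by simpa using h)
  exact this.congr (Eventually.of_forall fun s => by simp)

theorem negConj_mem_TD {f : ℝ ≃o ℝ} (h : f ∈ TD) : negConj f ∈ TD :=
  fun t => (h (-t)).imp plAt_negConj singAt_negConj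

/-- Close to 0 the germ is determined by its values on one fundamental domain `[2 ^ (-k), 2 * 2 ^
(-k)]`. Rescaled to `[1, 2]`, this piece extends to a self-similar automorphism. -/
theorem exists_rightCone_of_singAt {g : ℝ ≃o ℝ} (h0 : g 0 = 0) (h : SingAt g 0) :
    ∃ V ∈ rightCone, ∀ᶠ t in 𝓝[≥] 0, g t = V t := by
  obtain ⟨-, h1, h2⟩ := h
  rw [eventually_nhdsWithin_iff] at h1
  obtain ⟨δ, hδ, hball⟩ := Metric.eventually_nhds_iff.1 (h1.and h2)
  have hg : ∀ t, 0 < t → t < δ → PLAt g t ∧ g (2 * t) = 2 * g t := by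
    intro t ht ht'
    obtain ⟨k1, k2⟩ := hball (y := t) (by rwa [Real.dist_eq, sub_zero, abs_of_pos ht])
    refine ⟨k1 ht.ne', ?_⟩
    simpa [doubling, h0] using k2
  obtain ⟨k, hk⟩ := exists_pow_lt_of_lt_one (show 0 < δ / 2 by linarith)
    (by norm_num : (1 / 2 : ℝ) < 1)
  rw [one_div, inv_pow, ← zpow_natCast, ← zpow_neg] at hk
  have hpos : (0 : ℝ) < 2 ^ (-(k : ℤ)) := by positivity
  let v : ℝ ≃o ℝ := affineIso k 0 * g * affineIso (-k) 0
  have hv : ∀ t, v t = 2 ^ (k : ℤ) * g (2 ^ (-(k : ℤ)) * t) := fun t => by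
    simp [v, RelIso.mul_apply]
  have hv2 : v 2 = 2 * v 1 := by
    rw [hv, hv, mul_one, mul_comm _ (2 : ℝ), (hg _ hpos (by linarith)).2]
    ring
  have hvpl : ∀ t ∈ Icc (1 : ℝ) 2, PLAt v t := by
    intro t ht
    have h3 : PLAt (fun s : ℝ => 2 ^ (-(k : ℤ)) * s) t :=
      plAt_of_affine (n := -k) isDyadic_zero (Eventually.of_forall fun s => by simp)
    have h4 : PLAt (fun s : ℝ => 2 ^ (k : ℤ) * s) (g (2 ^ (-(k : ℤ)) * t)) :=
      plAt_of_affine (n := k) isDyadic_zero (Eventually.of_forall fun s => by simp)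
    refine (PLAt.comp (g := fun s : ℝ => 2 ^ (k : ℤ) * s)
      (f := fun s : ℝ => g (2 ^ (-(k : ℤ)) * s)) h4
      (PLAt.comp (g := g) (f := fun s : ℝ => 2 ^ (-(k : ℤ)) * s) (hg _ ?_ ?_).1 h3)).congr
      (Eventually.of_forall fun s => (hv s).symm)
    · nlinarith [ht.1]
    · nlinarith [ht.2]
  have hv1 : 0 < v 1 := by
    rw [hv, mul_one]
    have := g.strictMono hpos
    rw [h0] at this
    positivity
  obtain ⟨V, hV, hVv⟩ := exists_rightCone hv1 hv2 hvpl
  -- Induction on the number `j` of doublings that bring `s` into the fundamental domain.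
  have key : ∀ (j : ℕ) (s : ℝ), 2 ^ (-(k : ℤ)) ≤ 2 ^ j * s → 2 ^ j * s ≤ 2 * 2 ^ (-(k : ℤ)) →
      g s = V s := by
    intro j
    induction j with
    | zero =>
      intro s h1 h2
      rw [pow_zero, one_mul] at h1 h2
      have hs := hVv (2 ^ (k : ℤ) * s) ⟨by
        rwa [zpow_neg, inv_le_iff_one_le_mul₀' (by positivity)] at h1, by
        rw [zpow_neg, ← div_eq_mul_inv, le_div_iff₀' (by positivity)] at h2
        exact h2⟩
      rw [rightCone_zpow hV, hv, ← mul_assoc, ← zpow_add₀ two_ne_zero, neg_add_cancel, zpow_zero,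
        one_mul] at hs
      exact (mul_left_cancel₀ (by positivity) hs).symm
    | succ j ih =>
      intro s h1 h2
      rw [pow_succ, mul_assoc] at h1 h2
      have := ih (2 * s) h1 h2
      have hs : 0 < s := by
        by_contra hs
        have h5 : 2 ^ j * (2 * s) ≤ 0 :=
          mul_nonpos_of_nonneg_of_nonpos (by positivity) (by linarith)
        linarith
      have hs' : s < δ := by
        have : 2 * s ≤ 2 ^ j * (2 * s) :=
          le_mul_of_one_le_left (by linarith) (one_le_pow₀ one_le_two)
        linarith
      rw [(hg s hs hs').2, hV.1] at this
      linarith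
  refine ⟨V, hV, ?_⟩
  filter_upwards [Ico_mem_nhdsGE hpos] with t ht
  rcases ht.1.eq_or_lt with rfl | ht0
  · rw [h0, hV.2.2 0 le_rfl]
  obtain ⟨m, m1, m2⟩ := exists_zpow_mul_mem ht0
  have hm : m < -(k : ℤ) := by
    have := m1.trans_lt ht.2
    exact (zpow_lt_zpow_iff_right₀ one_lt_two).1 this
  obtain ⟨j, hj⟩ := Int.eq_ofNat_of_zero_le (show 0 ≤ -(k : ℤ) - m by omega)
  have e : (2 : ℝ) ^ (-(k : ℤ)) = 2 ^ j * 2 ^ m := by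
    rw [← zpow_natCast, ← zpow_add₀ two_ne_zero]
    congr 1
    omega
  have hp : (0 : ℝ) < 2 ^ j := by positivity
  rw [zpow_add_one₀ two_ne_zero] at m2
  refine key j t ?_ ?_
  · rw [e]
    exact mul_le_mul_of_nonneg_left m1 hp.le
  · rw [e]
    nlinarith

/-! ### Germs at singular points and their representatives -/

/-- The pairs `(V, n)` such that the germ of `n` at `p` is, up to translation, the germ of `V` at
`0`, and `n` is piecewise linear away from `p`. -/
def germRel (p : ℝ) : Subgroup ((ℝ ≃o ℝ) × (ℝ ≃o ℝ)) where
  carrier := {q | q.1 0 = 0 ∧ (∀ᶠ t in 𝓝 0, q.2 (p + t) = p + q.1 t) ∧ ∀ t ≠ p, PLAt q.2 t}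
  mul_mem' := by
    rintro ⟨V, n⟩ ⟨W, m⟩ ⟨V0, e, h⟩ ⟨W0, e', h'⟩
    simp only at V0 e h W0 e' h'
    have hmp : m p = p := by simpa [W0] using e'.self_of_nhds
    refine ⟨by simp [RelIso.mul_apply, W0, V0], ?_,
      fun t ht => (h _ fun hmt => ht (m.injective (hmt.trans hmp.symm))).comp (h' t ht)⟩
    have : Tendsto W (𝓝 0) (𝓝 0) := by
      have := W.continuous.tendsto 0
      rwa [W0] at this
    filter_upwards [e', this.eventually e] with t ht ht'
    change n (m _) = p + V (W t)
    rw [ht, ht']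
  one_mem' := ⟨rfl, Eventually.of_forall fun _ => rfl, fun t _ => plAt_id t⟩
  inv_mem' := by
    rintro ⟨V, n⟩ ⟨V0, e, h⟩
    simp only at V0 e h
    have hnp : n p = p := by simpa [V0] using e.self_of_nhds
    have hV0 : V.symm 0 = 0 := by rw [V.symm_apply_eq, V0]
    have hnp' : n.symm p = p := by rw [n.symm_apply_eq, hnp]
    refine ⟨hV0, ?_, fun t ht => ?_⟩
    · have : Tendsto V.symm (𝓝 0) (𝓝 0) := by
        have := V.symm.continuous.tendsto 0
        rwa [hV0] at this
      filter_upwards [this.eventually e] with t ht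
      change n.symm _ = p + V.symm t
      rw [n.symm_apply_eq, ht, V.apply_symm_apply]
    · have := (h (n.symm t) fun h => ht (n.symm.injective (h.trans hnp'.symm))).orderIso_symm
      rwa [n.apply_symm_apply] at this

/-- The automorphisms fixing `0` whose germ is represented at `p` by an element of `N` which is
piecewise linear away from `p`. -/
def germGroup (N : Subgroup (ℝ ≃o ℝ)) (p : ℝ) : Subgroup (ℝ ≃o ℝ) :=
  (germRel p ⊓ N.comap (MonoidHom.snd _ _)).map (MonoidHom.fst _ _)

theorem mem_germGroup {N : Subgroup (ℝ ≃o ℝ)} {p : ℝ} {V : ℝ ≃o ℝ} :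
    V ∈ germGroup N p ↔ ∃ n ∈ N, (V, n) ∈ germRel p := by
  simp only [germGroup, Subgroup.mem_map, Subgroup.mem_inf, Subgroup.mem_comap,
    MonoidHom.coe_fst, MonoidHom.coe_snd, Prod.exists]
  constructor
  · rintro ⟨_, n, ⟨h1, h2⟩, rfl⟩
    exact ⟨n, h2, h1⟩
  · rintro ⟨n, h1, h2⟩
    exact ⟨V, n, ⟨h2, h1⟩, rfl⟩

/-- Since `germRel p` is a subgroup of a product, commutators of germs are represented by
commutators of representatives, and no singularity appears away from `p`. -/
theorem commutator_le_germGroup {N R : Subgroup (ℝ ≃o ℝ)} {p : ℝ} (h : R ≤ germGroup N p) :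
    ⁅R, R⁆ ≤ germGroup ⁅N, N⁆ p := by
  refine Subgroup.commutator_le.2 fun V hV W hW => ?_
  obtain ⟨n, hn, hVn⟩ := mem_germGroup.1 (h hV)
  obtain ⟨m, hm, hWm⟩ := mem_germGroup.1 (h hW)
  exact mem_germGroup.2 ⟨⁅n, m⁆, Subgroup.commutator_mem_commutator hn hm,
    mul_mem (mul_mem (mul_mem hVn hWm) (inv_mem hVn)) (inv_mem hWm)⟩

/-- The representative is `V` translated to `p` and cut off, which adds no singular point. -/
theorem mem_germGroup_TDOn {a b p : ℝ} (ha : IsDyadic a) (hb : IsDyadic b) (hp : IsDyadic p)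
    (hap : a < p) (hpb : p < b) {V : ℝ ≃o ℝ} (hV : V ∈ TD) (h0 : V 0 = 0)
    (hpl : ∀ t ≠ 0, PLAt V t) : V ∈ germGroup (TDOn a b) p := by
  let v : ℝ ≃o ℝ := affineIso 0 p * V * affineIso 0 (-p)
  have hv : ∀ t, v t = V (t - p) + p := fun t => by
    simp [v, RelIso.mul_apply, sub_eq_add_neg]
  have hvTD : v ∈ TD := mul_mem (mul_mem (PL_le_TD (affineIso_mem 0 hp)) hV)
    (PL_le_TD (affineIso_mem 0 hp.neg))
  have hvp : v p = p := by rw [hv, sub_self, h0, zero_add]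
  have hmem : Ioo a b ∈ 𝓝 p := Ioo_mem_nhds hap hpb
  obtain ⟨s, r, hs, hr, hsp, hpr, hsub⟩ := exists_dyadic_Icc_subset
    (inter_mem hmem (v.continuous.continuousAt (by rwa [hvp])))
  have hss := hsub (left_mem_Icc.2 (hsp.trans hpr).le)
  have hrr := hsub (right_mem_Icc.2 (hsp.trans hpr).le)
  obtain ⟨u, hu, huv, hupl⟩ := exists_cutoff ha hb hs hr hss.1.1 (hsp.trans hpr).le hrr.1.2
    hss.2.1 hrr.2.2 fun t _ => hvTD t
  have hvpl : ∀ t ≠ p, PLAt v t := fun t ht =>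
    ((affineIso_mem 0 hp _).comp (hpl _ (sub_ne_zero.2 ht))).comp
      (f := fun t : ℝ => t - p) (plAt_of_affine (n := 0) hp.neg (Eventually.of_forall fun s => by
        simp [sub_eq_add_neg])) |>.congr (Eventually.of_forall fun s => by
        rw [hv]
        simp)
  refine mem_germGroup.2 ⟨u, hu, h0, ?_, fun t ht => hupl t fun _ => hvpl t ht⟩
  have : Tendsto (fun t : ℝ => p + t) (𝓝 0) (𝓝 p) := by
    have := (by fun_prop : Continuous fun t : ℝ => p + t).tendsto 0
    rwa [add_zero] at this
  filter_upwards [this (Icc_mem_nhds hsp hpr)] with t ht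
  rw [huv _ ht, hv, add_sub_cancel_left, add_comm]

/-- Every point has a punctured neighbourhood of PL points, and all singular points lie in the
compact interval `[a, b]`. -/
theorem finite_not_plAt {a b : ℝ} {f : ℝ ≃o ℝ} (hf : f ∈ TDOn a b) :
    {t | ¬ PLAt f t}.Finite ∧ {t | ¬ PLAt f t} ⊆ Icc a b := by
  have hsub : {t | ¬ PLAt f t} ⊆ Icc a b := by
    intro t ht
    by_contra h
    refine ht ((plAt_id t).congr ?_)
    filter_upwards [isClosed_Icc.isOpen_compl.mem_nhds h] with s hs
    exact ((TDOn_le_suppIn _ _ hf) s fun h => hs (Ioo_subset_Icc_self h)).symm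
  refine ⟨?_, hsub⟩
  have : (Icc a b ∩ {t | ¬ PLAt f t}).Finite := by
    refine isCompact_Icc.induction_on (p := fun K => (K ∩ {t | ¬ PLAt f t}).Finite) (by simp)
      (fun s t hst h => h.subset (inter_subset_inter_left _ hst))
      (fun s t hs ht => by rw [union_inter_distrib_right]; exact hs.union ht) fun t _ => ?_
    have h := (TDOn_le_TD _ _ hf t).eventually_plAt
    rw [eventually_nhdsWithin_iff] at h
    refine ⟨_, mem_nhdsWithin_of_mem_nhds h, (finite_singleton t).subset ?_⟩
    rintro s ⟨hs, hs'⟩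
    by_contra hst
    exact hs' (hs hst)
  rwa [inter_eq_right.2 hsub] at this

/-- A singular germ fixing its point is a product of a germ trivial to the left, provided by
`rightCone`, and one trivial to the right, provided by its mirror image. -/
theorem exists_germRel {N : Subgroup (ℝ ≃o ℝ)} {p : ℝ} (hR : rightCone ≤ germGroup N p)
    (hL : rightCone.map negConj ≤ germGroup N p) {f : ℝ ≃o ℝ} (hf : TDAt f p) (hd : IsDyadic p)
    (hfp : f p = p) : ∃ n ∈ N, (∀ᶠ t in 𝓝 p, n t = f t) ∧ ∀ t ≠ p, PLAt n t := by
  let g : ℝ ≃o ℝ := affineIso 0 (-p) * f * affineIso 0 p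
  have hg : ∀ t, g t = f (t + p) - p := fun t => by
    simp [g, RelIso.mul_apply, sub_eq_add_neg]
  have hg0 : g 0 = 0 := by rw [hg, zero_add, hfp, sub_self]
  have hgs : SingAt g 0 := by
    have h1 : TDAt (f * affineIso 0 p : ℝ ≃o ℝ) 0 := TDAt.comp (f := f) (g := affineIso 0 p)
      (by simpa using hf) (Or.inl (affineIso_mem 0 hd 0))
    have h2 : TDAt g 0 := TDAt.comp (f := affineIso 0 (-p)) (g := f * affineIso 0 p)
      (Or.inl (affineIso_mem 0 hd.neg _)) h1
    exact h2.singAt isDyadic_zero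
  obtain ⟨V, hV, hVg⟩ := exists_rightCone_of_singAt hg0 hgs
  obtain ⟨W, hW, hWg⟩ := exists_rightCone_of_singAt (g := negConj g) (by simp [hg0])
    (singAt_negConj (by simpa using hgs))
  obtain ⟨n, hn, hnV⟩ := mem_germGroup.1 (mul_mem (hR hV) (hL ⟨W, hW, rfl⟩))
  refine ⟨n, hn, ?_, hnV.2.2⟩
  have hsub : Tendsto (fun t : ℝ => t - p) (𝓝 p) (𝓝 0) := by
    have := (by fun_prop : Continuous fun t : ℝ => t - p).tendsto p
    rwa [sub_self] at this
  have hneg : Tendsto (fun t : ℝ => -t) (𝓝 0) (𝓝 0) := by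
    have := (by fun_prop : Continuous fun t : ℝ => -t).tendsto 0
    rwa [neg_zero] at this
  have e : ∀ᶠ t in 𝓝 0, (V * negConj W) t = g t := by
    rw [eventually_nhdsWithin_iff] at hVg hWg
    filter_upwards [hVg, hneg.eventually hWg] with t h1 h2
    rw [RelIso.mul_apply, negConj_apply]
    rcases le_total t 0 with h | h
    · have h3 := h2 (by simpa using h)
      rw [← h3, negConj_apply, neg_neg, neg_neg, hV.2.2]
      rw [← hg0]
      exact g.monotone h
    · rw [hW.2.2 _ (by linarith), neg_neg, h1 h]
  filter_upwards [hsub.eventually hnV.2.1, hsub.eventually e] with t h1 h2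
  rw [add_sub_cancel] at h1
  rw [h1, h2, hg, sub_add_cancel, add_sub_cancel]

/-- Induction on the number of singular points. PL elements bring a singular point `q` and its image
to `p`; dividing by an element of `M` with the same germ at `p` removes this singularity and creates
none, that element being PL away from `p`. -/
theorem TDOn_le_of_germGroup {a b a' b' p : ℝ} {M N : Subgroup (ℝ ≃o ℝ)} (haa' : a < a')
    (hbb' : b' < b) (hp : IsDyadic p) (hap : a < p) (hpb : p < b) (hM : M ≤ TDOn a' b')
    (hMN : M ≤ N) (hPL : ∀ a₁ b₁, a < a₁ → b₁ < b → PLOn a₁ b₁ ≤ N)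
    (hR : rightCone ≤ germGroup M p) (hL : rightCone.map negConj ≤ germGroup M p) :
    ∀ a₁ b₁, a < a₁ → b₁ < b → TDOn a₁ b₁ ≤ N := by
  suffices H : ∀ (k : ℕ) (a₁ b₁ : ℝ), a < a₁ → b₁ < b → ∀ f ∈ TDOn a₁ b₁,
      {t | ¬ PLAt f t}.ncard < k → f ∈ N from
    fun a₁ b₁ h1 h2 f hf => H _ a₁ b₁ h1 h2 f hf (Nat.lt_succ_self _)
  intro k
  induction k with
  | zero => exact fun _ _ _ _ _ _ h => absurd h (Nat.not_lt_zero _)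
  | succ k ih =>
    intro a₁ b₁ ha₁ hb₁ f hf hk
    obtain ⟨hfin, hsub⟩ := finite_not_plAt hf
    by_cases hne : ∀ t, PLAt f t
    · exact hPL a₁ b₁ ha₁ hb₁ (mem_PLOn.2 ⟨hne, hf.2⟩)
    push Not at hne
    obtain ⟨q, hq⟩ := hne
    have hqd : IsDyadic q := ((hf.1 q).resolve_left hq).1
    have hfqd : IsDyadic (f q) := (isDyadic_apply hf.1).2 hqd
    have hqm : q ∈ Icc a₁ b₁ := hsub hq
    have hfqm := (suppIn_mem_Icc hf.2).2 hqm
    obtain ⟨c, hc, hac, hca⟩ := exists_isDyadic_between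
      (lt_min (lt_min ha₁ haa') hap)
    obtain ⟨d, hd, hdb, hbd⟩ := exists_isDyadic_between
      (max_lt (max_lt hb₁ hbb') hpb)
    simp only [lt_min_iff, max_lt_iff] at hca hdb
    obtain ⟨u, hu, hup⟩ := exists_PLOn_apply_eq hc hd hqd hp (hca.1.1.trans_le hqm.1)
      (hqm.2.trans_lt hdb.1.1) hca.2 hdb.2
    obtain ⟨w, hw, hwp⟩ := exists_PLOn_apply_eq hc hd hfqd hp (hca.1.1.trans_le hfqm.1)
      (hfqm.2.trans_lt hdb.1.1) hca.2 hdb.2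
    have huN := hPL c d hac hbd hu
    have hwN := hPL c d hac hbd hw
    have huT := PLOn_le_TDOn _ _ hu
    have hwT := PLOn_le_TDOn _ _ hw
    have husym : u.symm p = q := by rw [u.symm_apply_eq, hup]
    have hf' : w * f * u⁻¹ ∈ TDOn c d :=
      mul_mem (mul_mem hwT (TDOn_mono hca.1.1.le hdb.1.1.le hf)) (inv_mem huT)
    have hf'p : (w * f * u⁻¹) p = p := by
      change w (f (u.symm p)) = p
      rw [husym, hwp]
    obtain ⟨n, hn, hnf, hnpl⟩ := exists_germRel hR hL (TDOn_le_TD _ _ hf' p) hp hf'p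
    have hnp : n p = p := hnf.self_of_nhds.trans hf'p
    have hnsym : n.symm p = p := by rw [n.symm_apply_eq, hnp]
    have hnT := TDOn_mono hca.1.2.le hdb.1.2.le (hM hn)
    have hmem : w * f * u⁻¹ * n⁻¹ ∈ N := by
      refine ih c d hac hbd _ (mul_mem hf' (inv_mem hnT)) (lt_of_lt_of_le ?_ (Nat.lt_succ_iff.1 hk))
      -- At `p` the new map is the identity germ. At any other point all factors except `f` are PL,
      -- so a singular point comes from one of `f` different from `q`.
      have hs : {t | ¬ PLAt (w * f * u⁻¹ * n⁻¹ : ℝ ≃o ℝ) t} ⊆ (n * u) '' ({t | ¬ PLAt f t} \ {q}) := by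
        intro y hy
        refine ⟨u.symm (n.symm y), ⟨fun h => hy ?_, fun h => hy ?_⟩, ?_⟩
        · by_cases hyp : y = p
          · refine absurd ?_ hq
            rwa [hyp, hnsym, husym] at h
          · have h1 : PLAt n.symm y := by
              have := (hnpl (n.symm y) fun h => hyp (by
                rw [← n.apply_symm_apply y, h, hnp])).orderIso_symm
              rwa [n.apply_symm_apply] at this
            have h2 : PLAt u.symm (n.symm y) := inv_mem (PLOn_le_PL _ _ hu) _
            exact (((PLOn_le_PL _ _ hw _).comp h).comp h2).comp h1
        · have hyp : y = p := by
            rw [mem_singleton_iff, u.symm_apply_eq, hup, n.symm_apply_eq, hnp] at h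
            exact h
          subst hyp
          have : Tendsto n.symm (𝓝 y) (𝓝 y) := by
            have := n.symm.continuous.tendsto y
            rwa [hnsym] at this
          refine (plAt_id y).congr ?_
          filter_upwards [this.eventually hnf] with t ht
          rw [n.apply_symm_apply] at ht
          exact ht
        · change n (u (u.symm (n.symm y))) = y
          simp
      calc _ ≤ ((n * u) '' ({t | ¬ PLAt f t} \ {q})).ncard :=
            ncard_le_ncard hs ((hfin.subset sdiff_subset).image _)
        _ ≤ ({t | ¬ PLAt f t} \ {q}).ncard := ncard_image_le (hfin.subset sdiff_subset)
        _ < _ := ncard_sdiff_singleton_lt_of_mem hq hfin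
    have : f = w⁻¹ * (w * f * u⁻¹ * n⁻¹) * n * u := by group
    rw [this]
    exact mul_mem (mul_mem (mul_mem (inv_mem hwN) hmem) (hMN hn)) huN

theorem rightCone_le_germGroup_TDOn {a b p : ℝ} (ha : IsDyadic a) (hb : IsDyadic b)
    (hp : IsDyadic p) (hap : a < p) (hpb : p < b) : rightCone ≤ germGroup (TDOn a b) p :=
  fun _ hV => mem_germGroup_TDOn ha hb hp hap hpb (rightCone_le_TD hV) (hV.2.2 0 le_rfl) hV.2.1

theorem map_rightCone_le_germGroup_TDOn {a b p : ℝ} (ha : IsDyadic a) (hb : IsDyadic b)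
    (hp : IsDyadic p) (hap : a < p) (hpb : p < b) :
    rightCone.map negConj ≤ germGroup (TDOn a b) p := by
  rintro _ ⟨V, hV, rfl⟩
  exact mem_germGroup_TDOn ha hb hp hap hpb (negConj_mem_TD (rightCone_le_TD hV))
    (by simp [hV.2.2 0 le_rfl]) fun t ht => plAt_negConj (hV.2.1 _ (neg_ne_zero.2 ht))

theorem exists_dyadic_subinterval {a b : ℝ} (hab : a < b) : ∃ c p d, IsDyadic c ∧ IsDyadic p ∧
    IsDyadic d ∧ a < c ∧ c < p ∧ p < d ∧ d < b := by
  obtain ⟨p, hp, h1, h2⟩ := exists_isDyadic_between hab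
  obtain ⟨c, hc, h3, h4⟩ := exists_isDyadic_between h1
  obtain ⟨d, hd, h5, h6⟩ := exists_isDyadic_between h2
  exact ⟨c, p, d, hc, hp, hd, h3, h4, h5, h6⟩

/-- Up to shrinking the support, `TDOn a b` is finitely generated. -/
theorem exists_TDOn_generators {a b : ℝ} (ha : IsDyadic a) (hb : IsDyadic b) (hab : a < b) :
    ∃ T : Set (ℝ ≃o ℝ), T.Finite ∧ T ⊆ TDOn a b ∧
      ∀ a₁ b₁, a < a₁ → b₁ < b → TDOn a₁ b₁ ≤ Subgroup.closure T := by
  obtain ⟨c, p, d, hc, hp, hd, hac, hcp, hpd, hdb⟩ := exists_dyadic_subinterval hab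
  obtain ⟨T₁, hT₁, hT₁s, h₁⟩ := exists_PLOn_le_commutator ha hb hab
  obtain ⟨T₂, hT₂, hT₂s, h₂⟩ := exists_rightCone_generators
  have hR := rightCone_le_germGroup_TDOn hc hd hp hcp hpd
  have hL := map_rightCone_le_germGroup_TDOn hc hd hp hcp hpd
  choose! r hr hrV using fun V (hV : V ∈ germGroup (TDOn c d) p) => mem_germGroup.1 hV
  set M := Subgroup.closure (r '' (T₂ ∪ negConj '' T₂)) with hM
  have hmem : ∀ V ∈ T₂ ∪ negConj '' T₂, V ∈ germGroup (TDOn c d) p := by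
    rintro _ (hV | ⟨V, hV, rfl⟩)
    · exact hR (hT₂s hV)
    · exact hL ⟨V, hT₂s hV, rfl⟩
  have hMle : M ≤ TDOn c d := by
    rw [hM, Subgroup.closure_le]
    rintro _ ⟨V, hV, rfl⟩
    exact hr V (hmem V hV)
  have hgerm : ∀ V ∈ T₂ ∪ negConj '' T₂, V ∈ germGroup M p := fun V hV =>
    mem_germGroup.2 ⟨r V, Subgroup.subset_closure ⟨V, hV, rfl⟩, hrV V (hmem V hV)⟩
  refine ⟨T₁ ∪ r '' (T₂ ∪ negConj '' T₂),
    hT₁.union ((hT₂.union (hT₂.image _)).image _), ?_, TDOn_le_of_germGroup hac hdb hp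
      (hac.trans hcp) (hpd.trans hdb) hMle (Subgroup.closure_mono subset_union_right)
      (fun a₁ b₁ ha₁ hb₁ => ?_) ?_ ?_⟩
  · rintro _ (h | ⟨V, hV, rfl⟩)
    · exact PLOn_le_TDOn _ _ (hT₁s h)
    · exact TDOn_mono hac.le hdb.le (hr V (hmem V hV))
  · refine (h₁ a₁ b₁ ha₁ hb₁).trans ((Subgroup.commutator_le_self _).trans
      (Subgroup.closure_mono subset_union_left))
  · exact h₂.trans ((Subgroup.closure_le _).2 fun V hV => hgerm V (Or.inl hV))
  · rw [Subgroup.map_le_iff_le_comap]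
    exact h₂.trans ((Subgroup.closure_le _).2 fun V hV => hgerm _ (Or.inr ⟨V, hV, rfl⟩))

/-- Up to shrinking the support, `TDOn a b` is perfect. -/
theorem TDOn_le_commutator {a b : ℝ} (ha : IsDyadic a) (hb : IsDyadic b) (hab : a < b)
    {a₁ b₁ : ℝ} (ha₁ : a < a₁) (hb₁ : b₁ < b) : TDOn a₁ b₁ ≤ ⁅TDOn a b, TDOn a b⁆ := by
  obtain ⟨c, p, d, hc, hp, hd, hac, hcp, hpd, hdb⟩ := exists_dyadic_subinterval hab
  obtain ⟨T, -, hTs, h⟩ := exists_PLOn_le_commutator ha hb hab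
  have hT : Subgroup.closure T ≤ TDOn a b :=
    (Subgroup.closure_le _).2 fun t ht => PLOn_le_TDOn _ _ (hTs ht)
  have hle := TDOn_mono hac.le hdb.le
  refine TDOn_le_of_germGroup hac hdb hp (hac.trans hcp) (hpd.trans hdb)
    (Subgroup.commutator_le_self (TDOn c d)) (Subgroup.commutator_mono hle hle)
    (fun a₁ b₁ h1 h2 => (h a₁ b₁ h1 h2).trans (Subgroup.commutator_mono hT hT)) ?_ ?_ a₁ b₁ ha₁ hb₁
  · exact rightCone_le_commutator.trans
      (commutator_le_germGroup (rightCone_le_germGroup_TDOn hc hd hp hcp hpd))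
  · refine (Subgroup.map_mono rightCone_le_commutator).trans ?_
    rw [Subgroup.map_commutator]
    exact commutator_le_germGroup (map_rightCone_le_germGroup_TDOn hc hd hp hcp hpd)

namespace ReversibleSystem

variable {X : Type*} [TopologicalSpace X] {S : ReversibleSystem X}

/-! ### Local forms of self-maps of the suspension -/

theorem continuous_proj : Continuous S.proj := continuous_quot_mk

theorem isQuotientMap_proj : IsQuotientMap S.proj := isQuotientMap_quot_mk

theorem surjective_proj : Function.Surjective S.proj := Quotient.exists_rep

theorem proj_zpow (n : ℤ) (x : X) (t : ℝ) : S.proj ((S.φ ^ n) x, t - n) = S.proj (x, t) :=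
  (S.proj_eq_iff (p := (x, t)).2 ⟨n, Or.inl rfl⟩).symm

theorem proj_zpow_σ (n : ℤ) (x : X) (t : ℝ) :
    S.proj ((S.φ ^ n) (S.σ x), -t - n) = S.proj (x, t) :=
  (S.proj_eq_iff (p := (x, t)).2 ⟨n, Or.inr rfl⟩).symm

/-- Near `(x, t)`, the map `g` is `(y, s) ↦ (y, f s)`. -/
def LocalForm (g : S.Z → S.Z) (x : X) (t : ℝ) (f : ℝ → ℝ) : Prop :=
  ∀ᶠ p in 𝓝 (x, t), g (S.proj p) = S.proj (p.1, f p.2)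

theorem LocalForm.comp {g h : S.Z → S.Z} {x : X} {t : ℝ} {f k : ℝ → ℝ} (hf : ContinuousAt f t)
    (hg : LocalForm g x (f t) k) (hh : LocalForm h x t f) :
    LocalForm (fun z => g (h z)) x t (fun s => k (f s)) := by
  have : Tendsto (fun p : X × ℝ => (p.1, f p.2)) (𝓝 (x, t)) (𝓝 (x, f t)) :=
    (continuous_fst.tendsto (x, t)).prodMk_nhds
      (hf.tendsto.comp (continuous_snd.tendsto (x, t)))
  filter_upwards [hh, this.eventually hg] with p h1 h2
  rw [h1, h2]

theorem LocalForm.congr {g : S.Z → S.Z} {x : X} {t : ℝ} {f k : ℝ → ℝ} (h : LocalForm g x t f)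
    (e : f =ᶠ[𝓝 t] k) : LocalForm g x t k := by
  filter_upwards [h, (continuous_snd.tendsto (x, t)).eventually e] with p h1 h2
  rw [h1, h2]

theorem LocalForm.conj {g : S.Z → S.Z} {x : X} {t : ℝ} {f : ℝ → ℝ} (h : LocalForm g x t f)
    {ψ : X ≃ₜ X} {ε : ℝ} {n : ℤ} (hε : ε = 1 ∨ ε = -1)
    (hψ : ∀ r : X × ℝ, S.proj (ψ r.1, ε * r.2 - n) = S.proj r) :
    LocalForm g (ψ x) (ε * t - n) (fun s => ε * f (ε * (s + n)) - n) := by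
  have hεε : ε * ε = 1 := by rcases hε with rfl | rfl <;> norm_num
  have hc : Tendsto (fun p : X × ℝ => (ψ.symm p.1, ε * (p.2 + n))) (𝓝 (ψ x, ε * t - n))
      (𝓝 (x, t)) := by
    have := (by fun_prop : Continuous fun p : X × ℝ => (ψ.symm p.1, ε * (p.2 + n))).tendsto
      (ψ x, ε * t - n)
    have e : ε * (ε * t - n + n) = t := by linear_combination t * hεε
    simpa only [ψ.symm_apply_apply, e] using this
  filter_upwards [hc.eventually h] with p hp
  have h1 := hψ (ψ.symm p.1, ε * (p.2 + n))
  have h2 := hψ (ψ.symm p.1, f (ε * (p.2 + n)))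
  have e : ε * (ε * (p.2 + n)) - n = p.2 := by linear_combination (p.2 + n) * hεε
  simp only [ψ.apply_symm_apply, e, Prod.mk.eta] at h1 h2
  rw [h1, hp, h2]

theorem exists_conj_mem_TD {f : ℝ ≃o ℝ} (hf : f ∈ TD) {ε : ℝ} (n : ℤ) (hε : ε = 1 ∨ ε = -1) :
    ∃ k ∈ TD, ∀ s, k s = ε * f (ε * (s + n)) - n := by
  have h1 := PL_le_TD (affineIso_mem 0 (isDyadic_int n).neg)
  have h2 := PL_le_TD (affineIso_mem 0 (isDyadic_int n))
  rcases hε with rfl | rfl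
  · exact ⟨affineIso 0 (-n) * f * affineIso 0 n, mul_mem (mul_mem h1 hf) h2, fun s => by
      simp [RelIso.mul_apply, sub_eq_add_neg]⟩
  · exact ⟨affineIso 0 (-n) * negConj f * affineIso 0 n,
      mul_mem (mul_mem h1 (negConj_mem_TD hf)) h2, fun s => by
      simp [RelIso.mul_apply, sub_eq_add_neg]⟩

theorem zpow_natCast_apply (n : ℕ) (x : X) : (S.φ ^ (n : ℤ)) x = S.φ^[n] x := by
  induction n generalizing x with
  | zero => rfl
  | succ n ih =>
    rw [Function.iterate_succ_apply, ← ih, Nat.cast_succ, zpow_add_one]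
    rfl

theorem mem_periodicPts_of_zpow {x : X} {n : ℤ} (hn : n ≠ 0) (h : (S.φ ^ n) x = x) :
    x ∈ Function.periodicPts S.φ := by
  have h' : (S.φ ^ (-n)) x = x := by
    conv_lhs => rw [← h]
    rw [zpow_zpow, neg_add_cancel]
    rfl
  obtain ⟨m, rfl | rfl⟩ := n.eq_nat_or_neg
  · refine ⟨m, by omega, ?_⟩
    rwa [zpow_natCast_apply] at h
  · refine ⟨m, by omega, ?_⟩
    rwa [neg_neg, zpow_natCast_apply] at h'

theorem StandingAssumption.zpow_σ_ne (hS : S.StandingAssumption) (n : ℤ) (x : X) :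
    (S.φ ^ n) (S.σ x) ≠ x := fun h => by
  refine hS.not_preserve_orbit x (-n) ?_
  conv_rhs => rw [← h]
  rw [zpow_zpow, neg_add_cancel, zpow_zero]
  rfl

theorem StandingAssumption.eq_of_proj_eq (hS : S.StandingAssumption) {x : X}
    (hx : x ∉ Function.periodicPts S.φ) {s t : ℝ} (h : S.proj (x, s) = S.proj (x, t)) :
    s = t := by
  obtain ⟨n, h | h⟩ := S.proj_eq_iff.1 h
  · simp only [Prod.mk.injEq] at h
    by_cases hn : n = 0
    · subst hn
      simpa using h.2.symm
    · exact absurd (mem_periodicPts_of_zpow hn h.1.symm) hx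
  · simp only [Prod.mk.injEq] at h
    exact absurd h.1.symm (hS.zpow_σ_ne n x)

/-- Over a non-periodic point `y` the leaf `{y} × ℝ` injects into `Z`, because neither a nonzero
power of `φ` nor any `φ ^ n σ` fixes `y`. Such points are dense, and a single nearby leaf determines
the germ. -/
theorem StandingAssumption.localForm_unique (hS : S.StandingAssumption) {g : S.Z → S.Z} {x : X}
    {t : ℝ} {f k : ℝ → ℝ} (hf : LocalForm g x t f) (hk : LocalForm g x t k) : f =ᶠ[𝓝 t] k := by
  have h := hf.and hk
  rw [nhds_prod_eq] at h
  obtain ⟨p, hp, q, hq, hpq⟩ := eventually_prod_iff.1 h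
  obtain ⟨y, hy, hyp⟩ := hS.topologicallyFree.inter_nhds_nonempty hp
  filter_upwards [hq] with s hs
  obtain ⟨h1, h2⟩ := hpq hyp hs
  exact hS.eq_of_proj_eq hy (h1.symm.trans h2)

/-- Slopes are powers of 2, so a type `𝔇` map is necessarily increasing. Its restriction to a small
dyadic interval therefore extends by translations to an automorphism of the line. -/
theorem exists_mem_TD_of_isTypeD {f : OpenPartialHomeomorph ℝ ℝ} (hf : IsTypeD f) {t : ℝ}
    (ht : t ∈ f.source) : ∃ F ∈ TD, ∀ᶠ s in 𝓝 t, F s = f s := by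
  obtain ⟨a, b, ha, hb, hat, htb, hab⟩ := exists_dyadic_Icc_subset (f.open_source.mem_nhds ht)
  obtain ⟨-, -, hTD, -⟩ := isTypeD_iff.1 hf
  have hTD' : ∀ s ∈ Icc a b, TDAt f s := fun s hs => hTD s (hab hs)
  have hlt := hat.trans htb
  have hma := left_mem_Icc.2 hlt.le
  have hmb := right_mem_Icc.2 hlt.le
  have hcont : ContinuousOn f (Icc a b) := f.continuousOn.mono hab
  have hmono : StrictMonoOn f (Icc a b) := by
    refine (hcont.strictMonoOn_of_injOn_Icc' hlt.le (f.injOn.mono hab)).resolve_right fun h => ?_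
    -- A decreasing map is contradicted at a PL point `s` just to the right of `t`, where the right
    -- slope is positive.
    have h1 := ((hTD' t ⟨hat.le, htb.le⟩).eventually_plAt.filter_mono
      (nhdsWithin_mono t (fun s (hs : s ∈ Ioi t) => (ne_of_gt hs)))).and (Ioo_mem_nhdsGT htb)
    obtain ⟨s, hs, hs1, hs2⟩ := h1.exists
    obtain ⟨n, c, -, h2⟩ := hs.2.1
    have h3 : ∀ᶠ r in 𝓝[>] s, (f r = 2 ^ n * r + c ∧ f s = 2 ^ n * s + c) ∧ r ∈ Ioo s b :=
      ((h2.filter_mono (nhdsWithin_mono s Ioi_subset_Ici_self)).and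
        (Eventually.of_forall fun _ => h2.self_of_nhdsWithin self_mem_Ici)).and (Ioo_mem_nhdsGT hs2)
    obtain ⟨r, ⟨h4, h5⟩, h6, h7⟩ := h3.exists
    have h8 := h ⟨(hat.trans hs1).le, hs2.le⟩ ⟨(hat.trans (hs1.trans h6)).le, h7.le⟩ h6
    rw [h4, h5] at h8
    have : (0 : ℝ) < 2 ^ n := by positivity
    nlinarith
  have hda : IsDyadic (f a - a) := ((hTD' a hma).isDyadic_iff.2 ha).sub ha
  have hdb : IsDyadic (f b - b) := ((hTD' b hmb).isDyadic_iff.2 hb).sub hb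
  let v := glueFun b f (affineIso 0 (f b - b))
  have ev : f b = affineIso 0 (f b - b) b := by simp
  let u := glueFun a (affineIso 0 (f a - a)) v
  have hva : v a = f a := glueFun_of_le hlt.le
  have eu : affineIso 0 (f a - a) a = v a := by simp [hva]
  have hu1 : ∀ s ≤ a, u s = s + (f a - a) := fun s hs => by
    change glueFun a _ v s = _
    rw [glueFun_of_le hs]
    simp
  have hu2 : ∀ s ∈ Icc a b, u s = f s := fun s hs => by
    change glueFun a _ v s = _
    rw [glueFun_of_ge eu hs.1]
    exact glueFun_of_le hs.2
  have hu3 : ∀ s, b ≤ s → u s = s + (f b - b) := fun s hs => by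
    change glueFun a _ v s = _
    rw [glueFun_of_ge eu (hlt.le.trans hs)]
    change glueFun b f _ s = _
    rw [glueFun_of_ge ev hs]
    simp
  have hum : StrictMono u := by
    refine StrictMonoOn.Iic_union_Ici (a := b) ?_ fun s hs r hr hsr => ?_
    · have h1 : StrictMonoOn u (Iic a) := fun s hs r hr hsr => by
        rw [hu1 s hs, hu1 r hr]
        linarith
      have h2 : StrictMonoOn u (Icc a b) := fun s hs r hr hsr => by
        rw [hu2 s hs, hu2 r hr]
        exact hmono hs hr hsr
      have := h1.union h2 (isGreatest_Iic) (isLeast_Icc hlt.le)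
      rwa [Iic_union_Icc_eq_Iic hlt.le] at this
    · rw [hu3 s hs, hu3 r hr]
      linarith
  have husurj : Function.Surjective u := by
    intro y
    rcases le_or_gt y (f a) with h | h
    · exact ⟨y - (f a - a), by rw [hu1 _ (by linarith)]; ring⟩
    rcases le_or_gt y (f b) with h' | h'
    · obtain ⟨s, hs, rfl⟩ := intermediate_value_Icc hlt.le hcont ⟨h.le, h'⟩
      exact ⟨s, hu2 s hs⟩
    · exact ⟨y - (f b - b), by rw [hu3 _ (by linarith)]; ring⟩
  refine ⟨hum.orderIsoOfSurjective u husurj, fun s => ?_, ?_⟩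
  · exact tdAt_glueFun ha eu (fun _ => Or.inl (affineIso_mem 0 hda s)) fun h1 =>
      tdAt_glueFun hb ev (fun h2 => hTD' s ⟨h1, h2⟩) fun _ => Or.inl (affineIso_mem 0 hdb s)
  · filter_upwards [Icc_mem_nhds hat htb] with s hs using hu2 s hs

theorem IsTypeDHomeo.exists_localForm {g : S.Z ≃ₜ S.Z} (hg : S.IsTypeDHomeo g) (x : X) (t : ℝ) :
    ∃ f ∈ TD, LocalForm g x t f := by
  obtain ⟨C, f, hf, hC, -, ⟨⟨y, s⟩, ⟨hy, hs⟩, hxy⟩, -, -, h⟩ := hg (S.proj (x, t))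
  obtain ⟨F, hF, hFf⟩ := exists_mem_TD_of_isTypeD hf hs
  have hl : LocalForm g y s f := by
    filter_upwards [prod_mem_nhds (hC.1.isOpen.mem_nhds hy) (f.open_source.mem_nhds hs)] with p hp
    exact h p.1 hp.1 p.2 hp.2
  obtain ⟨ψ, ε, n, hε, hxt, hψ⟩ := S.exists_isometry hxy
  obtain ⟨k, hk, hkF⟩ := exists_conj_mem_TD hF n hε
  refine ⟨k, hk, ?_⟩
  have := (hl.congr (k := F) (hFf.mono fun _ h => h.symm)).conj hε hψ
  simp only [Prod.mk.injEq] at hxt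
  rw [← hxt.1, ← hxt.2] at this
  exact this.congr (Eventually.of_forall fun s => (hkF s).symm)

theorem StandingAssumption.isTypeDHomeo_of_localForm (hS : S.StandingAssumption) {g : S.Z ≃ₜ S.Z}
    (h : ∀ x t, ∃ f ∈ TD, LocalForm g x t f) : S.IsTypeDHomeo g := by
  intro z
  obtain ⟨⟨x, t⟩, rfl⟩ := surjective_proj z
  obtain ⟨f, hf, hl⟩ := h x t
  obtain ⟨C, I, hCI, hI, hx, ht⟩ := hS.exists_chart x t
  obtain ⟨C', I', hCI', hI', hx', ht'⟩ := hS.exists_chart x (f t)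
  obtain ⟨U, hU, V, hV, hUV⟩ := mem_nhds_prod_iff.1 hl
  have := hS.compact
  have := hS.metrizable
  have := hS.totallyDisconnected
  obtain ⟨E, hE, hxE, hEU⟩ := compact_exists_isClopen_in_isOpen isOpen_interior
    (mem_interior_iff_mem_nhds.2 hU)
  have hpl := (hf t).eventually_plAt
  rw [eventually_nhdsWithin_iff] at hpl
  obtain ⟨a, b, ha, hb, hat, htb, hab⟩ := exists_dyadic_Icc_subset
    (inter_mem (inter_mem hV hpl) (inter_mem (hCI.2.1.mem_nhds ht)
      (f.continuous.continuousAt (hCI'.2.1.mem_nhds ht'))))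
  have hlt := hat.trans htb
  let F := f.toHomeomorph.toOpenPartialHomeomorph.restrOpen (Ioo a b) isOpen_Ioo
  have hsrc : F.source = Ioo a b := by
    rw [OpenPartialHomeomorph.restrOpen_source]
    exact univ_inter _
  have hcoe : ⇑F = f := rfl
  have htgt : F.target = Ioo (f a) (f b) := by
    rw [← OpenPartialHomeomorph.image_source_eq_target, hsrc, hcoe, f.image_Ioo]
  have hIab : IsDyadicInterval F.source := hsrc ▸ ⟨a, b, ha, hb, hlt, rfl⟩
  have hIab' : IsDyadicInterval F.target := htgt ▸ ⟨f a, f b, (isDyadic_apply hf).2 ha,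
    (isDyadic_apply hf).2 hb, f.strictMono hlt, rfl⟩
  have hF : IsTypeD F := by
    refine isTypeD_iff.2 ⟨hIab, hIab', fun s _ => hf s, (finite_singleton t).subset ?_⟩
    rintro s ⟨hs, hs'⟩
    rw [hsrc] at hs
    by_contra hst
    exact hs' ((hab (Ioo_subset_Icc_self hs)).1.2 hst)
  have hsub : F.source ⊆ I := by
    rw [hsrc]
    exact fun s hs => (hab (Ioo_subset_Icc_self hs)).2.1
  have hsub' : F.target ⊆ I' := by
    rw [← OpenPartialHomeomorph.image_source_eq_target, hsrc]
    rintro _ ⟨s, hs, rfl⟩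
    exact (hab (Ioo_subset_Icc_self hs)).2.2
  have hD : IsClopen (E ∩ (C ∩ C')) := hE.inter (hCI.1.inter hCI'.1)
  have hform : ∀ y ∈ E ∩ (C ∩ C'), ∀ s ∈ F.source, g (S.proj (y, s)) = S.proj (y, F s) := by
    intro y hy s hs
    rw [hsrc] at hs
    exact hUV (mk_mem_prod (interior_subset (hEU hy.1)) (hab (Ioo_subset_Icc_self hs)).1.1)
  have hmem : S.proj (x, t) ∈ S.chartSet (E ∩ (C ∩ C')) F.source :=
    ⟨(x, t), ⟨⟨hxE, hx, hx'⟩, hsrc ▸ ⟨hat, htb⟩⟩, rfl⟩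
  have himg := image_chartSet hform
  exact ⟨E ∩ (C ∩ C'), F, hF, hCI.mono hD hIab (fun y hy => hy.2.1) hsub,
    hCI'.mono hD hIab' (fun y hy => hy.2.2) hsub', hmem, himg ▸ mem_image_of_mem _ hmem, himg,
    hform⟩

theorem continuous_of_localForm {g : S.Z → S.Z}
    (h : ∀ x t, ∃ f : ℝ ≃o ℝ, LocalForm g x t f) : Continuous g := by
  rw [isQuotientMap_proj.continuous_iff, continuous_iff_continuousAt]
  rintro ⟨x, t⟩
  obtain ⟨f, hf⟩ := h x t
  have h1 : Continuous fun p : X × ℝ => S.proj (p.1, f p.2) :=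
    continuous_proj.comp (continuous_fst.prodMk (f.continuous.comp continuous_snd))
  exact h1.continuousAt.congr (hf.mono fun p hp => hp.symm)

theorem StandingAssumption.exists_mem_typeDGroup (hS : S.StandingAssumption) {g g' : S.Z → S.Z}
    (h1 : Function.LeftInverse g' g) (h2 : Function.RightInverse g' g)
    (hg : ∀ x t, ∃ f ∈ TD, LocalForm g x t f) (hg' : ∀ x t, ∃ f ∈ TD, LocalForm g' x t f) :
    ∃ k ∈ S.typeDGroup hS, ∀ z, k z = g z := by
  let k : S.Z ≃ₜ S.Z :=
    { toFun := g
      invFun := g'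
      left_inv := h1
      right_inv := h2
      continuous_toFun := continuous_of_localForm fun x t => (hg x t).imp fun _ h => h.2
      continuous_invFun := continuous_of_localForm fun x t => (hg' x t).imp fun _ h => h.2 }
  exact ⟨k, hS.isTypeDHomeo_of_localForm (g := k) hg, fun _ => rfl⟩

/-! ### Homeomorphisms supported in a chart -/

/-- The homeomorphism `h` is `(y, s) ↦ (y, f s)` on `E × {f ≠ id}`, and the identity elsewhere. -/
def Acts (E : Set X) (f : ℝ ≃o ℝ) (h : S.Z ≃ₜ S.Z) : Prop :=
  (∀ y ∈ E, ∀ s, f s ≠ s → h (S.proj (y, s)) = S.proj (y, f s)) ∧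
    ∀ z, (∀ y ∈ E, ∀ s, f s ≠ s → S.proj (y, s) ≠ z) → h z = z

theorem Acts.unique {E : Set X} {f : ℝ ≃o ℝ} {h k : S.Z ≃ₜ S.Z} (hh : Acts E f h)
    (hk : Acts E f k) : h = k := by
  ext z
  by_cases hz : ∀ y ∈ E, ∀ s, f s ≠ s → S.proj (y, s) ≠ z
  · rw [hh.2 z hz, hk.2 z hz]
  · push Not at hz
    obtain ⟨y, hy, s, hs, rfl⟩ := hz
    rw [hh.1 y hy s hs, hk.1 y hy s hs]

theorem Acts.conj {E : Set X} {f k : ℝ ≃o ℝ} {h : S.Z ≃ₜ S.Z} {ψ : X ≃ₜ X} {ε : ℝ} {n : ℤ}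
    (hε : ε = 1 ∨ ε = -1) (hψ : ∀ r : X × ℝ, S.proj (ψ r.1, ε * r.2 - n) = S.proj r)
    (hk : ∀ s, k s = ε * f (ε * (s + n)) - n) (hh : Acts (ψ ⁻¹' E) f h) : Acts E k h := by
  have hεε : ε * ε = 1 := by rcases hε with rfl | rfl <;> norm_num
  have key : ∀ y s, S.proj (ψ.symm y, ε * (s + n)) = S.proj (y, s) := by
    intro y s
    have h1 := hψ (ψ.symm y, ε * (s + n))
    have e : ε * (ε * (s + n)) - n = s := by linear_combination (s + n) * hεε
    simp only [ψ.apply_symm_apply, e] at h1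
    exact h1.symm
  have hne : ∀ s, k s ≠ s → f (ε * (s + n)) ≠ ε * (s + n) := by
    intro s hs h
    refine hs ?_
    rw [hk, h]
    linear_combination (s + n) * hεε
  refine ⟨fun y hy s hs => ?_, fun z hz => hh.2 z fun y hy s hs hyz => ?_⟩
  · rw [← key y s, hh.1 _ (by simpa using hy) _ (hne s hs), ← key y (k s)]
    congr 2
    rw [hk]
    linear_combination -(f (ε * (s + n))) * hεε
  · refine hz (ψ y) hy (ε * s - n) (fun h => hs ?_) ?_
    · have e : ε * (ε * s - n + n) = s := by linear_combination s * hεε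
      rw [hk, e] at h
      linear_combination ε * h - (f s - s) * hεε
    · rw [← hyz]
      exact hψ (y, s)

variable (S) in
/-- The pairs `(U, h)` such that `h` is `(y, s) ↦ (y, U y s)` on `D × (a, b)` and the identity
outside of the image of this set. -/
def actRel (D : Set X) (a b : ℝ) : Subgroup ((X → ℝ ≃o ℝ) × (S.Z ≃ₜ S.Z)) where
  carrier := {q | (∀ y, q.1 y ∈ suppIn a b) ∧
    (∀ y ∈ D, ∀ s ∈ Ioo a b, q.2 (S.proj (y, s)) = S.proj (y, q.1 y s)) ∧
    ∀ z ∉ S.proj '' D ×ˢ Ioo a b, q.2 z = z}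
  mul_mem' := by
    rintro ⟨U, h⟩ ⟨V, k⟩ ⟨hU, h1, h2⟩ ⟨hV, k1, k2⟩
    refine ⟨fun y => mul_mem (hU y) (hV y), fun y hy s hs => ?_, fun z hz => ?_⟩
    · change h (k _) = S.proj (y, U y (V y s))
      rw [k1 y hy s hs, h1 y hy _ ((suppIn_mem_Ioo (hV y)).2 hs)]
    · change h (k z) = z
      rw [k2 z hz, h2 z hz]
  one_mem' := ⟨fun _ => one_mem _, fun _ _ _ _ => rfl, fun _ _ => rfl⟩
  inv_mem' := by
    rintro ⟨U, h⟩ ⟨hU, h1, h2⟩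
    refine ⟨fun y => inv_mem (hU y), fun y hy s hs => ?_, fun z hz => ?_⟩
    · change h.symm _ = S.proj (y, (U y).symm s)
      have hs' : (U y).symm s ∈ Ioo a b := by
        rwa [← suppIn_mem_Ioo (hU y), OrderIso.apply_symm_apply]
      have := h1 y hy _ hs'
      simp only [OrderIso.apply_symm_apply] at this
      rw [← this, h.symm_apply_apply]
    · change h.symm z = z
      conv_lhs => rw [← show h z = z from h2 z hz]
      rw [h.symm_apply_apply]

/-- Recording an action over `E` as a function on a larger chart `D` lets actions over different
sets be multiplied pointwise in `X → ℝ ≃o ℝ`. Injectivity over `D` ensures that points over `D \ E`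
are not moved. -/
theorem acts_iff {E D : Set X} {a b : ℝ} {f : ℝ ≃o ℝ} {h : S.Z ≃ₜ S.Z} (hE : E ⊆ D)
    (hD : InjOn S.proj (D ×ˢ Ioo a b)) (hf : f ∈ suppIn a b) :
    Acts E f h ↔ (E.mulIndicator fun _ => f, h) ∈ S.actRel D a b := by
  have hsupp : ∀ s, f s ≠ s → s ∈ Ioo a b := fun s hs => by
    by_contra hs'
    exact hs (hf s hs')
  constructor
  · rintro ⟨h1, h2⟩
    refine ⟨fun y => ?_, fun y hy s hs => ?_, fun z hz => h2 z fun y hy s hs hyz =>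
      hz ⟨(y, s), ⟨hE hy, hsupp s hs⟩, hyz⟩⟩
    · by_cases hy : y ∈ E
      · simpa [hy] using hf
      · simp [hy, one_mem]
    · by_cases hy' : y ∈ E
      · by_cases hs' : f s = s
        · simp only [mulIndicator_of_mem hy', hs']
          refine h2 _ fun x hx t ht hxt => ht ?_
          have := hD (mk_mem_prod (hE hx) (hsupp t ht)) (mk_mem_prod hy hs) hxt
          simp only [Prod.mk.injEq] at this
          rw [this.2, hs']
        · simpa only [mulIndicator_of_mem hy'] using h1 y hy' s hs'
      · simp only [mulIndicator_of_notMem hy', one_apply]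
        refine h2 _ fun x hx t ht hxt => hy' ?_
        have := hD (mk_mem_prod (hE hx) (hsupp t ht)) (mk_mem_prod hy hs) hxt
        simp only [Prod.mk.injEq] at this
        rwa [← this.1]
  · rintro ⟨-, h1, h2⟩
    refine ⟨fun y hy s hs => ?_, fun z hz => ?_⟩
    · have := h1 y (hE hy) s (hsupp s hs)
      simpa only [mulIndicator_of_mem hy] using this
    · by_cases hz' : z ∈ S.proj '' D ×ˢ Ioo a b
      · obtain ⟨⟨y, s⟩, ⟨hy, hs⟩, rfl⟩ := hz'
        have := h1 y hy s hs
        simp only at this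
        rw [this]
        by_cases hy' : y ∈ E
        · simp only [mulIndicator_of_mem hy']
          have : f s = s := by
            by_contra hs'
            exact hz y hy' s hs' rfl
          rw [this]
        · simp only [mulIndicator_of_notMem hy', one_apply]
      · exact h2 z hz'

/-- The saturation of `E × [a, b]` is closed: for times in a bounded set only finitely many elements
of the dihedral group can reach `[a, b]`. -/
theorem eventually_proj_notMem {E : Set X} (hE : IsClosed E) {a b : ℝ} {p : X × ℝ}
    (hp : S.proj p ∉ S.proj '' E ×ˢ Icc a b) :
    ∀ᶠ q in 𝓝 p, S.proj q ∉ S.proj '' E ×ˢ Icc a b := by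
  have hK : IsOpen (E ×ˢ Icc a b)ᶜ := (hE.prod isClosed_Icc).isOpen_compl
  obtain ⟨M, hM⟩ := exists_nat_gt (|p.2| + 1 + |a| + |b|)
  have h1 : ∀ n : ℤ, ∀ᶠ q in 𝓝 p, ((S.φ ^ n) q.1, q.2 - (n : ℝ)) ∉ E ×ˢ Icc a b ∧
      ((S.φ ^ n) (S.σ q.1), -q.2 - (n : ℝ)) ∉ E ×ˢ Icc a b := by
    intro n
    have c1 : Continuous fun q : X × ℝ => ((S.φ ^ n) q.1, q.2 - (n : ℝ)) := by fun_prop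
    have c2 : Continuous fun q : X × ℝ => ((S.φ ^ n) (S.σ q.1), -q.2 - (n : ℝ)) := by fun_prop
    refine (c1.continuousAt.eventually (hK.mem_nhds fun h => hp ⟨_, h, ?_⟩)).and
      (c2.continuousAt.eventually (hK.mem_nhds fun h => hp ⟨_, h, ?_⟩))
    · exact proj_zpow n p.1 p.2
    · exact proj_zpow_σ n p.1 p.2
  have h2 : ∀ᶠ q in 𝓝 p, ∀ n ∈ Finset.Icc (-M : ℤ) M,
      ((S.φ ^ n) q.1, q.2 - (n : ℝ)) ∉ E ×ˢ Icc a b ∧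
      ((S.φ ^ n) (S.σ q.1), -q.2 - (n : ℝ)) ∉ E ×ˢ Icc a b :=
    (Finset.eventually_all _).2 fun n _ => h1 n
  have h3 : ∀ᶠ q : X × ℝ in 𝓝 p, |q.2| < |p.2| + 1 :=
    (continuous_snd.abs.tendsto p).eventually (gt_mem_nhds (by linarith))
  filter_upwards [h2, h3] with q hq hq'
  rintro ⟨r, hr, hrq⟩
  have hbound : ∀ {n : ℤ} {s : ℝ}, |s| < |p.2| + 1 → s - n ∈ Icc a b →
      n ∈ Finset.Icc (-M : ℤ) M := by
    intro n s hs ⟨h1, h2⟩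
    have : |(n : ℝ)| < M := by
      have := abs_lt.1 hs
      rw [abs_lt]
      constructor <;> linarith [neg_abs_le a, le_abs_self b, abs_nonneg a, abs_nonneg b]
    have := abs_lt.1 this
    rw [Finset.mem_Icc]
    constructor
    · exact_mod_cast this.1.le
    · exact_mod_cast this.2.le
  obtain ⟨n, h | h⟩ := S.proj_eq_iff.1 hrq.symm
  · exact (hq n (hbound hq' (by rw [h] at hr; exact hr.2))).1 (h ▸ hr)
  · exact (hq n (hbound (by rwa [abs_neg]) (by rw [h] at hr; exact hr.2))).2 (h ▸ hr)

/-! ### Extension of a chart map by the identity -/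

open scoped Classical in
/-- The map `(y, s) ↦ (y, f s)` on the image of `E × (a, b)`, extended by the identity. -/
noncomputable def chartFun (S : ReversibleSystem X) (E : Set X) (a b : ℝ) (f : ℝ ≃o ℝ) (z : S.Z) :
    S.Z :=
  if h : ∃ p ∈ E ×ˢ Ioo a b, S.proj p = z then S.proj (h.choose.1, f h.choose.2) else z

theorem chartFun_proj {E : Set X} {a b : ℝ} {f : ℝ ≃o ℝ} (hinj : InjOn S.proj (E ×ˢ Ioo a b))
    {y : X} (hy : y ∈ E) {s : ℝ} (hs : s ∈ Ioo a b) :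
    S.chartFun E a b f (S.proj (y, s)) = S.proj (y, f s) := by
  have h : ∃ p ∈ E ×ˢ Ioo a b, S.proj p = S.proj (y, s) := ⟨(y, s), ⟨hy, hs⟩, rfl⟩
  unfold chartFun
  rw [dif_pos h, hinj h.choose_spec.1 (mk_mem_prod hy hs) h.choose_spec.2]

theorem chartFun_of_notMem {E : Set X} {a b : ℝ} {f : ℝ ≃o ℝ} {z : S.Z}
    (hz : z ∉ S.proj '' E ×ˢ Ioo a b) : S.chartFun E a b f z = z := dif_neg hz

theorem chartFun_inverse {E : Set X} {a b : ℝ} {f k : ℝ ≃o ℝ}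
    (hinj : InjOn S.proj (E ×ˢ Ioo a b)) (hf : f ∈ suppIn a b) (hk : ∀ s, k (f s) = s) (z : S.Z) :
    S.chartFun E a b k (S.chartFun E a b f z) = z := by
  by_cases hz : z ∈ S.proj '' E ×ˢ Ioo a b
  · obtain ⟨⟨y, s⟩, ⟨hy, hs⟩, rfl⟩ := hz
    rw [chartFun_proj hinj hy hs, chartFun_proj hinj hy ((suppIn_mem_Ioo hf).2 hs), hk]
  · rw [chartFun_of_notMem hz, chartFun_of_notMem hz]

/-- The support lies in an interval strictly inside the one defining the chart. A point outside the
chart thus has a neighbourhood avoiding `E × [a, b]`, where the map is trivial. -/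
theorem exists_localForm_chartFun {E : Set X} (hE : IsClopen E) {a b a' b' : ℝ}
    (hinj : InjOn S.proj (E ×ˢ Ioo a' b')) {f : ℝ ≃o ℝ} (hf : f ∈ TDOn a b) (ha : a' < a)
    (hb : b < b') (x : X) (t : ℝ) : ∃ k ∈ TD, LocalForm (S.chartFun E a' b' f) x t k := by
  by_cases hz : S.proj (x, t) ∈ S.proj '' E ×ˢ Ioo a' b'
  · obtain ⟨⟨y, s⟩, ⟨hy, hs⟩, hys⟩ := hz
    have hl : LocalForm (S.chartFun E a' b' f) y s f := by
      filter_upwards [prod_mem_nhds (hE.isOpen.mem_nhds hy) (isOpen_Ioo.mem_nhds hs)] with p hp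
      exact chartFun_proj hinj hp.1 hp.2
    obtain ⟨ψ, ε, n, hε, hxt, hψ⟩ := S.exists_isometry hys
    obtain ⟨k, hk, hkF⟩ := exists_conj_mem_TD (TDOn_le_TD _ _ hf) n hε
    have := hl.conj hε hψ
    simp only [Prod.mk.injEq] at hxt
    rw [← hxt.1, ← hxt.2] at this
    exact ⟨k, hk, this.congr (Eventually.of_forall fun s => (hkF s).symm)⟩
  · refine ⟨1, one_mem _, ?_⟩
    have h1 : S.proj (x, t) ∉ S.proj '' E ×ˢ Icc a b := fun h =>
      hz (image_mono (prod_mono_right (Icc_subset_Ioo ha hb)) h)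
    filter_upwards [eventually_proj_notMem hE.isClosed h1] with q hq
    rw [one_apply, Prod.mk.eta]
    by_cases h2 : S.proj q ∈ S.proj '' E ×ˢ Ioo a' b'
    · obtain ⟨⟨y, s⟩, ⟨hy, hs⟩, hys⟩ := h2
      rw [← hys, chartFun_proj hinj hy hs, TDOn_le_suppIn _ _ hf s]
      exact fun hs' => hq ⟨(y, s), ⟨hy, Ioo_subset_Icc_self hs'⟩, hys⟩
    · exact chartFun_of_notMem h2

theorem StandingAssumption.exists_acts (hS : S.StandingAssumption) {E : Set X} (hE : IsClopen E)
    {a b a' b' : ℝ} (hinj : InjOn S.proj (E ×ˢ Ioo a' b')) {f : ℝ ≃o ℝ} (hf : f ∈ TDOn a b)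
    (ha : a' < a) (hb : b < b') : ∃ h ∈ S.typeDGroup hS, Acts E f h := by
  have hf' : f ∈ suppIn a' b' := suppIn_mono ha.le hb.le (TDOn_le_suppIn _ _ hf)
  obtain ⟨h, hh, e⟩ := hS.exists_mem_typeDGroup (g := S.chartFun E a' b' f)
    (g' := S.chartFun E a' b' f⁻¹)
    (fun z => chartFun_inverse hinj hf' (fun s => f.symm_apply_apply s) z)
    (fun z => chartFun_inverse hinj (inv_mem hf') (fun s => f.apply_symm_apply s) z)
    (exists_localForm_chartFun hE hinj hf ha hb)
    (exists_localForm_chartFun hE hinj (inv_mem hf) ha hb)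
  have hsupp : ∀ s, f s ≠ s → s ∈ Ioo a' b' := fun s hs => by
    by_contra hs'
    exact hs (hf' s hs')
  refine ⟨h, hh, fun y hy s hs => ?_, fun z hz => ?_⟩
  · rw [e, chartFun_proj hinj hy (hsupp s hs)]
  · rw [e]
    by_cases hz' : z ∈ S.proj '' E ×ˢ Ioo a' b'
    · obtain ⟨⟨y, s⟩, ⟨hy, hs⟩, rfl⟩ := hz'
      rw [chartFun_proj hinj hy hs]
      have : f s = s := by
        by_contra hs'
        exact hz y hy s hs' rfl
      rw [this]
    · exact chartFun_of_notMem hz'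

/-! ### Lifts to `X × ℝ` -/

section Lift

open scoped Classical in
/-- The lift of `g` to `X × ℝ` preserving the leaves `{x} × ℝ`. -/
noncomputable def lift (g : S.Z ≃ₜ S.Z) (x : X) (t : ℝ) : ℝ :=
  if h : ∃ f : ℝ → ℝ, LocalForm g x t f then h.choose t else t

variable {hS : S.StandingAssumption} {g h : S.Z ≃ₜ S.Z}

theorem exists_localForm_of_mem (hg : g ∈ S.typeDGroup hS) (x : X) (t : ℝ) :
    ∃ f ∈ TD, LocalForm g x t f := IsTypeDHomeo.exists_localForm hg x t

theorem lift_eq (hS : S.StandingAssumption) {x : X} {t : ℝ} {f : ℝ → ℝ} (hf : LocalForm g x t f) : lift g x t = f t := by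
  have h : ∃ f : ℝ → ℝ, LocalForm g x t f := ⟨f, hf⟩
  unfold lift
  rw [dif_pos h]
  exact (hS.localForm_unique h.choose_spec hf).self_of_nhds

theorem lift_eventually_eq (hS : S.StandingAssumption) {x : X} {t : ℝ} {f : ℝ → ℝ} (hf : LocalForm g x t f) :
    ∀ᶠ p : X × ℝ in 𝓝 (x, t), lift g p.1 p.2 = f p.2 := by
  filter_upwards [eventually_eventually_nhds.2 hf] with p hp
  exact lift_eq hS hp

theorem proj_lift (hg : g ∈ S.typeDGroup hS) (x : X) (t : ℝ) :
    g (S.proj (x, t)) = S.proj (x, lift g x t) := by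
  obtain ⟨f, -, hf⟩ := exists_localForm_of_mem hg x t
  rw [lift_eq hS hf]
  exact hf.self_of_nhds

theorem lift_mul (hg : g ∈ S.typeDGroup hS) (hh : h ∈ S.typeDGroup hS) (x : X) (t : ℝ) :
    lift (g * h) x t = lift g x (lift h x t) := by
  obtain ⟨f, -, hf⟩ := exists_localForm_of_mem hh x t
  obtain ⟨k, -, hk⟩ := exists_localForm_of_mem hg x (f t)
  rw [lift_eq hS hf, lift_eq hS hk]
  exact lift_eq hS (g := g * h) (f := fun s => k (f s)) (LocalForm.comp (g := g) (h := h) f.continuous.continuousAt hk hf)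

theorem lift_one (hS : S.StandingAssumption) (x : X) (t : ℝ) : lift (1 : S.Z ≃ₜ S.Z) x t = t :=
  lift_eq hS (f := fun s => s) (Eventually.of_forall fun _ => rfl)

theorem lift_conj (hg : g ∈ S.typeDGroup hS) {ψ : X ≃ₜ X} {ε : ℝ} {n : ℤ} (hε : ε = 1 ∨ ε = -1)
    (hψ : ∀ r : X × ℝ, S.proj (ψ r.1, ε * r.2 - n) = S.proj r) (x : X) (t : ℝ) :
    lift g (ψ x) (ε * t - n) = ε * lift g x t - n := by
  have hεε : ε * ε = 1 := by rcases hε with rfl | rfl <;> norm_num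
  obtain ⟨f, -, hf⟩ := exists_localForm_of_mem hg x t
  rw [lift_eq hS hf, lift_eq hS (hf.conj hε hψ)]
  have e : ε * (ε * t - n + n) = t := by linear_combination t * hεε
  rw [e]

theorem lift_zpow (hg : g ∈ S.typeDGroup hS) (n : ℤ) (x : X) (t : ℝ) :
    lift g ((S.φ ^ n) x) (t - n) = lift g x t - n := by
  simpa using lift_conj hg (ψ := S.φ ^ n) (ε := 1) (n := n) (Or.inl rfl)
    (fun r => by simpa using proj_zpow n r.1 r.2) x t

theorem lift_zpow_σ (hg : g ∈ S.typeDGroup hS) (n : ℤ) (x : X) (t : ℝ) :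
    lift g ((S.φ ^ n) (S.σ x)) (-t - n) = -lift g x t - n := by
  simpa using lift_conj hg (ψ := S.φ ^ n * S.σ) (ε := -1) (n := n) (Or.inr rfl)
    (fun r => by simpa using proj_zpow_σ n r.1 r.2) x t

/-- Local forms do not involve the base point, so the lift is locally constant in it; compactness of
`K` makes this uniform in time. -/
theorem lift_eventually_forall_eq (hg : g ∈ S.typeDGroup hS) (x : X) {K : Set ℝ}
    (hK : IsCompact K) : ∀ᶠ y in 𝓝 x, ∀ t ∈ K, lift g y t = lift g x t := by
  refine hK.eventually_forall_of_forall_eventually fun t _ => ?_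
  obtain ⟨f, -, hf⟩ := exists_localForm_of_mem hg x t
  have h1 := lift_eventually_eq hS hf
  have h2 : Tendsto (fun p : X × ℝ => (x, p.2)) (𝓝 (x, t)) (𝓝 (x, t)) := by
    have := (by fun_prop : Continuous fun p : X × ℝ => (x, p.2)).tendsto (x, t)
    exact this
  filter_upwards [h1, h2.eventually h1] with p h3 h4
  rw [h3, h4]

theorem eq_of_lift_eq (hg : g ∈ S.typeDGroup hS) (hh : h ∈ S.typeDGroup hS)
    (e : ∀ x t, lift g x t = lift h x t) : g = h := by
  ext z
  obtain ⟨⟨x, t⟩, rfl⟩ := surjective_proj z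
  rw [proj_lift hg, proj_lift hh, e]

/-- Locally the lift is an element of `TD`, which makes it increasing on the whole leaf; the lift of
the inverse gives surjectivity. -/
theorem exists_eq_lift (hg : g ∈ S.typeDGroup hS) (x : X) : ∃ F ∈ TD, ∀ t, F t = lift g x t := by
  have hloc : ∀ t, ∃ f ∈ TD, ∀ᶠ s in 𝓝 t, lift g x s = f s := by
    intro t
    obtain ⟨f, hfT, hf⟩ := exists_localForm_of_mem hg x t
    refine ⟨f, hfT, ?_⟩
    have h2 : Tendsto (fun s : ℝ => (x, s)) (𝓝 t) (𝓝 (x, t)) :=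
      (by fun_prop : Continuous fun s : ℝ => (x, s)).tendsto t
    exact h2.eventually (lift_eventually_eq hS hf)
  have hmono : StrictMono (lift g x) :=
    strictMono_of_locally fun t => (hloc t).imp fun f hf => hf.2
  have hsurj : Function.Surjective (lift g x) := fun t => ⟨lift g⁻¹ x t, by
    rw [← lift_mul hg (inv_mem hg), mul_inv_cancel, lift_one hS]⟩
  refine ⟨hmono.orderIsoOfSurjective _ hsurj, fun t => ?_, fun t => rfl⟩
  obtain ⟨f, hfT, hf⟩ := hloc t
  exact (hfT t).congr (hf.mono fun _ h => h.symm)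

end Lift

/-! ### Fragmentation -/

/-- `H` contains all homeomorphisms acting on `E × (a, b)` by a type `𝔇` automorphism supported in
`(a, b)`. -/
def Full (H : Subgroup (S.Z ≃ₜ S.Z)) (E : Set X) (a b : ℝ) : Prop :=
  ∀ f ∈ TDOn a b, ∀ h, Acts E f h → h ∈ H

/-- `H` contains all type `𝔇` homeomorphisms supported in charts over closed subintervals of the
box `(e - 1 / 2, e + 1 / 2)`. -/
def BoxFull (H : Subgroup (S.Z ≃ₜ S.Z)) (N : ℤ) (e : ℝ) : Prop :=
  ∀ E, IsClopen E → (∀ y ∈ E, (S.φ ^ N) (S.σ y) ∉ E) → ∀ a b, e - 1 / 2 < a → b < e + 1 / 2 →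
    Full H E a b

/-- Within an open interval of length one centred at `e`, the only possible identifications are
trivial or come from the reflection about the centre, combined with `φ ^ N σ` on the base, which the
hypothesis on `E` excludes. -/
theorem injOn_box {N : ℤ} {e : ℝ} (he : 2 * e = -N) {E : Set X}
    (hE : ∀ y ∈ E, (S.φ ^ N) (S.σ y) ∉ E) :
    InjOn S.proj (E ×ˢ Ioo (e - 1 / 2) (e + 1 / 2)) := by
  rintro ⟨y, s⟩ ⟨hy, hs⟩ ⟨y', s'⟩ ⟨hy', hs'⟩ h
  simp only [mem_Ioo] at hy hs hy' hs'
  obtain ⟨n, h | h⟩ := S.proj_eq_iff.1 h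
  · simp only [Prod.mk.injEq] at h
    have h1 : |(n : ℝ)| < 1 := by
      rw [abs_lt]
      constructor <;> linarith [h.2]
    have h2 : n = 0 := Int.abs_lt_one_iff.1 (by exact_mod_cast h1)
    subst h2
    simp only [zpow_zero, Int.cast_zero, sub_zero] at h
    exact Prod.ext h.1.symm h.2.symm
  · simp only [Prod.mk.injEq] at h
    have h1 : |((n - N : ℤ) : ℝ)| < 1 := by
      push_cast
      rw [abs_lt]
      constructor <;> linarith [h.2]
    have h2 : n - N = 0 := Int.abs_lt_one_iff.1 (by exact_mod_cast h1)
    obtain rfl : n = N := by omega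
    exact absurd (h.1 ▸ hy') (hE y hy)

theorem mem_actRel_of_subset {D D' : Set X} {a b : ℝ} (hD : D ⊆ D')
    (hinj : InjOn S.proj (D' ×ˢ Ioo a b)) {U : X → ℝ ≃o ℝ} {h : S.Z ≃ₜ S.Z}
    (hU : (U, h) ∈ S.actRel D a b) : (D.mulIndicator U, h) ∈ S.actRel D' a b := by
  obtain ⟨h1, h2, h3⟩ := hU
  refine ⟨fun y => ?_, fun y hy s hs => ?_, fun z hz =>
    h3 z fun h' => hz (image_mono (prod_mono_left hD) h')⟩
  · by_cases hy : y ∈ D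
    · simpa [hy] using h1 y
    · simp [hy, one_mem]
  · by_cases hy' : y ∈ D
    · simpa only [mulIndicator_of_mem hy'] using h2 y hy' s hs
    · simp only [mulIndicator_of_notMem hy', one_apply]
      refine h3 _ ?_
      rintro ⟨⟨x, t⟩, ⟨hx, ht⟩, hxt⟩
      have := hinj (mk_mem_prod (hD hx) ht) (mk_mem_prod hy hs) hxt
      simp only [Prod.mk.injEq] at this
      exact hy' (this.1 ▸ hx)

theorem zpow_σ_zpow_σ (N : ℤ) (x : X) : (S.φ ^ N) (S.σ ((S.φ ^ N) (S.σ x))) = x := by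
  rw [σ_zpow, S.σ_σ, zpow_zpow, add_neg_cancel]
  rfl

theorem continuous_zpow_σ (N : ℤ) : Continuous fun x => (S.φ ^ N) (S.σ x) := by fun_prop

/-- Realisation of a locally prescribed behaviour in a box. -/
theorem exists_box (hS : S.StandingAssumption) {H : Subgroup (S.Z ≃ₜ S.Z)} {N : ℤ} {e : ℝ}
    (he : 2 * e = -N) (hH : BoxFull H N e) (P : X → (ℝ ≃o ℝ) → Prop)
    (hP : ∀ x, ∃ a b, e - 1 / 2 < a ∧ b < e + 1 / 2 ∧ ∃ u ∈ TDOn a b, ∀ᶠ y in 𝓝 x, P y u) :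
    ∃ h ∈ S.typeDGroup hS, h ∈ H ∧ ∃ Y : Set X, (∀ x, x ∈ Y ∨ (S.φ ^ N) (S.σ x) ∈ Y) ∧
      ∀ x ∈ Y, ∃ u ∈ suppIn (e - 1 / 2) (e + 1 / 2), P x u ∧
        ∀ s ∈ Ioo (e - 1 / 2) (e + 1 / 2), lift h x s = u s := by
  have := hS.compact
  have := hS.metrizable
  have := hS.totallyDisconnected
  have hC : ∀ x, ∃ E : Set X, IsClopen E ∧ x ∈ E ∧ (∀ y ∈ E, (S.φ ^ N) (S.σ y) ∉ E) ∧
      ∃ a b, e - 1 / 2 < a ∧ b < e + 1 / 2 ∧ ∃ u ∈ TDOn a b, ∀ y ∈ E, P y u := by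
    intro x
    obtain ⟨a, b, ha, hb, u, hu, hPu⟩ := hP x
    obtain ⟨V, W, hV, hW, hxV, hxW, hVW⟩ := t2_separation (hS.zpow_σ_ne N x)
    obtain ⟨E, hE, hxE, hEs⟩ := compact_exists_isClopen_in_isOpen
      (((hV.preimage (continuous_zpow_σ N)).inter hW).inter isOpen_interior)
      ⟨⟨hxV, hxW⟩, mem_interior_iff_mem_nhds.2 hPu⟩
    exact ⟨E, hE, hxE, fun y hy hy' => disjoint_left.1 hVW (hEs hy).1.1 (hEs hy').1.2,
      a, b, ha, hb, u, hu, fun y hy => interior_subset (s := {y | P y u}) (hEs hy).2⟩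
  choose E hE hxE hdisj a b ha hb u hu hPu using hC
  obtain ⟨t, ht⟩ := isCompact_univ.elim_nhds_subcover E fun x _ => (hE x).isOpen.mem_nhds (hxE x)
  -- The sets `E x` are exhausted one by one, discarding what `Y` or its mirror image under `φ ^ N
  -- σ` already covers. Thus `Y` stays disjoint from its mirror image, so that it defines a chart,
  -- while the two together come to cover `X`.
  have key : ∀ t : Finset X, ∃ Y : Set X, IsClopen Y ∧ (∀ y ∈ Y, (S.φ ^ N) (S.σ y) ∉ Y) ∧
      (∀ x ∈ t, ∀ y ∈ E x, y ∈ Y ∨ (S.φ ^ N) (S.σ y) ∈ Y) ∧ ∃ h ∈ S.typeDGroup hS, h ∈ H ∧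
      ∃ U : X → ℝ ≃o ℝ, (U, h) ∈ S.actRel Y (e - 1 / 2) (e + 1 / 2) ∧
        ∀ y ∈ Y, P y (U y) ∧ ∀ᶠ y' in 𝓝 y, U y' = U y := by
    intro t
    classical
    induction t using Finset.induction_on with
    | empty =>
      exact ⟨∅, isClopen_empty, by simp, by simp, 1, one_mem _, one_mem _, 1, one_mem _, by simp⟩
    | insert x t _ ih =>
      obtain ⟨Y, hY, hYd, hcov, h, hh, hhH, U, hU, hUP⟩ := ih
      set F := E x \ (Y ∪ (fun y => (S.φ ^ N) (S.σ y)) ⁻¹' Y) with hF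
      have hFc : IsClopen F := (hE x).diff (hY.union (hY.preimage (continuous_zpow_σ N)))
      have hFd : ∀ y ∈ F, (S.φ ^ N) (S.σ y) ∉ F := fun y hy hy' => hdisj x y hy.1 hy'.1
      have hd : ∀ y ∈ Y ∪ F, (S.φ ^ N) (S.σ y) ∉ Y ∪ F := by
        rintro y (hy | hy) (hy' | hy')
        · exact hYd y hy hy'
        · refine hy'.2 (Or.inr ?_)
          change (S.φ ^ N) (S.σ ((S.φ ^ N) (S.σ y))) ∈ Y
          rwa [zpow_σ_zpow_σ]
        · exact hy.2 (Or.inr hy')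
        · exact hFd y hy hy'
      have hinj := injOn_box he hd
      obtain ⟨k, hk, hka⟩ := hS.exists_acts hFc (injOn_box he hFd) (hu x) (ha x) (hb x)
      have hkH : k ∈ H := hH F hFc hFd _ _ (ha x) (hb x) _ (hu x) _ hka
      have hux := suppIn_mono (ha x).le (hb x).le (TDOn_le_suppIn _ _ (hu x))
      rw [acts_iff subset_union_right hinj hux] at hka
      refine ⟨Y ∪ F, hY.union hFc, hd, ?_, h * k, mul_mem hh hk, mul_mem hhH hkH, _,
        mul_mem (mem_actRel_of_subset subset_union_left hinj hU) hka, ?_⟩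
      · intro x' hx' y hy
        rcases Finset.mem_insert.1 hx' with rfl | hx'
        · by_cases h1 : y ∈ Y
          · exact Or.inl (Or.inl h1)
          by_cases h2 : (S.φ ^ N) (S.σ y) ∈ Y
          · exact Or.inr (Or.inl h2)
          · exact Or.inl (Or.inr ⟨hy, fun h => h.elim h1 h2⟩)
        · exact (hcov x' hx' y hy).imp Or.inl Or.inl
      · have e1 : ∀ y ∈ Y, (Y.mulIndicator U * F.mulIndicator fun _ => u x) y = U y := by
          intro y hy
          rw [Pi.mul_apply, mulIndicator_of_mem hy,
            mulIndicator_of_notMem fun h : y ∈ F => h.2 (Or.inl hy), mul_one]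
        have e2 : ∀ y ∈ F, (Y.mulIndicator U * F.mulIndicator fun _ => u x) y = u x := by
          intro y hy
          rw [Pi.mul_apply, mulIndicator_of_mem hy,
            mulIndicator_of_notMem fun h : y ∈ Y => hy.2 (Or.inl h), one_mul]
        rintro y (hy | hy)
        · simp only [e1 y hy]
          refine ⟨(hUP y hy).1, ?_⟩
          filter_upwards [(hUP y hy).2, hY.isOpen.mem_nhds hy] with y' h1 h2
          rw [e1 y' h2, h1]
        · simp only [e2 y hy]
          refine ⟨hPu x y hy.1, ?_⟩
          filter_upwards [hFc.isOpen.mem_nhds hy] with y' h2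
          rw [e2 y' h2]
  obtain ⟨Y, hY, -, hcov, h, hh, hhH, U, hU, hUP⟩ := key t
  refine ⟨h, hh, hhH, Y, fun x => ?_, fun x hx => ⟨U x, hU.1 x, (hUP x hx).1, fun s hs => ?_⟩⟩
  · obtain ⟨x', hx', hxx'⟩ := mem_iUnion₂.1 (ht.2 (mem_univ x))
    exact hcov x' hx' x hxx'
  · refine lift_eq hS (f := U x) ?_
    filter_upwards [prod_mem_nhds (inter_mem (hY.isOpen.mem_nhds hx) (hUP x hx).2)
      (isOpen_Ioo.mem_nhds hs)] with p hp
    have := hU.2.1 p.1 hp.1.1 p.2 hp.2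
    rwa [show (U, h).1 p.1 = U x from hp.1.2] at this

/-- Over `Y` this expresses that `u` is supported in the box; elsewhere it follows from equivariance
under the reflection about `e`. -/
theorem lift_mem_box {hS : S.StandingAssumption} {h : S.Z ≃ₜ S.Z} (hh : h ∈ S.typeDGroup hS)
    {N : ℤ} {e : ℝ} (he : 2 * e = -N) {Y : Set X} (hY : ∀ x, x ∈ Y ∨ (S.φ ^ N) (S.σ x) ∈ Y)
    (hu : ∀ x ∈ Y, ∃ u ∈ suppIn (e - 1 / 2) (e + 1 / 2),
      ∀ s ∈ Ioo (e - 1 / 2) (e + 1 / 2), lift h x s = u s) (x : X) :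
    (∀ s ∈ Ioo (e - 1 / 2) (e + 1 / 2), lift h x s ∈ Ioo (e - 1 / 2) (e + 1 / 2)) ∧
      lift h x (e - 1 / 2) = e - 1 / 2 := by
  have h1 : ∀ x, lift h x (e - 1 / 2) = e - 1 / 2 ∧ lift h x (e + 1 / 2) = e + 1 / 2 ∧
      ∀ s ∈ Ioo (e - 1 / 2) (e + 1 / 2), lift h x s ∈ Ioo (e - 1 / 2) (e + 1 / 2) := by
    have key : ∀ x ∈ Y, lift h x (e - 1 / 2) = e - 1 / 2 ∧ lift h x (e + 1 / 2) = e + 1 / 2 ∧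
        ∀ s ∈ Ioo (e - 1 / 2) (e + 1 / 2), lift h x s ∈ Ioo (e - 1 / 2) (e + 1 / 2) := by
      intro x hx
      obtain ⟨u, hu, e1⟩ := hu x hx
      obtain ⟨F, -, hF⟩ := exists_eq_lift hh x
      have hcl : EqOn F u (closure (Ioo (e - 1 / 2) (e + 1 / 2))) :=
        EqOn.closure (fun s hs => by rw [hF, e1 s hs]) F.continuous u.continuous
      rw [closure_Ioo (by linarith)] at hcl
      refine ⟨?_, ?_, fun s hs => ?_⟩
      · rw [← hF, hcl (left_mem_Icc.2 (by linarith)), hu _ (by simp)]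
      · rw [← hF, hcl (right_mem_Icc.2 (by linarith)), hu _ (by simp)]
      · rw [e1 s hs]
        exact (suppIn_mem_Ioo hu).2 hs
    intro x
    rcases hY x with hx | hx
    · exact key x hx
    · obtain ⟨k1, k2, k3⟩ := key _ hx
      have hflip : ∀ s, lift h ((S.φ ^ N) (S.σ x)) (2 * e - s) = 2 * e - lift h x s := by
        intro s
        have := lift_zpow_σ hh N x s
        rw [show 2 * e - s = -s - N by linarith, this]
        linarith
      have f1 := hflip (e - 1 / 2)
      have f2 := hflip (e + 1 / 2)
      rw [show 2 * e - (e - 1 / 2) = e + 1 / 2 by ring, k2] at f1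
      rw [show 2 * e - (e + 1 / 2) = e - 1 / 2 by ring, k1] at f2
      refine ⟨by linarith, by linarith, fun s hs => ?_⟩
      have := k3 (2 * e - s) ⟨by linarith [hs.2], by linarith [hs.1]⟩
      rw [hflip] at this
      exact ⟨by linarith [this.2], by linarith [this.1]⟩
  exact ⟨(h1 x).2.2, (h1 x).1⟩

/-! ### Reducing the displacement of time 0 -/

theorem exists_abs_lift_zero_le {hS : S.StandingAssumption} {g : S.Z ≃ₜ S.Z}
    (hg : g ∈ S.typeDGroup hS) : ∃ K, ∀ x, |lift g x 0| ≤ K := by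
  have := hS.compact
  have hc : Continuous fun x => lift g x 0 := by
    refine IsLocallyConstant.continuous ((IsLocallyConstant.iff_eventually_eq _).2 fun x => ?_)
    filter_upwards [lift_eventually_forall_eq hg x (isCompact_singleton (x := (0 : ℝ)))] with y hy
    exact hy 0 rfl
  obtain ⟨K, hK⟩ := isCompact_univ.exists_bound_of_continuousOn hc.continuousOn
  exact ⟨K, fun x => hK x (mem_univ x)⟩

theorem lift_intCast {hS : S.StandingAssumption} {g : S.Z ≃ₜ S.Z}
    (hg : g ∈ S.typeDGroup hS) (n : ℤ) (x : X) :
    lift g x n = lift g ((S.φ ^ n) x) 0 + n := by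
  have := lift_zpow hg n x n
  rw [sub_self] at this
  linarith

/-- As `F` is increasing, the images of the integers below `e` lie to the left of those of the
integers above `e`. Inside the box a PL map can push the rightmost of the former below `e - 1 / 4`
and the leftmost of the latter above `e + 1 / 4`. -/
theorem exists_push {hS : S.StandingAssumption} {g : S.Z ≃ₜ S.Z} (hg : g ∈ S.typeDGroup hS)
    (e : ℝ) (x : X) : ∃ a b, e - 1 / 2 < a ∧ b < e + 1 / 2 ∧ ∃ u ∈ TDOn a b, ∀ᶠ y in 𝓝 x,
      ∀ n : ℤ, lift g y n ∈ Ioo (e - 1 / 2) (e + 1 / 2) →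
        ((n : ℝ) < e → u (lift g y n) < e - 1 / 4) ∧
        (e < (n : ℝ) → e + 1 / 4 < u (lift g y n)) := by
  obtain ⟨F, hF, hFl⟩ := exists_eq_lift hg x
  have hFd : ∀ n : ℤ, IsDyadic (F n) := fun n => (isDyadic_apply hF).2 (isDyadic_int n)
  have hpq : ∃ p q, IsDyadic p ∧ IsDyadic q ∧ e - 1 / 2 < p ∧ p < q ∧ q < e + 1 / 2 ∧
      (∀ n : ℤ, (n : ℝ) < e → F n ∈ Ioo (e - 1 / 2) (e + 1 / 2) → F n ≤ p) ∧
      ∀ n : ℤ, e < (n : ℝ) → F n ∈ Ioo (e - 1 / 2) (e + 1 / 2) → q ≤ F n := by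
    have hA : (∃ p, IsDyadic p ∧ e - 1 / 2 < p ∧ p < e + 1 / 2 ∧
        (∀ n : ℤ, (n : ℝ) < e → F n ∈ Ioo (e - 1 / 2) (e + 1 / 2) → F n ≤ p) ∧
        ∀ n : ℤ, e < (n : ℝ) → p < F n) ∨
        ∀ n : ℤ, (n : ℝ) < e → F n ∉ Ioo (e - 1 / 2) (e + 1 / 2) := by
      by_cases h : ∃ n : ℤ, (n : ℝ) < e ∧ F n ∈ Ioo (e - 1 / 2) (e + 1 / 2)
      · obtain ⟨m, ⟨hm1, hm2⟩, hm3⟩ := Int.exists_greatest_of_bdd (P := fun n : ℤ => (n : ℝ) < e ∧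
          F n ∈ Ioo (e - 1 / 2) (e + 1 / 2)) ⟨⌈e⌉, fun z hz => by
            have := hz.1.le.trans (Int.le_ceil e)
            exact_mod_cast this⟩ h
        exact Or.inl ⟨F m, hFd m, hm2.1, hm2.2, fun n hn hn' =>
          F.monotone (by exact_mod_cast hm3 n ⟨hn, hn'⟩), fun n hn => F.strictMono (by linarith)⟩
      · push Not at h
        exact Or.inr h
    have hB : (∃ q, IsDyadic q ∧ e - 1 / 2 < q ∧ q < e + 1 / 2 ∧
        (∀ n : ℤ, e < (n : ℝ) → F n ∈ Ioo (e - 1 / 2) (e + 1 / 2) → q ≤ F n) ∧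
        ∃ n : ℤ, e < (n : ℝ) ∧ q = F n) ∨
        ∀ n : ℤ, e < (n : ℝ) → F n ∉ Ioo (e - 1 / 2) (e + 1 / 2) := by
      by_cases h : ∃ n : ℤ, e < (n : ℝ) ∧ F n ∈ Ioo (e - 1 / 2) (e + 1 / 2)
      · obtain ⟨m, ⟨hm1, hm2⟩, hm3⟩ := Int.exists_least_of_bdd (P := fun n : ℤ => e < (n : ℝ) ∧
          F n ∈ Ioo (e - 1 / 2) (e + 1 / 2)) ⟨⌊e⌋, fun z hz => by
            have := (Int.floor_le e).trans hz.1.le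
            exact_mod_cast this⟩ h
        exact Or.inl ⟨F m, hFd m, hm2.1, hm2.2, fun n hn hn' =>
          F.monotone (by exact_mod_cast hm3 n ⟨hn, hn'⟩), m, hm1, rfl⟩
      · push Not at h
        exact Or.inr h
    rcases hA with ⟨p, hp, p1, p2, p3, p4⟩ | hA
    · rcases hB with ⟨q, hq, q1, q2, q3, n, hn, rfl⟩ | hB
      · exact ⟨p, F n, hp, hq, p1, p4 n hn, q2, p3, q3⟩
      · obtain ⟨q, hq, h1, h2⟩ := exists_isDyadic_between p2
        exact ⟨p, q, hp, hq, p1, h1, h2, p3, fun n hn hn' => absurd hn' (hB n hn)⟩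
    · rcases hB with ⟨q, hq, q1, q2, q3, -⟩ | hB
      · obtain ⟨p, hp, h1, h2⟩ := exists_isDyadic_between q1
        exact ⟨p, q, hp, hq, h1, h2, q2, fun n hn hn' => absurd hn' (hA n hn), q3⟩
      · obtain ⟨p, hp, h1, h2⟩ := exists_isDyadic_between
          (show e - 1 / 2 < e + 1 / 2 by linarith)
        obtain ⟨q, hq, h3, h4⟩ := exists_isDyadic_between h2
        exact ⟨p, q, hp, hq, h1, h3, h4, fun n hn hn' => absurd hn' (hA n hn),
          fun n hn hn' => absurd hn' (hB n hn)⟩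
  obtain ⟨p, q, hp, hq, p1, pq, q2, hlow, hupp⟩ := hpq
  obtain ⟨p', hp', p1', p2'⟩ := exists_isDyadic_between (show e - 1 / 2 < e - 1 / 4 by linarith)
  obtain ⟨q', hq', q1', q2'⟩ := exists_isDyadic_between (show e + 1 / 4 < e + 1 / 2 by linarith)
  obtain ⟨a, ha, a1, a2⟩ := exists_isDyadic_between (lt_min p1 p1')
  obtain ⟨b, hb, b1, b2⟩ := exists_isDyadic_between (max_lt q2 q2')
  rw [lt_min_iff] at a2
  rw [max_lt_iff] at b1
  obtain ⟨u, hu, hup, huq⟩ := exists_PLOn_apply_eq₂ ha hb hp hq hp' hq' a2.1 pq b1.1 a2.2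
    (by linarith) b1.2
  -- Displacements of integer times are bounded by `K` uniformly in the base point. Only integers in
  -- a fixed compact interval can land in the box, and there the lift over `y` agrees with the lift
  -- over `x`.
  obtain ⟨K, hK⟩ := exists_abs_lift_zero_le hg
  refine ⟨a, b, a1, b2, u, PLOn_le_TDOn _ _ hu, ?_⟩
  filter_upwards [lift_eventually_forall_eq hg x
    (isCompact_Icc (a := -(|e| + 1 + K)) (b := |e| + 1 + K))] with y hy n hn
  have hn' : (n : ℝ) ∈ Icc (-(|e| + 1 + K)) (|e| + 1 + K) := by
    have h1 := lift_intCast hg n y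
    have h2 := abs_le.1 (hK ((S.φ ^ n) y))
    constructor <;> linarith [hn.1, hn.2, neg_abs_le e, le_abs_self e, h2.1, h2.2]
  rw [hy n hn', ← hFl] at hn ⊢
  refine ⟨fun h => ?_, fun h => ?_⟩
  · have := u.monotone (hlow n h hn)
    linarith
  · have := u.monotone (hupp n h hn)
    linarith

/-- Multiplying by an element of `H` in order to push the points `lift g x n` away from `e`. -/
theorem exists_push_all (hS : S.StandingAssumption) {H : Subgroup (S.Z ≃ₜ S.Z)} {N : ℤ} {e : ℝ}
    (he : 2 * e = -N) (hH : BoxFull H N e) {g : S.Z ≃ₜ S.Z} (hg : g ∈ S.typeDGroup hS) :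
    ∃ h ∈ S.typeDGroup hS, h ∈ H ∧ ∀ (x : X) (m : ℤ),
      (lift g x 0 = e - 1 / 2 + m → lift (h * g) x 0 = e - 1 / 2 + m) ∧
      (lift g x 0 ∈ Ioo (e - 1 / 2 + m) (e + 1 / 2 + m) →
        lift (h * g) x 0 ∈ Ioo (e - 1 / 2 + m) (e + 1 / 2 + m) ∧
        (-(m : ℝ) < e → lift (h * g) x 0 < e - 1 / 4 + m) ∧
        (e < -(m : ℝ) → e + 1 / 4 + m < lift (h * g) x 0)) := by
  obtain ⟨h, hh, hhH, Y, hY, hYu⟩ := exists_box hS he hH (fun y u => ∀ n : ℤ,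
    lift g y n ∈ Ioo (e - 1 / 2) (e + 1 / 2) → ((n : ℝ) < e → u (lift g y n) < e - 1 / 4) ∧
        (e < (n : ℝ) → e + 1 / 4 < u (lift g y n))) (exists_push hg e)
  have hbox := lift_mem_box hh he hY fun x hx => (hYu x hx).imp fun u hu => ⟨hu.1, hu.2.2⟩
  have key1 : ∀ x ∈ Y, ∀ n : ℤ, lift g x n ∈ Ioo (e - 1 / 2) (e + 1 / 2) →
      ((n : ℝ) < e → lift h x (lift g x n) < e - 1 / 4) ∧
        (e < (n : ℝ) → e + 1 / 4 < lift h x (lift g x n)) := by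
    intro x hx n hn
    obtain ⟨u, -, hu, hul⟩ := hYu x hx
    rw [hul _ hn]
    exact hu n hn
  have key : ∀ x, ∀ n : ℤ, lift g x n ∈ Ioo (e - 1 / 2) (e + 1 / 2) →
      ((n : ℝ) < e → lift h x (lift g x n) < e - 1 / 4) ∧
        (e < (n : ℝ) → e + 1 / 4 < lift h x (lift g x n)) := by
    intro x n hn
    rcases hY x with hx | hx
    · exact key1 x hx n hn
    · have h1 := key1 _ hx (-n - N)
      have h2 := lift_zpow_σ hg N x n
      have h3 := lift_zpow_σ hh N x (lift g x n)
      push_cast at h1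
      rw [h2, h3] at h1
      have h4 := h1 ⟨by linarith [hn.2], by linarith [hn.1]⟩
      refine ⟨fun h => ?_, fun h => ?_⟩
      · linarith [h4.2 (by linarith)]
      · linarith [h4.1 (by linarith)]
  refine ⟨h, hh, hhH, fun x m => ?_⟩
  -- The image of time 0 over `x` lies in the `m`-th translate of the box exactly when the image of
  -- time `-m` over `φ ^ m x` lies in the box itself.
  have e1 : lift g ((S.φ ^ m) x) ((-m : ℤ) : ℝ) = lift g x 0 - m := by
    have := lift_zpow hg m x 0
    rwa [zero_sub, ← Int.cast_neg] at this
  have e2 : lift h ((S.φ ^ m) x) (lift g x 0 - m) = lift (h * g) x 0 - m := by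
    rw [lift_zpow hh, lift_mul hh hg]
  have hb := hbox ((S.φ ^ m) x)
  refine ⟨fun h0 => ?_, fun h0 => ?_⟩
  · have h1 : lift g x 0 - m = e - 1 / 2 := by linarith
    rw [h1, hb.2] at e2
    linarith
  · have h1 : lift g x 0 - m ∈ Ioo (e - 1 / 2) (e + 1 / 2) :=
      ⟨by linarith [h0.1], by linarith [h0.2]⟩
    have h2 := hb.1 _ h1
    have h3 := key ((S.φ ^ m) x) (-m) (by rwa [e1])
    rw [e1, e2] at h3
    rw [e2] at h2
    push_cast at h3
    exact ⟨⟨by linarith [h2.1], by linarith [h2.2]⟩, fun h => by linarith [h3.1 h],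
      fun h => by linarith [h3.2 h]⟩

/-- The translated boxes are the intervals `(m, m + 1)`. For `m ≥ 0` the value is pushed below `m +
1 / 4 ≤ k - 3 / 4`, and for `m < 0` above `m + 3 / 4 ≥ -k + 3 / 4`. Integer values are left in
place. -/
theorem exists_contract_half (hS : S.StandingAssumption) {H : Subgroup (S.Z ≃ₜ S.Z)}
    (hH : BoxFull H (-1) (1 / 2)) {g : S.Z ≃ₜ S.Z} (hg : g ∈ S.typeDGroup hS) {k : ℤ} (hk : 1 ≤ k)
    (hgk : ∀ x, |lift g x 0| < k) :
    ∃ h ∈ S.typeDGroup hS, h ∈ H ∧ ∀ x, |lift (h * g) x 0| < k - 3 / 4 := by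
  obtain ⟨h, hh, hhH, hp⟩ := exists_push_all hS (by norm_num) hH hg
  refine ⟨h, hh, hhH, fun x => ?_⟩
  obtain ⟨p1, p2⟩ := hp x ⌊lift g x 0⌋
  obtain ⟨g1, g2⟩ := abs_lt.1 (hgk x)
  set m := ⌊lift g x 0⌋
  have m1 : (m : ℝ) ≤ lift g x 0 := Int.floor_le _
  have m2 : lift g x 0 < m + 1 := Int.lt_floor_add_one _
  have hk' : (1 : ℝ) ≤ k := by exact_mod_cast hk
  have hmk : (m : ℝ) ≤ k - 1 := by
    have : m < k := by exact_mod_cast m1.trans_lt g2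
    exact_mod_cast Int.le_sub_one_of_lt this
  rw [abs_lt]
  rcases m1.eq_or_lt with h0 | h0
  · rw [p1 (by linarith)]
    have : (-k : ℝ) + 1 ≤ m := by
      have : -k < m := by
        rw [← h0] at g1
        exact_mod_cast g1
      exact_mod_cast this
    constructor <;> linarith
  · obtain ⟨q1, q2, q3⟩ := p2 ⟨by linarith, by linarith⟩
    rcases le_or_gt 0 m with h1 | h1
    · have h1' : (0 : ℝ) ≤ m := by exact_mod_cast h1
      have := q2 (by linarith)
      constructor <;> linarith [q1.1]
    · have h1' : (m : ℝ) ≤ -1 := by exact_mod_cast Int.le_sub_one_of_lt h1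
      have := q3 (by linarith)
      have : (-k : ℝ) ≤ m := by
        have : -k < m + 1 := by exact_mod_cast g1.trans m2
        exact_mod_cast Int.lt_add_one_iff.1 this
      constructor <;> linarith [q1.2]

/-- The translated boxes are centred at the integers `m`, and the bound forces `|m| ≤ k - 1`. A
value in the box around 0 stays there, and one in the box around `m ≠ 0` ends with absolute value
below `|m| - 1 / 4`. The left endpoints of the boxes are left in place. -/
theorem exists_contract_zero (hS : S.StandingAssumption) {H : Subgroup (S.Z ≃ₜ S.Z)}
    (hH : BoxFull H 0 0) {g : S.Z ≃ₜ S.Z} (hg : g ∈ S.typeDGroup hS) {k : ℤ} (hk : 2 ≤ k)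
    (hgk : ∀ x, |lift g x 0| < k - 3 / 4) :
    ∃ h ∈ S.typeDGroup hS, h ∈ H ∧ ∀ x, |lift (h * g) x 0| < k - 1 := by
  obtain ⟨h, hh, hhH, hp⟩ := exists_push_all hS (by norm_num) hH hg
  refine ⟨h, hh, hhH, fun x => ?_⟩
  obtain ⟨p1, p2⟩ := hp x ⌊lift g x 0 + 1 / 2⌋
  obtain ⟨g1, g2⟩ := abs_lt.1 (hgk x)
  set m := ⌊lift g x 0 + 1 / 2⌋
  have m1 : (m : ℝ) ≤ lift g x 0 + 1 / 2 := Int.floor_le _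
  have m2 : lift g x 0 + 1 / 2 < m + 1 := Int.lt_floor_add_one _
  have hk' : (2 : ℝ) ≤ k := by exact_mod_cast hk
  have hmk : (m : ℝ) ≤ k - 1 := by
    have : (m : ℝ) < k := by linarith
    have : m < k := by exact_mod_cast this
    exact_mod_cast Int.le_sub_one_of_lt this
  have hmk' : (-k : ℝ) + 1 ≤ m := by
    have : (-k : ℝ) < m := by linarith
    have : -k < m := by exact_mod_cast this
    exact_mod_cast this
  rw [abs_lt]
  rcases m1.eq_or_lt with h0 | h0
  · rw [p1 (by linarith)]
    have : (-k : ℝ) + 2 ≤ m := by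
      have : (-k : ℝ) + 1 < m := by linarith
      have : -k + 1 < m := by exact_mod_cast this
      have : -k + 2 ≤ m := by omega
      exact_mod_cast this
    constructor <;> linarith
  · obtain ⟨q1, q2, q3⟩ := p2 ⟨by linarith, by linarith⟩
    rcases lt_trichotomy m 0 with h1 | h1 | h1
    · have h1' : (m : ℝ) ≤ -1 := by exact_mod_cast Int.le_sub_one_of_lt h1
      have := q3 (by linarith)
      constructor <;> linarith [q1.2]
    · rw [h1] at q1
      push_cast at q1
      constructor <;> linarith [q1.1, q1.2]
    · have h1' : (1 : ℝ) ≤ m := by exact_mod_cast h1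
      have := q2 (by linarith)
      constructor <;> linarith [q1.1]

/-- Since 0 is moved by less than 1/4, the germ of `lift g x` at 0 can be cut off inside the box
around 0. Over points outside `Y`, the reflection t ↦ −t gives the same agreement. -/
theorem exists_eq_near_zero (hS : S.StandingAssumption) {H : Subgroup (S.Z ≃ₜ S.Z)}
    (hH : BoxFull H 0 0) {g : S.Z ≃ₜ S.Z} (hg : g ∈ S.typeDGroup hS)
    (hg4 : ∀ x, |lift g x 0| < 1 / 4) :
    ∃ h ∈ S.typeDGroup hS, h ∈ H ∧ ∀ x, ∀ᶠ t in 𝓝 0, lift h x t = lift g x t := by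
  have hd : IsDyadic (1 / 4) := ⟨1, 2, by norm_num⟩
  have hd' : IsDyadic (-(1 / 4)) := hd.neg
  obtain ⟨h, hh, hhH, Y, hY, hYu⟩ := exists_box hS (N := 0) (e := 0) (by norm_num) hH
    (fun y u => ∀ᶠ t in 𝓝 0, u t = lift g y t) fun x => by
      obtain ⟨F, hF, hFl⟩ := exists_eq_lift hg x
      have h0 := abs_lt.1 (hg4 x)
      rw [← hFl] at h0
      obtain ⟨s, r, hs, hr, hs0, hr0, hsub⟩ := exists_dyadic_Icc_subset
        (inter_mem (Ioo_mem_nhds (show (-(1 / 4) : ℝ) < 0 by norm_num) (show (0 : ℝ) < 1 / 4 by norm_num))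
        (F.continuous.continuousAt (Ioo_mem_nhds h0.1 h0.2)))
      have h1 := hsub (left_mem_Icc.2 (hs0.trans hr0).le)
      have h2 := hsub (right_mem_Icc.2 (hs0.trans hr0).le)
      obtain ⟨u, hu, huF, -⟩ := exists_cutoff hd' hd hs hr h1.1.1 (hs0.trans hr0).le h2.1.2 h1.2.1
        h2.2.2 fun t _ => hF t
      refine ⟨-(1 / 4), 1 / 4, by norm_num, by norm_num, u, hu, ?_⟩
      filter_upwards [lift_eventually_forall_eq hg x (isCompact_Icc (a := s) (b := r))] with y hy
      filter_upwards [Icc_mem_nhds hs0 hr0] with t ht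
      rw [hy t ht, huF t ht, hFl]
  refine ⟨h, hh, hhH, fun x => ?_⟩
  have hbox : Ioo ((0 : ℝ) - 1 / 2) (0 + 1 / 2) ∈ 𝓝 (0 : ℝ) := Ioo_mem_nhds (by norm_num) (by norm_num)
  have key : ∀ x ∈ Y, ∀ᶠ t in 𝓝 0, lift h x t = lift g x t := by
    intro x hx
    obtain ⟨u, -, hu, hul⟩ := hYu x hx
    filter_upwards [hu, hbox] with t h1 h2
    rw [hul t h2, h1]
  rcases hY x with hx | hx
  · exact key x hx
  · have hneg : Tendsto (fun t : ℝ => -t) (𝓝 0) (𝓝 0) := by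
      have := (by fun_prop : Continuous fun t : ℝ => -t).tendsto 0
      rwa [neg_zero] at this
    filter_upwards [hneg.eventually (key _ hx)] with t ht
    have h1 := lift_zpow_σ hh 0 x t
    have h2 := lift_zpow_σ hg 0 x t
    simp only [Int.cast_zero, sub_zero] at h1 h2
    rw [h1, h2] at ht
    linarith

/-- By equivariance the lift is the identity near every integer, so on each leaf it splits into
independent pieces supported strictly inside the intervals (n, n + 1). An element of the box around
1/2 reproduces all of them. -/
theorem mem_of_eq_near_zero (hS : S.StandingAssumption) {H : Subgroup (S.Z ≃ₜ S.Z)}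
    (hH : BoxFull H (-1) (1 / 2)) {g : S.Z ≃ₜ S.Z} (hg : g ∈ S.typeDGroup hS)
    (hg0 : ∀ x, ∀ᶠ t in 𝓝 0, lift g x t = t) : g ∈ H := by
  have hg1 : ∀ x, ∀ᶠ t in 𝓝 1, lift g x t = t := by
    intro x
    have : Tendsto (fun t : ℝ => t - 1) (𝓝 1) (𝓝 0) := by
      have := (by fun_prop : Continuous fun t : ℝ => t - 1).tendsto 1
      rwa [sub_self] at this
    filter_upwards [this.eventually (hg0 ((S.φ ^ (1 : ℤ)) x))] with t ht
    have := lift_zpow hg 1 x t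
    rw [Int.cast_one, ht] at this
    linarith
  obtain ⟨h, hh, hhH, Y, hY, hYu⟩ := exists_box hS (N := -1) (e := 1 / 2) (by norm_num) hH
    (fun y u => ∀ t ∈ Ioo (0 : ℝ) 1, u t = lift g y t) fun x => by
      obtain ⟨F, hF, hFl⟩ := exists_eq_lift hg x
      have e1 : F 1 = (1 : ℝ ≃o ℝ) 1 := by rw [hFl, (hg1 x).self_of_nhds, one_apply]
      have e0 : (1 : ℝ ≃o ℝ) 0 = glueIso 1 F 1 e1 0 := by
        rw [coe_glueIso, glueFun_of_le zero_le_one, hFl, (hg0 x).self_of_nhds, one_apply]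
      obtain ⟨l, a, -, -, hl0, ha0, hsub⟩ := exists_dyadic_Icc_subset (hg0 x)
      obtain ⟨b, r, -, -, hb1, hr1, hsub'⟩ := exists_dyadic_Icc_subset (hg1 x)
      have hfix : ∀ t ∉ Ioo a b, glueIso 0 1 (glueIso 1 F 1 e1) e0 t = t := by
        intro t ht
        rw [coe_glueIso]
        rcases le_or_gt t 0 with h | h
        · rw [glueFun_of_le h, one_apply]
        rw [glueFun_of_lt h, coe_glueIso]
        rcases le_or_gt t 1 with h' | h'
        · rw [glueFun_of_le h', hFl]
          rcases le_or_gt t a with h'' | h''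
          · exact hsub ⟨hl0.le.trans h.le, h''⟩
          · exact hsub' ⟨not_lt.1 fun h3 => ht ⟨h'', h3⟩, h'.trans hr1.le⟩
        · rw [glueFun_of_lt h', one_apply]
      refine ⟨a, b, by linarith, by linarith, _, mem_TDOn.2 ⟨glueIso_mem_TD isDyadic_zero
        (one_mem _) (glueIso_mem_TD isDyadic_one hF (one_mem _)), hfix⟩, ?_⟩
      filter_upwards [lift_eventually_forall_eq hg x (isCompact_Icc (a := 0) (b := 1))] with y hy t ht
      rw [coe_glueIso, glueFun_of_lt ht.1, coe_glueIso, glueFun_of_le ht.2.le, hFl,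
        hy t (Ioo_subset_Icc_self ht)]
  have hbox := lift_mem_box hh (by norm_num) hY fun x hx => (hYu x hx).imp fun u hu => ⟨hu.1, hu.2.2⟩
  have i0 : (1 / 2 - 1 / 2 : ℝ) = 0 := by norm_num
  have i1 : (1 / 2 + 1 / 2 : ℝ) = 1 := by norm_num
  rw [i0, i1] at hYu
  rw [i0] at hbox
  have key : ∀ x, ∀ t ∈ Ico (0 : ℝ) 1, lift g x t = lift h x t := by
    intro x t ht
    rcases ht.1.eq_or_lt with rfl | ht0
    · rw [(hg0 x).self_of_nhds, (hbox x).2]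
    rcases hY x with hx | hx
    · obtain ⟨u, -, hu, hul⟩ := hYu x hx
      rw [hul t ⟨ht0, ht.2⟩, hu t ⟨ht0, ht.2⟩]
    · obtain ⟨u, -, hu, hul⟩ := hYu _ hx
      have h1 := lift_zpow_σ hg (-1) x t
      have h2 := lift_zpow_σ hh (-1) x t
      have ht' : -t - ((-1 : ℤ) : ℝ) ∈ Ioo (0 : ℝ) 1 := by
        push_cast
        constructor <;> linarith [ht.2]
      rw [← hu _ ht', ← hul _ ht'] at h1
      linarith
  have : g = h := eq_of_lift_eq hg hh fun x t => by
    have h1 := lift_zpow hg ⌊t⌋ x t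
    have h2 := lift_zpow hh ⌊t⌋ x t
    have := key ((S.φ ^ ⌊t⌋) x) (t - ⌊t⌋) ⟨Int.fract_nonneg t, Int.fract_lt_one t⟩
    linarith
  rwa [this]

/-- A subgroup containing all homeomorphisms supported in the two boxes is the whole group. -/
theorem typeDGroup_le (hS : S.StandingAssumption) {H : Subgroup (S.Z ≃ₜ S.Z)}
    (h0 : BoxFull H 0 0) (h1 : BoxFull H (-1) (1 / 2)) : S.typeDGroup hS ≤ H := by
  have key : ∀ k : ℕ, ∀ g ∈ S.typeDGroup hS, (∀ x, |lift g x 0| < ((k + 1 : ℕ) : ℤ)) → g ∈ H := by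
    intro k
    induction k with
    | zero =>
      intro g hg hgk
      -- A displacement below 1 becomes a displacement below 1/4. Then the germs at time 0 are
      -- matched by `k`, and the quotient is trivial near time 0.
      obtain ⟨h, hh, hhH, hhg⟩ := exists_contract_half hS h1 hg (by norm_num) hgk
      norm_num at hhg
      have hm := mul_mem hh hg
      obtain ⟨k, hk, hkH, hkg⟩ := exists_eq_near_zero hS h0 hm (by norm_num; exact hhg)
      have : k⁻¹ * (h * g) ∈ H := mem_of_eq_near_zero hS h1 (mul_mem (inv_mem hk) hm) fun x => by
        filter_upwards [hkg x] with t ht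
        rw [lift_mul (inv_mem hk) hm, ← ht, ← lift_mul (inv_mem hk) hk, inv_mul_cancel,
          lift_one hS]
      exact (mul_mem_cancel_left hhH).1 ((mul_mem_cancel_left (inv_mem hkH)).1 this)
    | succ k ih =>
      intro g hg hgk
      -- The bound `k + 2` drops to `k + 2 - 3 / 4`, and the other box then brings it to `k + 1`.
      obtain ⟨h, hh, hhH, hhg⟩ := exists_contract_half hS h1 hg (by omega) hgk
      obtain ⟨h', hh', hhH', hhg'⟩ := exists_contract_zero hS h0 (mul_mem hh hg) (by omega) hhg
      have := ih _ (mul_mem hh' (mul_mem hh hg)) fun x => by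
        have := hhg' x
        push_cast at this ⊢
        linarith
      exact (mul_mem_cancel_left hhH).1 ((mul_mem_cancel_left hhH').1 this)
  intro g hg
  obtain ⟨K, hK⟩ := exists_abs_lift_zero_le hg
  obtain ⟨n, hn⟩ := exists_nat_gt K
  refine key n g hg fun x => (hK x).trans_lt (hn.trans ?_)
  push_cast
  linarith

/-! ### Subgroups containing all homeomorphisms supported in a box -/

section Good

/-- Every type `𝔇` automorphism with support in a closed subinterval of `(A, B)` is realised on `E`
by an element of `H`. -/
def GoodOn (H : Subgroup (S.Z ≃ₜ S.Z)) (E : Set X) (A B : ℝ) : Prop :=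
  ∀ a b, A < a → b < B → ∀ f ∈ TDOn a b, ∃ h ∈ H, Acts E f h

/-- The automorphisms supported in `(A, B)` which are realised on `E` by an element of `H`. -/
def realised (H : Subgroup (S.Z ≃ₜ S.Z)) (E D : Set X) (A B : ℝ) : Subgroup (ℝ ≃o ℝ) where
  carrier := {f | f ∈ suppIn A B ∧ ∃ h ∈ H, (E.mulIndicator fun _ => f, h) ∈ S.actRel D A B}
  mul_mem' := by
    rintro f k ⟨hf, h, hh, h1⟩ ⟨hk, h', hh', h2⟩
    refine ⟨mul_mem hf hk, h * h', mul_mem hh hh', ?_⟩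
    have := mul_mem h1 h2
    rwa [Prod.mk_mul_mk, ← mulIndicator_mul'] at this
  one_mem' := ⟨one_mem _, 1, one_mem _, by
    rw [show (fun _ : X => (1 : ℝ ≃o ℝ)) = 1 from rfl, mulIndicator_one']
    exact one_mem _⟩
  inv_mem' := by
    rintro f ⟨hf, h, hh, h1⟩
    refine ⟨inv_mem hf, h⁻¹, inv_mem hh, ?_⟩
    have := inv_mem h1
    rwa [Prod.inv_mk, ← mulIndicator_inv'] at this

variable {H : Subgroup (S.Z ≃ₜ S.Z)} {E E' F C D : Set X} {A B A' B' : ℝ}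

theorem mem_realised_iff (hE : E ⊆ D) (hD : InjOn S.proj (D ×ˢ Ioo A B)) {f : ℝ ≃o ℝ} :
    f ∈ realised H E D A B ↔ f ∈ suppIn A B ∧ ∃ h ∈ H, Acts E f h := by
  refine and_congr_right fun hf => exists_congr fun h => and_congr_right fun _ => ?_
  rw [acts_iff hE hD hf]

theorem goodOn_iff (hE : E ⊆ D) (hD : InjOn S.proj (D ×ˢ Ioo A B)) :
    GoodOn H E A B ↔ ∀ a b, A < a → b < B → TDOn a b ≤ realised H E D A B := by
  refine forall_congr' fun a => forall_congr' fun b => forall_congr' fun ha =>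
    forall_congr' fun hb => forall_congr' fun f => forall_congr' fun hf => ?_
  rw [mem_realised_iff hE hD, and_iff_right]
  exact suppIn_mono ha.le hb.le (TDOn_le_suppIn _ _ hf)

theorem GoodOn.mono (h : GoodOn H E A B) (hA : A ≤ A') (hB : B' ≤ B) : GoodOn H E A' B' :=
  fun a b ha hb => h a b (hA.trans_lt ha) (hb.trans_le hB)

theorem GoodOn.full (h : GoodOn H E A B) {a b : ℝ} (ha : A < a) (hb : b < B) : Full H E a b := by
  intro f hf k hk
  obtain ⟨k', hk', hk'a⟩ := h a b ha hb f hf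
  rwa [hk.unique hk'a]

theorem goodOn_empty : GoodOn H ∅ A B :=
  fun _ _ _ _ _ _ => ⟨1, one_mem _, by simp, fun _ _ => rfl⟩

theorem exists_dyadic_enlarge {a b : ℝ} (hAB : A < B) (ha : A < a) (hb : b < B) :
    ∃ a' b', IsDyadic a' ∧ IsDyadic b' ∧ A < a' ∧ a' < a ∧ b < b' ∧ b' < B ∧ a' < b' := by
  obtain ⟨a', ha', h1, h2⟩ := exists_isDyadic_between
    (lt_min ha (show A < (A + B) / 2 by linarith))
  obtain ⟨b', hb', h3, h4⟩ := exists_isDyadic_between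
    (max_lt hb (show (A + B) / 2 < B by linarith))
  rw [lt_min_iff] at h2
  rw [max_lt_iff] at h3
  exact ⟨a', b', ha', hb', h1, h2.1, h3.1, h4, h2.2.trans h3.2⟩

theorem goodOn_of_closure (hC : InjOn S.proj (C ×ˢ Ioo A B)) {T : Set (ℝ ≃o ℝ)}
    (hT : T ⊆ TDOn A B) (hTH : ∀ f ∈ T, ∃ h ∈ H, Acts C f h)
    (h : ∀ a b, A < a → b < B → TDOn a b ≤ Subgroup.closure T) : GoodOn H C A B := by
  rw [goodOn_iff subset_rfl hC]
  refine fun a b ha hb => (h a b ha hb).trans ((Subgroup.closure_le _).2 fun f hf => ?_)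
  exact (mem_realised_iff subset_rfl hC).2 ⟨TDOn_le_suppIn _ _ (hT hf), hTH f hf⟩

/-- If `h` acts by `f` over `E` and `h'` by `k` over `E'`, then `⁅h, h'⁆` acts by `⁅f, k⁆` over `E ∩
E'` and trivially elsewhere. By `TDOn_le_commutator` such commutators generate everything needed, a
slightly larger dyadic interval absorbing the loss of support. -/
theorem GoodOn.inter (hAB : A < B) (hD : InjOn S.proj (D ×ˢ Ioo A B)) (hED : E ⊆ D)
    (hED' : E' ⊆ D) (hE : GoodOn H E A B) (hE' : GoodOn H E' A B) : GoodOn H (E ∩ E') A B := by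
  rw [goodOn_iff hED hD] at hE
  rw [goodOn_iff hED' hD] at hE'
  rw [goodOn_iff (inter_subset_left.trans hED) hD]
  intro a b ha hb
  obtain ⟨a', b', ha', hb', h1, h2, h3, h4, h5⟩ := exists_dyadic_enlarge hAB ha hb
  refine (TDOn_le_commutator ha' hb' h5 h2 h3).trans (Subgroup.commutator_le.2 fun f hf k hk => ?_)
  obtain ⟨hfs, h, hh, hr⟩ := hE a' b' h1 h4 hf
  obtain ⟨hks, h', hh', hr'⟩ := hE' a' b' h1 h4 hk
  refine ⟨mul_mem (mul_mem (mul_mem hfs hks) (inv_mem hfs)) (inv_mem hks), ⁅h, h'⁆,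
    mul_mem (mul_mem (mul_mem hh hh') (inv_mem hh)) (inv_mem hh'), ?_⟩
  convert mul_mem (mul_mem (mul_mem hr hr') (inv_mem hr)) (inv_mem hr') using 1
  refine Prod.ext (funext fun y => ?_) rfl
  by_cases hy : y ∈ E <;> by_cases hy' : y ∈ E' <;>
    simp [hy, hy', commutatorElement_def]

theorem GoodOn.diff (hD : InjOn S.proj (D ×ˢ Ioo A B)) (hED : E ⊆ D) (hE : GoodOn H E A B)
    (hE' : GoodOn H D A B) : GoodOn H (D \ E) A B := by
  rw [goodOn_iff hED hD] at hE
  rw [goodOn_iff subset_rfl hD] at hE'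
  rw [goodOn_iff sdiff_subset hD]
  intro a b ha hb f hf
  obtain ⟨hfs, h, hh, hr⟩ := hE a b ha hb hf
  obtain ⟨-, h', hh', hr'⟩ := hE' a b ha hb hf
  refine ⟨hfs, h' * h⁻¹, mul_mem hh' (inv_mem hh), ?_⟩
  convert mul_mem hr' (inv_mem hr) using 1
  refine Prod.ext (funext fun y => ?_) rfl
  by_cases hy : y ∈ E
  · simp [hy, hED hy]
  · by_cases hy' : y ∈ D <;> simp [hy, hy']

theorem GoodOn.union_disjoint (hD : InjOn S.proj (D ×ˢ Ioo A B)) (hED : E ⊆ D) (hED' : E' ⊆ D)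
    (hE : GoodOn H E A B) (hE' : GoodOn H E' A B) (hd : Disjoint E E') :
    GoodOn H (E ∪ E') A B := by
  rw [goodOn_iff hED hD] at hE
  rw [goodOn_iff hED' hD] at hE'
  rw [goodOn_iff (union_subset hED hED') hD]
  intro a b ha hb f hf
  obtain ⟨hfs, h, hh, hr⟩ := hE a b ha hb hf
  obtain ⟨-, h', hh', hr'⟩ := hE' a b ha hb hf
  refine ⟨hfs, h * h', mul_mem hh hh', ?_⟩
  convert mul_mem hr hr' using 1
  refine Prod.ext (funext fun y => ?_) rfl
  by_cases hy : y ∈ E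
  · simp [hy, disjoint_left.1 hd hy]
  · by_cases hy' : y ∈ E' <;> simp [hy, hy']

theorem GoodOn.union (hAB : A < B) (hD : InjOn S.proj (D ×ˢ Ioo A B)) (hED : E ⊆ D)
    (hED' : E' ⊆ D) (hE : GoodOn H E A B) (hE' : GoodOn H E' A B) : GoodOn H (E ∪ E') A B := by
  have hi := hE.inter hAB hD hED hED' hE'
  have hd := GoodOn.diff (hD.mono (prod_mono_left hED')) inter_subset_right hi hE'
  have e : E' \ (E ∩ E') = E' \ E := by
    ext y
    simp only [Set.mem_sdiff, mem_inter_iff]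
    tauto
  rw [e] at hd
  rw [← union_sdiff_self]
  exact hE.union_disjoint hD hED (sdiff_subset.trans hED') hd disjoint_sdiff_right

/-- Some `w` realised over all of `C` squeezes the support of `f` into `(a, b)`. Conjugating back an
element that acts over `F` by `w * f * w⁻¹` gives `f` over `F` and nothing elsewhere. -/
theorem GoodOn.spread (hC : InjOn S.proj (C ×ˢ Ioo A B)) (hCg : GoodOn H C A B) (hFC : F ⊆ C)
    {a b : ℝ} (hAa : A ≤ a) (hab : a < b) (hbB : b ≤ B) (hF : GoodOn H F a b) :
    GoodOn H F A B := by
  rw [goodOn_iff hFC hC]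
  intro c d hc hd f hf
  have hAB : A < B := hAa.trans_lt (hab.trans_le hbB)
  obtain ⟨c₁, d₁, hc₁, hd₁, h1, h2, h3, h4, h5⟩ := exists_dyadic_enlarge hAB hc hd
  obtain ⟨a₁, hda₁, k1, k2⟩ := exists_isDyadic_between hab
  obtain ⟨b₁, hdb₁, k3, k4⟩ := exists_isDyadic_between k2
  obtain ⟨r, hr, r1, r2⟩ := exists_isDyadic_between (lt_min h1 (hAa.trans_lt k1))
  obtain ⟨s, hs, s1, s2⟩ := exists_isDyadic_between (max_lt h4 (k4.trans_le hbB))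
  rw [lt_min_iff] at r2
  rw [max_lt_iff] at s1
  obtain ⟨w, hw, wc, wd⟩ := exists_PLOn_apply_eq₂ hr hs hc₁ hd₁ hda₁ hdb₁ r2.1 h5 s1.1 r2.2 k3 s1.2
  have hwT := PLOn_le_TDOn _ _ hw
  have hfT := TDOn_mono h2.le h3.le hf
  have hconj : w * f * w⁻¹ ∈ TDOn a₁ b₁ := by
    refine mem_TDOn.2 ⟨mul_mem (mul_mem (TDOn_le_TD _ _ hwT) (TDOn_le_TD _ _ hf))
      (inv_mem (TDOn_le_TD _ _ hwT)), fun t ht => ?_⟩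
    change w (f (w.symm t)) = t
    rw [TDOn_le_suppIn _ _ hfT (w.symm t), w.apply_symm_apply]
    rintro ⟨h6, h7⟩
    refine ht ⟨?_, ?_⟩
    · rwa [w.lt_symm_apply, wc] at h6
    · rwa [w.symm_apply_lt, wd] at h7
  obtain ⟨h, hh, hr⟩ := hF a₁ b₁ k1 k4 _ hconj
  obtain ⟨-, k, hk, hr'⟩ := (goodOn_iff subset_rfl hC).1 hCg r s r1 s2 hwT
  rw [acts_iff hFC hC (suppIn_mono (hAa.trans k1.le) (k4.le.trans hbB)
    (TDOn_le_suppIn _ _ hconj))] at hr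
  refine ⟨suppIn_mono hc.le hd.le (TDOn_le_suppIn _ _ hf), k⁻¹ * h * k,
    mul_mem (mul_mem (inv_mem hk) hh) hk, ?_⟩
  convert mul_mem (mul_mem (inv_mem hr') hr) hr' using 1
  refine Prod.ext (funext fun y => ?_) rfl
  by_cases hy : y ∈ F
  · simp [hy, hFC hy, mul_assoc]
  · simp [hy]

/-- The two windows overlap, so `TDOn_le_sup` factors an automorphism of their union. -/
theorem GoodOn.glue (hF : InjOn S.proj (F ×ˢ Ioo A B')) (h : GoodOn H F A B)
    (h' : GoodOn H F A' B') (h1 : A < A') (h2 : A' < B) (h3 : B < B') : GoodOn H F A B' := by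
  have hi : ∀ {a b : ℝ}, A < a → b < B' → TDOn a b ≤ suppIn A B' := fun ha hb =>
    (TDOn_le_suppIn _ _).trans (suppIn_mono ha.le hb.le)
  rw [goodOn_iff subset_rfl hF]
  intro c d hc hd
  obtain ⟨c', hc', c1, c2⟩ := exists_isDyadic_between (lt_min hc h1)
  obtain ⟨d', hd', d1, d2⟩ := exists_isDyadic_between (max_lt hd h3)
  obtain ⟨p, hp, p1, p2⟩ := exists_isDyadic_between h2
  obtain ⟨q, hq, q1, q2⟩ := exists_isDyadic_between p2
  rw [lt_min_iff] at c2
  rw [max_lt_iff] at d1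
  refine (TDOn_mono c2.1.le d1.1.le).trans ((TDOn_le_sup hc' hp hq hd' (c2.2.trans p1) q1
    (q2.trans d1.2)).trans (sup_le (fun f hf => ?_) fun f hf => ?_))
  · exact (mem_realised_iff subset_rfl hF).2 ⟨hi c1 (q2.trans h3) hf, h _ _ c1 q2 f hf⟩
  · exact (mem_realised_iff subset_rfl hF).2 ⟨hi (h1.trans p1) d2 hf, h' _ _ p1 d2 f hf⟩

/-- The same homeomorphisms of `Z` are read in a chart translated by an element of the dihedral
group. -/
theorem GoodOn.zpow {n : ℤ} (h : GoodOn H ((S.φ ^ n) ⁻¹' E) (A + n) (B + n)) :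
    GoodOn H E A B := by
  intro a b ha hb f hf
  obtain ⟨k, hk, hkf⟩ := exists_conj_mem_TD (TDOn_le_TD _ _ hf) (-n) (ε := 1) (Or.inl rfl)
  simp only [one_mul, Int.cast_neg, sub_neg_eq_add, ← sub_eq_add_neg] at hkf
  obtain ⟨h', hh', hr⟩ := h (a + n) (b + n) (by linarith) (by linarith) k
    (mem_TDOn.2 ⟨hk, fun t ht => by
      rw [hkf, TDOn_le_suppIn _ _ hf _ fun h => ht ⟨by linarith [h.1], by linarith [h.2]⟩]
      ring⟩)
  refine ⟨h', hh', hr.conj (ε := 1) (n := n) (Or.inl rfl)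
    (fun r => by simpa using proj_zpow n r.1 r.2) fun s => ?_⟩
  rw [one_mul, one_mul, hkf]
  ring_nf

/-! ### Windows of time and the algebra of good clopen sets -/

/-- A finite clopen cover whose members are good on the windows centred at `1`, `1 / 2`, `0`,
`-1 / 2`. -/
structure GoodCover (H : Subgroup (S.Z ≃ₜ S.Z)) (t : Finset X) (C : X → Set X) : Prop where
  clopen : ∀ x ∈ t, IsClopen (C x)
  cover : ∀ y, ∃ x ∈ t, y ∈ C x
  disjoint : ∀ x ∈ t, ∀ N : ℤ, -2 ≤ N → N ≤ 1 → ∀ y ∈ C x, (S.φ ^ N) (S.σ y) ∉ C x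
  goodOn : ∀ x ∈ t, ∀ N : ℤ, -2 ≤ N → N ≤ 1 → GoodOn H (C x) (-N / 2 - 7 / 16) (-N / 2 + 7 / 16)

namespace GoodCover

variable {t : Finset X} {C : X → Set X}

/-- The window lies inside the fundamental domain `[0, 1 / 2]` of the dihedral action on the line.
No condition on the base is needed there, so goodness on this window can be combined over arbitrary
subsets of `X`. -/
theorem injOn_univ : InjOn S.proj (univ ×ˢ Ioo (1 / 16) (7 / 16)) := by
  rintro ⟨y, s⟩ ⟨-, hs⟩ ⟨y', s'⟩ ⟨-, hs'⟩ h
  simp only [mem_Ioo] at hs hs'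
  obtain ⟨n, h | h⟩ := S.proj_eq_iff.1 h
  · simp only [Prod.mk.injEq] at h
    have h1 : |(n : ℝ)| < 1 := by
      rw [abs_lt]
      constructor <;> linarith [h.2]
    have h2 : n = 0 := Int.abs_lt_one_iff.1 (by exact_mod_cast h1)
    subst h2
    simp only [zpow_zero, Int.cast_zero, sub_zero] at h
    exact Prod.ext h.1.symm h.2.symm
  · simp only [Prod.mk.injEq] at h
    have h1 : (-1 : ℝ) < n := by linarith [h.2]
    have h2 : (n : ℝ) < 0 := by linarith [h.2]
    have h3 : (-1 : ℤ) < n := by exact_mod_cast h1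
    have h4 : n < 0 := by exact_mod_cast h2
    omega

theorem injOn (hC : GoodCover H t C) {x : X} (hx : x ∈ t) {N : ℤ} (h1 : -2 ≤ N) (h2 : N ≤ 1) :
    InjOn S.proj (C x ×ˢ Ioo (-(N : ℝ) / 2 - 7 / 16) (-N / 2 + 7 / 16)) :=
  (injOn_box (N := N) (e := -N / 2) (by ring) (hC.disjoint x hx N h1 h2)).mono
    (prod_mono_right (Ioo_subset_Ioo (by linarith) (by linarith)))

/-- The interval `(1 / 16, 7 / 16)` is contained in the windows around 0 and 1/2, and these overlap
the windows around −1/2 and 1 respectively. Two applications of `GoodOn.spread` thus reach all four.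
-/
theorem goodOn_windows (hC : GoodCover H t C) {x : X} (hx : x ∈ t) (hF : F ⊆ C x)
    (h : GoodOn H F (1 / 16) (7 / 16)) : GoodOn H F (-15 / 16) (-1 / 16) ∧
      GoodOn H F (-7 / 16) (7 / 16) ∧ GoodOn H F (1 / 16) (15 / 16) ∧
      GoodOn H F (9 / 16) (23 / 16) := by
  have key : ∀ (N : ℤ), -2 ≤ N → N ≤ 1 → ∀ a b : ℝ, -N / 2 - 7 / 16 ≤ a → a < b →
      b ≤ -N / 2 + 7 / 16 → GoodOn H F a b → GoodOn H F (-N / 2 - 7 / 16) (-N / 2 + 7 / 16) :=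
    fun N h1 h2 a b ha hab hb h =>
      GoodOn.spread (hC.injOn hx h1 h2) (hC.goodOn x hx N h1 h2) hF ha hab hb h
  have w0 : GoodOn H F (-7 / 16) (7 / 16) := by
    have := key 0 (by norm_num) (by norm_num) _ _ (by norm_num) (by norm_num) (by norm_num) h
    norm_num at this ⊢
    exact this
  have w1 : GoodOn H F (1 / 16) (15 / 16) := by
    have := key (-1) (by norm_num) (by norm_num) _ _ (by norm_num) (by norm_num) (by norm_num) h
    norm_num at this ⊢
    exact this
  refine ⟨?_, w0, w1, ?_⟩
  · have := key 1 (by norm_num) (by norm_num) _ _ (by norm_num) (by norm_num) (by norm_num)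
      (w0.mono (A' := -7 / 16) (B' := -1 / 16) (by norm_num) (by norm_num))
    norm_num at this ⊢
    exact this
  · have := key (-2) (by norm_num) (by norm_num) _ _ (by norm_num) (by norm_num) (by norm_num)
      (w1.mono (A' := 9 / 16) (B' := 15 / 16) (by norm_num) (by norm_num))
    norm_num at this ⊢
    exact this

theorem inter (hE : GoodOn H E (1 / 16) (7 / 16)) (hE' : GoodOn H E' (1 / 16) (7 / 16)) :
    GoodOn H (E ∩ E') (1 / 16) (7 / 16) :=
  hE.inter (by norm_num) injOn_univ (subset_univ _) (subset_univ _) hE'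

theorem biUnion {ι : Type*} (s : Finset ι) (G : ι → Set X)
    (h : ∀ i ∈ s, GoodOn H (G i) (1 / 16) (7 / 16)) :
    GoodOn H (⋃ i ∈ s, G i) (1 / 16) (7 / 16) := by
  classical
  induction s using Finset.induction_on with
  | empty => simpa using goodOn_empty
  | insert i s _ ih =>
    rw [Finset.set_biUnion_insert]
    exact (h i (Finset.mem_insert_self _ _)).union (by norm_num) injOn_univ (subset_univ _)
      (subset_univ _) (ih fun j hj => h j (Finset.mem_insert_of_mem hj))

theorem goodOn_self (hC : GoodCover H t C) {x : X} (hx : x ∈ t) :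
    GoodOn H (C x) (1 / 16) (7 / 16) :=
  (hC.goodOn x hx 0 (by norm_num) (by norm_num)).mono (by norm_num) (by norm_num)

theorem biUnion_inter (hC : GoodCover H t C) (E : Set X) : ⋃ x ∈ t, E ∩ C x = E := by
  rw [← inter_iUnion₂, inter_eq_left]
  intro y _
  obtain ⟨x, hx, hy⟩ := hC.cover y
  exact mem_iUnion₂.2 ⟨x, hx, hy⟩

theorem univ (hC : GoodCover H t C) : GoodOn H (univ : Set X) (1 / 16) (7 / 16) := by
  have := biUnion t C fun x hx => hC.goodOn_self hx
  have h := hC.biUnion_inter Set.univ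
  simp only [univ_inter] at h
  rwa [h] at this

/-- The pieces of `E` inside members of the cover are good on the windows around −1/2 and 1, which
contain the translates of `(1 / 16, 7 / 16)` by −1 and by 1. Read in the translated chart, this is
goodness of the pieces of the translate of `E`. -/
theorem shift (hC : GoodCover H t C) {n : ℤ} (hn : n = 1 ∨ n = -1)
    (hE : GoodOn H E (1 / 16) (7 / 16)) :
    GoodOn H ((S.φ ^ n) ⁻¹' E) (1 / 16) (7 / 16) := by
  rw [← hC.biUnion_inter E, preimage_iUnion₂]
  refine biUnion t _ fun x hx => ?_
  have h := hC.goodOn_windows hx inter_subset_right (inter hE (hC.goodOn_self hx))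
  refine GoodOn.zpow (n := -n) ?_
  have e : (S.φ ^ (-n)) ⁻¹' ((S.φ ^ n) ⁻¹' (E ∩ C x)) = E ∩ C x := by
    ext y
    rw [mem_preimage, mem_preimage, zpow_zpow, add_neg_cancel]
    rfl
  rw [e]
  rcases hn with rfl | rfl
  · exact h.1.mono (by norm_num) (by norm_num)
  · exact h.2.2.2.mono (by norm_num) (by norm_num)

theorem zpow (hC : GoodCover H t C) (hE : GoodOn H E (1 / 16) (7 / 16)) (n : ℤ) :
    GoodOn H ((S.φ ^ n) ⁻¹' E) (1 / 16) (7 / 16) := by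
  have step : ∀ m n : ℤ, (S.φ ^ m) ⁻¹' ((S.φ ^ n) ⁻¹' E) = (S.φ ^ (n + m)) ⁻¹' E := fun m n => by
    ext y
    rw [mem_preimage, mem_preimage, zpow_zpow]
    rfl
  induction n with
  | zero => exact hE
  | succ n ih =>
    rw [← step]
    exact hC.shift (Or.inl rfl) ih
  | pred n ih =>
    rw [sub_eq_add_neg, ← step]
    exact hC.shift (Or.inr rfl) ih

/-- Over a clopen piece contained in a member of the cover, three consecutive windows, truncated to
the box, cover the box and are glued. The pieces are then made disjoint and assembled to `E`. -/
theorem boxFull (hC : GoodCover H t C)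
    (hcl : ∀ E, IsClopen E → GoodOn H E (1 / 16) (7 / 16)) {N : ℤ} {e : ℝ} (he : 2 * e = -N)
    (hN : N = 0 ∨ N = -1) : BoxFull H N e := by
  intro E hE hEd a b ha hb
  refine GoodOn.full ?_ ha hb
  have hinj := injOn_box he hEd
  have piece : ∀ x ∈ t, ∀ F, IsClopen F → F ⊆ E → F ⊆ C x →
      GoodOn H F (e - 1 / 2) (e + 1 / 2) := by
    intro x hx F hF hFE hFC
    have hFi := hinj.mono (prod_mono_left hFE)
    obtain ⟨w1, w2, w3, w4⟩ := hC.goodOn_windows hx hFC (hcl F hF)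
    rcases hN with rfl | rfl
    · obtain rfl : e = 0 := by
        push_cast at he
        linarith
      rw [show (0 - 1 / 2 : ℝ) = -8 / 16 by norm_num, show (0 + 1 / 2 : ℝ) = 8 / 16 by norm_num]
        at hFi ⊢
      have h1 := GoodOn.glue (hFi.mono (prod_mono_right (Ioo_subset_Ioo_right (by norm_num))))
        (w1.mono (A' := -8 / 16) (by norm_num) le_rfl) w2 (by norm_num) (by norm_num) (by norm_num)
      exact GoodOn.glue hFi h1 (w3.mono (B' := 8 / 16) le_rfl (by norm_num)) (by norm_num)
        (by norm_num) (by norm_num)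
    · obtain rfl : e = 1 / 2 := by
        push_cast at he
        linarith
      rw [show (1 / 2 - 1 / 2 : ℝ) = 0 by norm_num, show (1 / 2 + 1 / 2 : ℝ) = 1 by norm_num]
        at hFi ⊢
      have h1 := GoodOn.glue (hFi.mono (prod_mono_right (Ioo_subset_Ioo_right (by norm_num))))
        (w2.mono (A' := 0) (by norm_num) le_rfl) w3 (by norm_num) (by norm_num) (by norm_num)
      exact GoodOn.glue hFi h1 (w4.mono (B' := 1) le_rfl (by norm_num)) (by norm_num)
        (by norm_num) (by norm_num)
  have key : ∀ s ⊆ t, IsClopen (⋃ x ∈ s, E ∩ C x) ∧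
      GoodOn H (⋃ x ∈ s, E ∩ C x) (e - 1 / 2) (e + 1 / 2) := by
    classical
    intro s
    induction s using Finset.induction_on with
    | empty => exact fun _ => by simpa using ⟨isClopen_empty, goodOn_empty⟩
    | insert x s _ ih =>
      intro hs
      obtain ⟨h1, h2⟩ := ih ((Finset.subset_insert x s).trans hs)
      have hx := hs (Finset.mem_insert_self x s)
      have hc := hE.inter (hC.clopen x hx)
      rw [Finset.set_biUnion_insert, union_comm]
      refine ⟨h1.union hc, ?_⟩
      rw [← union_sdiff_self]
      exact h2.union_disjoint hinj (iUnion₂_subset fun _ _ => inter_subset_left)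
        (sdiff_subset.trans inter_subset_left)
        (piece x hx _ (hc.diff h1) (sdiff_subset.trans inter_subset_left)
          (sdiff_subset.trans inter_subset_right)) disjoint_sdiff_right
  have := (key t subset_rfl).2
  rwa [hC.biUnion_inter] at this

end GoodCover

end Good

/-! ### Finite generation -/

/-- Members of the cover are taken small enough for `κ` to be constant and for the four reflections
`φ ^ N σ` to displace them. Finiteness comes from the finite number of members and windows, and from
the finite generating sets of `exists_TDOn_generators`. -/
theorem exists_goodCover (hS : S.StandingAssumption) {k : ℕ} {κ : X → Fin k}
    (hκ : Continuous κ) : ∃ T : Set (S.Z ≃ₜ S.Z), T.Finite ∧ T ⊆ S.typeDGroup hS ∧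
      ∃ (t : Finset X) (C : X → Set X), GoodCover (Subgroup.closure T) t C ∧
        ∀ x, ∀ y ∈ C x, κ y = κ x := by
  have := hS.compact
  have := hS.metrizable
  have := hS.totallyDisconnected
  have hC : ∀ x, ∃ C : Set X, IsClopen C ∧ x ∈ C ∧ (∀ y ∈ C, κ y = κ x) ∧
      ∀ N : ℤ, -2 ≤ N → N ≤ 1 → ∀ y ∈ C, (S.φ ^ N) (S.σ y) ∉ C := by
    intro x
    have h1 : ∀ N : ℤ, ∃ E : Set X, E ∈ 𝓝 x ∧ ∀ y ∈ E, (S.φ ^ N) (S.σ y) ∉ E := by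
      intro N
      obtain ⟨V, W, hV, hW, hxV, hxW, hVW⟩ := t2_separation (hS.zpow_σ_ne N x)
      exact ⟨_, inter_mem ((hV.preimage (continuous_zpow_σ N)).mem_nhds hxV) (hW.mem_nhds hxW),
        fun y hy hy' => disjoint_left.1 hVW hy.1 hy'.2⟩
    choose E hE hEd using h1
    have h2 : (⋂ N ∈ Finset.Icc (-2 : ℤ) 1, E N) ∩ κ ⁻¹' {κ x} ∈ 𝓝 x :=
      inter_mem ((Finset.iInter_mem_sets _).2 fun N _ => hE N)
        (hκ.continuousAt.preimage_mem_nhds ((isOpen_discrete _).mem_nhds rfl))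
    obtain ⟨C, hC, hxC, hCs⟩ := compact_exists_isClopen_in_isOpen isOpen_interior
      (mem_interior_iff_mem_nhds.2 h2)
    have hCs' := hCs.trans interior_subset
    refine ⟨C, hC, hxC, fun y hy => (hCs' hy).2, fun N hN1 hN2 y hy hy' => ?_⟩
    have hN := Finset.mem_Icc.2 ⟨hN1, hN2⟩
    exact hEd N y (mem_iInter₂.1 (hCs' hy).1 N hN) (mem_iInter₂.1 (hCs' hy').1 N hN)
  choose C hCc hxC hCκ hCd using hC
  obtain ⟨t, ht⟩ := isCompact_univ.elim_nhds_subcover C fun x _ => (hCc x).isOpen.mem_nhds (hxC x)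
  have hT : ∀ N : ℤ, ∃ T : Set (ℝ ≃o ℝ), T.Finite ∧
      T ⊆ TDOn (-N / 2 - 7 / 16) (-N / 2 + 7 / 16) ∧ ∀ a b : ℝ, (-N / 2 - 7 / 16 : ℝ) < a →
        b < -N / 2 + 7 / 16 → TDOn a b ≤ Subgroup.closure T := fun N =>
    exists_TDOn_generators (a := -N / 2 - 7 / 16) (b := -N / 2 + 7 / 16) ⟨-8 * N - 7, 4, by push_cast; ring⟩
      ⟨-8 * N + 7, 4, by push_cast; ring⟩ (by linarith)
  choose T hTf hTs hTg using hT
  have hbox : ∀ (N : ℤ), -2 ≤ N → N ≤ 1 → ∀ x, InjOn S.proj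
      (C x ×ˢ Ioo (-(N : ℝ) / 2 - 1 / 2) (-N / 2 + 1 / 2)) := fun N h1 h2 x =>
    injOn_box (N := N) (e := -N / 2) (by ring) (hCd x N h1 h2)
  -- The value 1 for irrelevant triples makes a global choice possible. The windows have radius 7/16
  -- < 1/2, which leaves the margin inside the box that `exists_acts` requires.
  have hex : ∀ x, ∀ N : ℤ, ∀ f : ℝ ≃o ℝ, ∃ h, h ∈ S.typeDGroup hS ∧
      (-2 ≤ N → N ≤ 1 → f ∈ T N → Acts (C x) f h) := by
    intro x N f
    by_cases hf : -2 ≤ N ∧ N ≤ 1 ∧ f ∈ T N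
    · obtain ⟨h, hh, ha⟩ := hS.exists_acts (hCc x) (hbox N hf.1 hf.2.1 x) (hTs N hf.2.2)
        (by linarith) (by linarith)
      exact ⟨h, hh, fun _ _ _ => ha⟩
    · exact ⟨1, one_mem _, fun h1 h2 h3 => absurd ⟨h1, h2, h3⟩ hf⟩
  choose h hh ha using hex
  refine ⟨⋃ x ∈ t, ⋃ N ∈ Finset.Icc (-2 : ℤ) 1, h x N '' T N, ?_, ?_, t, C,
    ⟨fun x _ => hCc x, fun y => ?_, fun x _ N h1 h2 => hCd x N h1 h2, fun x hx N h1 h2 => ?_⟩, hCκ⟩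
  · exact t.finite_toSet.biUnion fun x _ => (Finset.finite_toSet _).biUnion fun N _ =>
      (hTf N).image _
  · refine iUnion₂_subset fun x _ => iUnion₂_subset fun N _ => ?_
    rintro _ ⟨f, -, rfl⟩
    exact hh x N f
  · simpa using ht.2 (mem_univ y)
  · refine goodOn_of_closure ((hbox N h1 h2 x).mono (prod_mono_right (Ioo_subset_Ioo
      (by linarith) (by linarith)))) (hTs N) (fun f hf => ⟨h x N f, Subgroup.subset_closure ?_,
        ha x N f h1 h2 hf⟩) (hTg N)
    exact mem_iUnion₂.2 ⟨x, hx, mem_iUnion₂.2 ⟨N, Finset.mem_Icc.2 ⟨h1, h2⟩, f, hf, rfl⟩⟩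

/-- The members of the cover carrying a given letter unite to a cylinder at position 0, and shifts
give the cylinders at the other positions. Their finite intersections form a basis, so a compact
open set is a finite union of good sets. -/
theorem GoodCover.goodOn_of_isClopen [CompactSpace X] {H : Subgroup (S.Z ≃ₜ S.Z)} {t : Finset X}
    {C : X → Set X} (hC : GoodCover H t C) {k : ℕ} {ι : X → ℤ → Fin k} (hι : IsInducing ι)
    (hshift : ∀ x n, ι (S.φ x) n = ι x (n + 1)) (hCι : ∀ x, ∀ y ∈ C x, ι y 0 = ι x 0)
    {E : Set X} (hE : IsClopen E) : GoodOn H E (1 / 16) (7 / 16) := by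
  classical
  have hzpow : ∀ (n : ℤ) x m, ι ((S.φ ^ n) x) m = ι x (m + n) := by
    intro n
    induction n with
    | zero => simp
    | succ n ih =>
      intro x m
      rw [add_comm (n : ℤ) 1, zpow_add, zpow_one, Homeomorph.mul_apply, hshift, ih]
      congr 1
      ring
    | pred n ih =>
      intro x m
      have h1 := hshift ((S.φ ^ (-(n : ℤ) - 1)) x) (m - 1)
      have h2 := S.zpow_zpow 1 (-(n : ℤ) - 1) x
      rw [zpow_one, show 1 + (-(n : ℤ) - 1) = -n by ring] at h2
      rw [h2, ih, sub_add_cancel] at h1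
      rw [← h1]
      congr 1
      ring
  have hcyl : ∀ (n : ℤ) (c : Fin k), GoodOn H {y | ι y n = c} (1 / 16) (7 / 16) := by
    intro n c
    have h0 : GoodOn H {y | ι y 0 = c} (1 / 16) (7 / 16) := by
      have := biUnion (H := H) (t.filter fun x => ι x 0 = c) C fun x hx =>
        hC.goodOn_self (Finset.mem_filter.1 hx).1
      convert this using 1
      ext y
      simp only [mem_ofPred_eq, mem_iUnion, Finset.mem_filter, exists_prop]
      constructor
      · intro hy
        obtain ⟨x, hx, hyx⟩ := hC.cover y
        exact ⟨x, ⟨hx, by rw [← hCι x y hyx, hy]⟩, hyx⟩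
      · rintro ⟨x, ⟨-, hx⟩, hyx⟩
        rw [hCι x y hyx, hx]
    have := hC.zpow h0 n
    convert this using 1
    ext y
    simp only [mem_preimage, mem_ofPred_eq, hzpow, zero_add]
  have hloc : ∀ x ∈ E, ∃ G ∈ 𝓝 x, G ⊆ E ∧ GoodOn H G (1 / 16) (7 / 16) := by
    intro x hx
    have h1 := hE.isOpen.mem_nhds hx
    rw [hι.nhds_eq_comap, nhds_pi] at h1
    obtain ⟨V, hV, hVE⟩ := h1
    obtain ⟨I, hI, W, hW, hIW⟩ := Filter.mem_pi.1 hV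
    have hfin : ∀ J : Finset ℤ, GoodOn H (⋂ n ∈ J, {y | ι y n = ι x n}) (1 / 16) (7 / 16) := by
      intro J
      induction J using Finset.induction_on with
      | empty => simpa using hC.univ
      | insert n J _ ih =>
        rw [Finset.set_biInter_insert]
        exact inter (hcyl n _) ih
    refine ⟨⋂ n ∈ hI.toFinset, {y | ι y n = ι x n}, (Finset.iInter_mem_sets _).2 fun n _ => ?_,
      fun y hy => hVE (hIW fun n hn => ?_), hfin _⟩
    · have : Continuous fun y => ι y n := (continuous_apply n).comp hι.continuous
      exact this.continuousAt.preimage_mem_nhds ((isOpen_discrete {ι x n}).mem_nhds rfl)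
    · have : ι y n = ι x n := mem_iInter₂.1 hy n (hI.mem_toFinset.2 hn)
      rw [this]
      exact mem_of_mem_nhds (hW n)
  choose! G hG hGE hGg using hloc
  obtain ⟨s, hs⟩ := hE.isClosed.isCompact.elim_nhds_subcover G hG
  have : E = ⋃ x ∈ s, G x :=
    subset_antisymm hs.2 (iUnion₂_subset fun x hx => hGE x (hs.1 x hx))
  rw [this]
  exact biUnion s G fun x hx => hGg x (hs.1 x hx)

end ReversibleSystem

end DihedralSuspension

theorem theorem3p8 {X : Type*} [TopologicalSpace X] (S : DihedralSuspension.ReversibleSystem X)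
    (hS : S.StandingAssumption) (hsub : S.IsSubshift) : (S.typeDGroup hS).FG := by
  obtain ⟨k, ι, hι, hshift⟩ := hsub
  have := hS.compact
  -- The cover is required to refine the partition by the letter at position 0, so that all
  -- cylinders are generated from it.
  obtain ⟨T, hT, hTs, t, C, hC, hCι⟩ := DihedralSuspension.ReversibleSystem.exists_goodCover hS
    (κ := fun x => ι x 0) ((continuous_apply 0).comp hι.continuous)
  have hcl := fun E (hE : IsClopen E) =>
    hC.goodOn_of_isClopen hι.isInducing hshift hCι hE
  refine (Subgroup.fg_iff _).2 ⟨T, le_antisymm ((Subgroup.closure_le _).2 hTs)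
    (DihedralSuspension.ReversibleSystem.typeDGroup_le hS ?_ ?_), hT⟩
  · exact hC.boxFull hcl (by norm_num) (Or.inl rfl)
  · exact hC.boxFull hcl (by norm_num) (Or.inr rfl)
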